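/- Let $k,\ell\ge 1$ be coprime integers and let $u,v$ be the integers with $ku-\ell v=1$, $1\le u\le \ell$, $0\le v\le k$. Let $n\ge 1$, $\varepsilon_0,\varepsilon_\infty\in\{0,1\}$, let $f=x^{\varepsilon_0}y^{\varepsilon_\infty}\prod_{i=1}^n(y^k-s_ix^\ell)$ with distinct $s_i\in\mathbb C^*$, and let $d=nk\ell+k\varepsilon_0+\ell\varepsilon_\infty$. Let $\sigma$ be the composition of blow-ups which separates the curves $y^k=sx^\ell$, $s\in\mathbb C^*$; near the principal component $D_c$ (the one created last) it is covered by two charts in which $$\sigma(x_c,y_c)=(x_c^{k-v}y_c^k,\;x_c^{\ell-u}y_c^\ell),\qquad \sigma(x_{c-1},y_{c-1})=(x_{c-1}^{k}y_{c-1}^{v},\;x_{c-1}^{\ell}y_{c-1}^{u}),\qquad D_c=\{y_c=0\}=\{x_{c-1}=0\}.$$ Let $\omega=a\,dx+b\,dy$ be a germ of holomorphic $1$-form on $(\mathbb C^2,0)$ with $a,b$ having no common zero except possibly $0$, defining a foliation $\mathcal F$, such that: every component of the exceptional divisor of $\sigma$ is invariant under the strict transform $\tilde{\mathcal F}$ of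 $\mathcal F$ by $\sigma$; all singularities of $\tilde{\mathcal F}$ are reduced and none is a saddle-node; the union of the separatrices of $\mathcal F$ is topologically conjugated to $\{f=0\}$; $x^{\varepsilon_0}y^{\varepsilon_\infty}=0$ is invariant; and $\sigma$ desingularizes the separatrices as it does $f$, that is, apart from the axis branches in $\{x^{\varepsilon_0}y^{\varepsilon_\infty}=0\}$, the points where their strict transforms meet the exceptional divisor are exactly $n$ points $z_i=(x_c=1/c_i,\,y_c=0)$ of $D_c$, with $c_1,\dots,c_n\in\mathbb C^*$ distinct. Let $\lambda_i$ ($1\le i\le n$), $\lambda_0$, $\lambda_\infty$ be the Camacho–Sad indices of $\tilde{\mathcal F}$ relative to $D_c$ at $z_i$, at $x_c=0$ and at $x_c=\infty$ respectively, where the index at $(p,0)$ relative to $\{y=0\}$ of a foliation $\hat a\,dx+\hat b\,dy=0$ is $-\mathrm{Res}_{x=p}\,\frac{\partial}{\partial y}\bigl(\hat a/\hat b\bigr)(x,0)$. For each $m$ let $\omega_m=a_{m-k}dx+b_{m-\ell}dy$, where $a_j,b_j$ are the $(k,\ell)$-quasi-homogeneous components of degree $j$ of $a,b$ (weights $k$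 for $x$, $\ell$ for $y$), and let $q_d$ be the component of degree $d$ of $q=kxa+\ell yb$. Then $\omega_m=0$ for all $m<d$, there is $c_0\ne 0$ with $q_d=c_0x^{\varepsilon_0}y^{\varepsilon_\infty}\prod_{i=1}^n(y^k-c_ix^\ell)$, and the initial part of $\omega$ is $$\omega_d=-q_d\left(\sum_{i=1}^n\lambda_i\frac{d(y^k-c_ix^\ell)}{y^k-c_ix^\ell}+\varepsilon_0\bigl(\ell(\lambda_0+1)-u\bigr)\frac{dx}{x}+\varepsilon_\infty\bigl(k\lambda_\infty+v\bigr)\frac{dy}{y}\right),$$ where $$\sum_{i=1}^n\lambda_i+\varepsilon_0\Bigl(\lambda_0+\frac{\ell-u}{\ell}\Bigr)+\varepsilon_\infty\Bigl(\lambda_\infty+\frac{v}{k}\Bigr)+\frac1{k\ell}=0.$$ -/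

import Mathlib

open Filter Topology

noncomputable section

namespace TQH

/-- A differential form `a dx + b dy` on (an open subset of) `ℂ²` is given by its pair of
coefficients `z ↦ (a z, b z)`. Germs at `0` are represented by functions; only their values
near the point under consideration are ever used. -/
abbrev Form := ℂ × ℂ → ℂ × ℂ

/-- The covector `p.1 dx + p.2 dy`. -/
def covector (p : ℂ × ℂ) : ℂ × ℂ →L[ℂ] ℂ :=
  p.1 • ContinuousLinearMap.fst ℂ ℂ ℂ + p.2 • ContinuousLinearMap.snd ℂ ℂ ℂ

/-- The logarithmic differential `dg / g` at `z`. -/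
def dlog (g : ℂ × ℂ → ℂ) (z : ℂ × ℂ) : ℂ × ℂ →L[ℂ] ℂ :=
  (g z)⁻¹ • fderiv ℂ g z

/-! ### Quasi-homogeneous components -/

/-- The `(k, l)`-quasi-homogeneous component of degree `m` of a germ `g`: the coefficient of `t ^ m`
in the expansion of `g (t ^ k x, t ^ l y)`, that is the sum of the Taylor monomials
`g_{ij} x ^ i y ^ j` with `k i + l j = m`. -/
def qhPart (k l m : ℕ) (g : ℂ × ℂ → ℂ) (z : ℂ × ℂ) : ℂ :=
  iteratedDeriv m (fun t : ℂ => g (t ^ k * z.1, t ^ l * z.2)) 0 / (m.factorial : ℂ)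

/-- The `(k, l)`-quasi-homogeneous component `ω_m = a_{m-k} dx + b_{m-l} dy` of degree `m` of
`ω = a dx + b dy`: the coefficient of `t ^ m` in the pull-back of `ω` by
`(x, y) ↦ (t ^ k x, t ^ l y)`. -/
def formPart (k l m : ℕ) (ω : Form) (z : ℂ × ℂ) : ℂ × ℂ :=
  (iteratedDeriv m (fun t : ℂ => t ^ k * (ω (t ^ k * z.1, t ^ l * z.2)).1) 0 / (m.factorial : ℂ),
   iteratedDeriv m (fun t : ℂ => t ^ l * (ω (t ^ k * z.1, t ^ l * z.2)).2) 0 / (m.factorial : ℂ))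

/-- `q = k x a + l y b`, the contraction of `ω = a dx + b dy` with the quasi-radial field. -/
def radial (k l : ℕ) (ω : Form) (z : ℂ × ℂ) : ℂ :=
  (k : ℂ) * z.1 * (ω z).1 + (l : ℂ) * z.2 * (ω z).2

/-- The reduced quasi-homogeneous function `x ^ ε₀ y ^ ε∞ ∏ (y ^ k - s i x ^ l)`. -/
def qhFun (k l ε₀ εinf : ℕ) {n : ℕ} (s : Fin n → ℂ) (z : ℂ × ℂ) : ℂ :=
  z.1 ^ ε₀ * z.2 ^ εinf * ∏ i, (z.2 ^ k - s i * z.1 ^ l)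

/-! ### The desingularization map -/

/-- The chain of divisors on the surface obtained from `(ℂ², 0)` by blowing up, successively,
the common infinitely near points of the curves `y ^ k = c x ^ l` until these curves are
separated. A divisor is recorded by its weight (order of `x` along it, order of `y` along it).
The list starts with the strict transform `(0, 1)` of `{y = 0}`, ends with the strict transform
`(1, 0)` of `{x = 0}`, and the entries between them are the components `D_1, …, D_N` of the
exceptional divisor; consecutive divisors meet.

If `l < k` the curves pass, after one blow-up `(x, y) = (X Y, Y)`, through the origin of the chart
`(X, Y)` and become there `Y ^ (k - l) = c X ^ l`; if `k < l` they pass, after one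
blow-up `(x, y) = (X, X Y)`, through the origin of `(X, Y)` and become `Y ^ k = c X ^ (l - k)`. -/
def divisors : ℕ → ℕ → List (ℕ × ℕ)
  | k, l =>
    if k = 0 ∨ l = 0 ∨ k = l then [(0, 1), (1, 1), (1, 0)]
    else if l < k then
      (0, 1) :: (divisors (k - l) l).map fun w => (w.1 + w.2, w.2)
    else
      (divisors k (l - k)).map (fun w => (w.1, w.1 + w.2)) ++ [(1, 0)]
  termination_by k l => k + l
  decreasing_by all_goals omega

/-- `V` and `W` are the weights of the divisors `{x = 0}` and `{y = 0}` of one of the `N + 1`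
charts which cover a neighbourhood of the exceptional divisor. -/
def IsChart (k l : ℕ) (V W : ℕ × ℕ) : Prop := [W, V] <:+: divisors k l

/-- The desingularization map `σ` in the chart with weights `V`, `W`. -/
def chartMap (V W : ℕ × ℕ) (z : ℂ × ℂ) : ℂ × ℂ :=
  (z.1 ^ V.1 * z.2 ^ W.1, z.1 ^ V.2 * z.2 ^ W.2)

/-- The pull-back `σ^* ω` in the chart with weights `V`, `W`. -/
def pullback (ω : Form) (V W : ℕ × ℕ) : Form := fun z =>
  ((ω (chartMap V W z)).1 * (V.1 * z.1 ^ (V.1 - 1) * z.2 ^ W.1) +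
      (ω (chartMap V W z)).2 * (V.2 * z.1 ^ (V.2 - 1) * z.2 ^ W.2),
   (ω (chartMap V W z)).1 * (z.1 ^ V.1 * (W.1 * z.2 ^ (W.1 - 1))) +
      (ω (chartMap V W z)).2 * (z.1 ^ V.2 * (W.2 * z.2 ^ (W.2 - 1))))

/-- `η` defines the strict transform of the foliation `ω = 0` in a chart, near the exceptional
divisor `σ⁻¹(0)`: it is holomorphic there with isolated zeros, and it is obtained from `σ^* ω` by
division by a monomial. -/
def IsStrictTransform (ω : Form) (V W : ℕ × ℕ) (η : Form) : Prop :=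
  ∃ α β : ℕ, ∀ P : ℂ × ℂ, chartMap V W P = 0 →
    AnalyticAt ℂ η P ∧
    (∀ᶠ z in 𝓝 P, pullback ω V W z = (z.1 ^ α * z.2 ^ β) • η z) ∧
    (∀ᶠ z in 𝓝[≠] P, η z ≠ 0)

/-- Every component of the exceptional divisor in the chart is invariant: the component `{x = 0}`
if it is exceptional (that is, if `x` and `y` both vanish along it), and likewise `{y = 0}`. -/
def NonDicritical (V W : ℕ × ℕ) (η : Form) : Prop :=
  (0 < V.1 ∧ 0 < V.2 → ∀ y : ℂ, (η (0, y)).2 = 0) ∧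
  (0 < W.1 ∧ 0 < W.2 → ∀ x : ℂ, (η (x, 0)).1 = 0)

/-- The singularity at `P` of the foliation `A dx + B dy = 0` is reduced and not a saddle-node:
the linear part at `P` of the vector field `B ∂x - A ∂y` has two non-zero eigenvalues whose quotient
is not a positive rational number. -/
def IsReducedNonSaddleNode (η : Form) (P : ℂ × ℂ) : Prop :=
  ∃ μ₁ μ₂ : ℂ, μ₁ ≠ 0 ∧ μ₂ ≠ 0 ∧
    μ₁ + μ₂ = (fderiv ℂ η P (1, 0)).2 - (fderiv ℂ η P (0, 1)).1 ∧
    μ₁ * μ₂ = (fderiv ℂ η P (0, 1)).2 * (fderiv ℂ η P (1, 0)).1 -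
      (fderiv ℂ η P (1, 0)).2 * (fderiv ℂ η P (0, 1)).1 ∧
    ∀ r : ℚ, 0 < r → μ₁ ≠ (r : ℂ) * μ₂

/-! ### Separatrices -/

/-- A parametrized holomorphic curve germ through the origin, not constant. -/
def IsCurve (γ : ℂ → ℂ × ℂ) : Prop :=
  AnalyticAt ℂ γ 0 ∧ γ 0 = 0 ∧ ∀ᶠ t in 𝓝[≠] (0 : ℂ), γ t ≠ 0

/-- `γ` parametrizes a separatrix of the foliation `ω = 0`: `γ^* ω = 0`. -/
def IsSeparatrix (ω : Form) (γ : ℂ → ℂ × ℂ) : Prop :=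
  IsCurve γ ∧ ∀ᶠ t in 𝓝 (0 : ℂ),
    (ω (γ t)).1 * (deriv γ t).1 + (ω (γ t)).2 * (deriv γ t).2 = 0

/-- The strict transform of the curve `γ` passes through the point `P` of the exceptional divisor
in the chart with weights `V`, `W`. -/
def PassesThrough (V W : ℕ × ℕ) (γ : ℂ → ℂ × ℂ) (P : ℂ × ℂ) : Prop :=
  ∃ δ : ℂ → ℂ × ℂ, AnalyticAt ℂ δ 0 ∧ δ 0 = P ∧ ∀ᶠ t in 𝓝 (0 : ℂ), chartMap V W (δ t) = γ t

/-- `g = 0` is an equation of the union of the separatrices of `ω`. -/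
def IsSeparatrixEquation (ω : Form) (g : ℂ × ℂ → ℂ) : Prop :=
  AnalyticAt ℂ g 0 ∧
    ∀ γ : ℂ → ℂ × ℂ, IsCurve γ → (IsSeparatrix ω γ ↔ ∀ᶠ t in 𝓝 (0 : ℂ), g (γ t) = 0)

/-- The germs at `0` of the zero sets of `g` and `f` are topologically conjugated. -/
def TopConjugate (g f : ℂ × ℂ → ℂ) : Prop :=
  ∃ Φ : OpenPartialHomeomorph (ℂ × ℂ) (ℂ × ℂ), 0 ∈ Φ.source ∧ Φ 0 = 0 ∧
    ∀ᶠ z in 𝓝 (0 : ℂ × ℂ), g z = 0 ↔ f (Φ z) = 0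

/-! ### The class of foliations -/

/-- Germs `ω` of topologically quasi-homogeneous forms, whose separatrices are topologically
conjugated to `f = x ^ ε₀ y ^ ε∞ ∏ (y ^ k - s i x ^ l)`, have the same desingularization `σ` as `f`,
and for which `x ^ ε₀ y ^ ε∞ = 0` is invariant. The points `z_i = (1 / c i, 0)` of the principal
component, in the chart where `σ (x, y) = (x ^ (k - v) y ^ k, x ^ (l - u) y ^ l)`, are those where
the strict transforms of the cuspidal branches meet the exceptional divisor. -/
structure MemQ (k l u v n ε₀ εinf : ℕ) (s c : Fin n → ℂ) (ω : Form) : Prop where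
  analytic : AnalyticAt ℂ ω 0
  isolated : ∀ᶠ z in 𝓝[≠] (0 : ℂ × ℂ), ω z ≠ 0
  /-- After desingularization: all components are invariant, all singularities are reduced and
  none is a saddle-node. -/
  desingularized : ∀ V W : ℕ × ℕ, IsChart k l V W →
    ∃ η : Form, IsStrictTransform ω V W η ∧ NonDicritical V W η ∧
      ∀ P : ℂ × ℂ, chartMap V W P = 0 → η P = 0 → IsReducedNonSaddleNode η P
  /-- The union of the separatrices is topologically conjugated to `f = 0`. -/
  topConjugate : ∃ g : ℂ × ℂ → ℂ, IsSeparatrixEquation ω g ∧ TopConjugate g (qhFun k l ε₀ εinf s)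
  /-- `x ^ ε₀ y ^ ε∞ = 0` is invariant. -/
  invariant_x : ε₀ = 1 → ∀ᶠ y in 𝓝 (0 : ℂ), (ω (0, y)).2 = 0
  invariant_y : εinf = 1 → ∀ᶠ x in 𝓝 (0 : ℂ), (ω (x, 0)).1 = 0
  /-- The separatrices are desingularized by `σ` in the same way as `f`: apart from the axis
  branches in `x ^ ε₀ y ^ ε∞ = 0`, their strict transforms meet the exceptional divisor in the `n`
  distinct points `z_i` of the principal component, away from `0` and `∞`. -/
  c_ne_zero : ∀ i, c i ≠ 0
  c_injective : Function.Injective c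
  cuspidal : ∀ i, ∃ γ : ℂ → ℂ × ℂ, IsSeparatrix ω γ ∧
    PassesThrough (k - v, l - u) (k, l) γ (1 / c i, 0)
  separatrices : ∀ γ : ℂ → ℂ × ℂ, IsSeparatrix ω γ →
    (ε₀ = 1 ∧ ∀ᶠ t in 𝓝 (0 : ℂ), (γ t).1 = 0) ∨
    (εinf = 1 ∧ ∀ᶠ t in 𝓝 (0 : ℂ), (γ t).2 = 0) ∨
    ∃ i, PassesThrough (k - v, l - u) (k, l) γ (1 / c i, 0)

/-! ### Camacho–Sad indices -/

/-- The residue at `p` of a function which is holomorphic in a punctured neighbourhood of `p`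
(the integrals do not depend on the small radius `r`). -/
def residue (h : ℂ → ℂ) (p : ℂ) : ℂ :=
  limUnder (𝓝[>] (0 : ℝ)) fun r => (2 * (Real.pi : ℂ) * Complex.I)⁻¹ * ∮ x in C(p, r), h x

/-- The Camacho–Sad index at `(p, 0)` of the foliation `A dx + B dy = 0` relative to the invariant
curve `y = 0`. -/
def indexY (η : Form) (p : ℂ) : ℂ :=
  -residue (fun x => deriv (fun y => (η (x, y)).1 / (η (x, y)).2) 0) p

/-- The Camacho–Sad index at `(0, p)` of the foliation `A dx + B dy = 0` relative to the invariant
curve `x = 0`. -/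
def indexX (η : Form) (p : ℂ) : ℂ :=
  -residue (fun y => deriv (fun x => (η (x, y)).2 / (η (x, y)).1) 0) p

end TQH

end

namespace TQH

/-! ### Regrouping double sums -/

/-! Write `ω = Σ x^i y^j (A dx/x + B dy/y)`, with `A`, `B` depending on the exponent `(i, j)`. A
chart of `σ` is a monomial map whose weights `V`, `W` have determinant one. It sends the exponent
`P` to `(V·P, W·P)` and the pair `(A, B)` to its contractions with `V` and `W`. The Taylor
coefficients of every strict transform at the origin of its chart are thus read on the Newton
diagram of `ω`, by uniqueness of double power series (`HasCoeffs.unique`, `exists_strictCoeffs`).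

Shape of the Newton diagram. At a corner of two invariant components the eigenvalues are non-zero,
so one support point minimises both orders (`exists_vertex_corner`). If the vertices at the two ends
of a non-principal component differed, the restriction of the strict transform to that component
would have two monomials, hence a non-zero root, which is a singularity off the corners. By
Briot–Bouquet (`briotBouquet`, `exists_transverse_curve`) it would carry a separatrix outside the
axes along which `x^l / y^k` tends to `0` or `∞`, against the hypotheses (`no_root`, `vertex_eq`).
All the vertices on one side of `D_c` therefore coincide. The last chart gives `x`-exponent `ε₀` on
one side (`exists_vertex_end`); exchanging the coordinates gives `y`-exponent `ε∞` on the other.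

The edge. Between these two vertices lies one edge, of weight `(k, l)`. The contraction with `(k,
l)` restricts on it to a polynomial whose non-zero roots are exactly the `1 / c i`: a separatrix
meets `D_c` at a singular point (`root_of_separatrix`), every other root would produce another
separatrix, and the roots are simple because there is no saddle-node. This fixes the vertices, `d`
and `q_d` (`exists_initialPart`).

The indices. The contraction with `(k - v, l - u)` is a second polynomial on the edge, and its
quotient by `x` times the first has the negatives of the Camacho–Sad indices as residues
(`indexY_eq`). Partial fractions recover it (`InitialPart.indices`). The two contractions determine
`ω_d`, since the weights have determinant one; leading coefficients and the chart at infinity give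
the relation between the indices (`index_relations`). -/

theorem hasSum_fiberwise {F : ℕ × ℕ → ℂ} {g : ℕ × ℕ → ℕ} {T : ℕ → Finset (ℕ × ℕ)}
    (hT : ∀ n p, p ∈ T n ↔ g p = n) {s : ℂ} (h : HasSum F s) :
    HasSum (fun n => ∑ p ∈ T n, F p) s := by
  have h1 := (Equiv.sigmaFiberEquiv g).hasSum_iff.mpr h
  refine h1.sigma fun n => ?_
  have h2 := (T n).hasSum F
  have e : {p // p ∈ T n} ≃ {p // g p = n} := Equiv.subtypeEquivRight fun p => hT n p
  rw [← (Equiv.subtypeEquivRight fun p => hT n p).hasSum_iff]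
  exact h2

theorem summable_of_fiberwise {F : ℕ × ℕ → ℝ} {g : ℕ × ℕ → ℕ} {T : ℕ → Finset (ℕ × ℕ)}
    (hT : ∀ n p, p ∈ T n ↔ g p = n) (hF : ∀ p, 0 ≤ F p)
    (h : Summable fun n => ∑ p ∈ T n, F p) : Summable F := by
  rw [← (Equiv.sigmaFiberEquiv g).summable_iff,
    summable_sigma_of_nonneg (f := F ∘ Equiv.sigmaFiberEquiv g) (fun _ => hF _)]
  have key : ∀ n, HasSum (fun y : {p // g p = n} => F y) (∑ p ∈ T n, F p) := fun n => by
    rw [← (Equiv.subtypeEquivRight fun p => hT n p).hasSum_iff]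
    exact (T n).hasSum F
  refine ⟨fun n => (key n).summable, ?_⟩
  refine h.congr fun n => ?_
  exact (key n).tsum_eq.symm

theorem summable_fiberwise {F : ℕ × ℕ → ℝ} {g : ℕ × ℕ → ℕ} {T : ℕ → Finset (ℕ × ℕ)}
    (hT : ∀ n p, p ∈ T n ↔ g p = n) (h : Summable F) :
    Summable fun n => ∑ p ∈ T n, F p := by
  have h1 := (Equiv.sigmaFiberEquiv g).hasSum_iff.mpr h.hasSum
  refine (h1.sigma (g := fun n => ∑ p ∈ T n, F p) fun n => ?_).summable
  rw [← (Equiv.subtypeEquivRight fun p => hT n p).hasSum_iff]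
  exact (T n).hasSum F

theorem hasSum_of_eq {ι : Type*} {F G : ι → ℂ} {s : ℂ} (h : ∀ p, F p = G p) (hF : HasSum F s) :
    HasSum G s :=
  (funext h : F = G) ▸ hF

/-! ### Double power series -/

/-- `f` is, on a closed polydisc around `0`, the sum of the absolutely convergent double power
series with coefficients `a`. -/
def HasCoeffs (a : ℕ × ℕ → ℂ) (f : ℂ × ℂ → ℂ) : Prop :=
  ∃ r : ℝ, 0 < r ∧ Summable (fun p => ‖a p‖ * r ^ (p.1 + p.2)) ∧
    ∀ z : ℂ × ℂ, ‖z.1‖ ≤ r → ‖z.2‖ ≤ r → HasSum (fun p => a p * (z.1 ^ p.1 * z.2 ^ p.2)) (f z)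

/-- Each slot of the multilinear map is expanded in the basis. The set `s` records the slots that
receive the first basis vector, and its cardinality is the exponent of `z.1`. -/
theorem hasSum_eval_diag {n : ℕ} (p : ContinuousMultilinearMap ℂ (fun _ : Fin n => ℂ × ℂ) ℂ)
    (z : ℂ × ℂ) :
    (p fun _ => z) = ∑ q ∈ Finset.HasAntidiagonal.antidiagonal n,
      (∑ s : Finset (Fin n), if s.card = q.1 then
        p (s.piecewise (fun _ => ((1, 0) : ℂ × ℂ)) fun _ => ((0, 1) : ℂ × ℂ)) else 0) *
        (z.1 ^ q.1 * z.2 ^ q.2) := by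
  have h1 : (fun _ : Fin n => z) =
      (fun _ => z.1 • ((1, 0) : ℂ × ℂ)) + fun _ => z.2 • ((0, 1) : ℂ × ℂ) := by
    funext i; ext <;> simp
  rw [h1, p.map_add_univ]
  have h2 : ∀ s : Finset (Fin n),
      p (s.piecewise (fun _ => z.1 • ((1, 0) : ℂ × ℂ)) fun _ => z.2 • ((0, 1) : ℂ × ℂ)) =
      (z.1 ^ s.card * z.2 ^ (n - s.card)) *
        p (s.piecewise (fun _ => ((1, 0) : ℂ × ℂ)) fun _ => ((0, 1) : ℂ × ℂ)) := fun s => by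
    have h3 : (s.piecewise (fun _ => z.1 • ((1, 0) : ℂ × ℂ)) fun _ => z.2 • ((0, 1) : ℂ × ℂ)) =
        fun i => (s.piecewise (fun _ => z.1) (fun _ => z.2)) i •
          (s.piecewise (fun _ => ((1, 0) : ℂ × ℂ)) (fun _ => ((0, 1) : ℂ × ℂ))) i := by
      funext i
      by_cases hi : i ∈ s <;> simp [hi]
    rw [h3, p.map_smul_univ, Finset.prod_piecewise]
    simp [Finset.card_sdiff, Finset.card_univ, smul_eq_mul]
  simp_rw [h2, Finset.sum_mul]
  rw [Finset.sum_comm]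
  refine Finset.sum_congr rfl fun s _ => ?_
  have hs : s.card ≤ n := by simpa using s.card_le_univ
  rw [Finset.sum_eq_single (s.card, n - s.card)]
  · simp [mul_comm]
  · rintro ⟨i, j⟩ hq hne
    rw [Finset.HasAntidiagonal.mem_antidiagonal] at hq
    have : s.card ≠ i := by
      rintro rfl
      apply hne
      ext <;> simp; omega
    simp [this]
  · intro h
    exact absurd (by rw [Finset.HasAntidiagonal.mem_antidiagonal]; simp; omega) h

/-- A homogeneous term of degree `n` splits into `2 ^ n` values on basis vectors; halving the radius
absorbs this factor and makes the double series absolutely convergent. -/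
theorem exists_hasCoeffs {f : ℂ × ℂ → ℂ} (hf : AnalyticAt ℂ f 0) : ∃ a, HasCoeffs a f := by
  obtain ⟨p, R, hp⟩ := hf
  let b : (n : ℕ) → ℕ → ℂ := fun n i => ∑ s : Finset (Fin n), if s.card = i then
        p n (s.piecewise (fun _ => ((1, 0) : ℂ × ℂ)) fun _ => ((0, 1) : ℂ × ℂ)) else 0
  obtain ⟨ρ, hρ0, hρ⟩ := ENNReal.lt_iff_exists_nnreal_btwn.mp hp.r_pos
  have hρ0' : 0 < (ρ : ℝ) := by simpa using hρ0
  have hsum := p.summable_norm_mul_pow (hρ.trans_le hp.r_le)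
  have hT : ∀ n (q : ℕ × ℕ), q ∈ Finset.HasAntidiagonal.antidiagonal n ↔ q.1 + q.2 = n := fun n q =>
    Finset.HasAntidiagonal.mem_antidiagonal
  have hb : ∀ n, ∑ q ∈ Finset.HasAntidiagonal.antidiagonal n, ‖b n q.1‖ ≤ 2 ^ n * ‖p n‖ := fun n => by
    calc ∑ q ∈ Finset.HasAntidiagonal.antidiagonal n, ‖b n q.1‖
        ≤ ∑ q ∈ Finset.HasAntidiagonal.antidiagonal n, ∑ s : Finset (Fin n), if s.card = q.1 then ‖p n‖ else 0 := by
          refine Finset.sum_le_sum fun q _ => (norm_sum_le _ _).trans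
            (Finset.sum_le_sum fun s _ => ?_)
          split_ifs
          · refine ((p n).le_opNorm _).trans ?_
            refine mul_le_of_le_one_right (norm_nonneg _) (Finset.prod_le_one (fun _ _ => norm_nonneg _) fun i _ => ?_)
            by_cases hi : i ∈ s <;> simp [hi, Prod.norm_def]
          · simp
      _ = ∑ s : Finset (Fin n), ∑ q ∈ Finset.HasAntidiagonal.antidiagonal n, if s.card = q.1 then ‖p n‖ else 0 :=
          Finset.sum_comm
      _ ≤ ∑ s : Finset (Fin n), ‖p n‖ := by
          refine Finset.sum_le_sum fun s _ => ?_
          have hs : s.card ≤ n := by simpa using s.card_le_univ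
          rw [Finset.sum_eq_single (s.card, n - s.card)]
          · simp
          · rintro ⟨i, j⟩ hq hne
            rw [Finset.HasAntidiagonal.mem_antidiagonal] at hq
            have : s.card ≠ i := by
              rintro rfl
              apply hne
              ext <;> simp; omega
            simp [this]
          · intro h
            exact absurd (by rw [Finset.HasAntidiagonal.mem_antidiagonal]; simp; omega) h
      _ = 2 ^ n * ‖p n‖ := by simp [Finset.card_univ]
  have hS : Summable (fun q : ℕ × ℕ => ‖b (q.1 + q.2) q.1‖ * (ρ / 2 : ℝ) ^ (q.1 + q.2)) := by
    refine summable_of_fiberwise hT (fun q => by positivity) ?_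
    refine Summable.of_nonneg_of_le (fun n => Finset.sum_nonneg fun q _ => by positivity)
      (fun n => ?_) hsum
    calc ∑ q ∈ Finset.HasAntidiagonal.antidiagonal n, ‖b (q.1 + q.2) q.1‖ * (ρ / 2 : ℝ) ^ (q.1 + q.2)
        = (∑ q ∈ Finset.HasAntidiagonal.antidiagonal n, ‖b n q.1‖) * (ρ / 2 : ℝ) ^ n := by
          rw [Finset.sum_mul]
          refine Finset.sum_congr rfl fun q hq => ?_
          rw [Finset.HasAntidiagonal.mem_antidiagonal.mp hq]
      _ ≤ (2 ^ n * ‖p n‖) * (ρ / 2 : ℝ) ^ n := by gcongr; exact hb n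
      _ = ‖p n‖ * ρ ^ n := by rw [div_pow]; field_simp
  refine ⟨fun q => b (q.1 + q.2) q.1, ρ / 2, by positivity, hS, fun z hz1 hz2 => ?_⟩
  have hSz : Summable (fun q : ℕ × ℕ => b (q.1 + q.2) q.1 * (z.1 ^ q.1 * z.2 ^ q.2)) := by
    refine Summable.of_norm_bounded hS fun q => ?_
    rw [norm_mul, norm_mul, norm_pow, norm_pow, pow_add]
    gcongr
  have h1 := hasSum_fiberwise hT hSz.hasSum
  have hz : z ∈ Metric.eball (0 : ℂ × ℂ) R := by
    refine lt_of_le_of_lt ?_ hρ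
    rw [edist_zero_right, enorm_eq_nnnorm, ENNReal.coe_le_coe, ← NNReal.coe_le_coe, coe_nnnorm,
      Prod.norm_def]
    refine max_le ?_ ?_ <;> linarith
  have h2 := hp.hasSum hz
  rw [zero_add] at h2
  have h3 : (fun n => p n fun _ => z) = fun n => ∑ q ∈ Finset.HasAntidiagonal.antidiagonal n,
      b (q.1 + q.2) q.1 * (z.1 ^ q.1 * z.2 ^ q.2) := by
    funext n
    rw [hasSum_eval_diag]
    refine Finset.sum_congr rfl fun q hq => ?_
    rw [Finset.HasAntidiagonal.mem_antidiagonal.mp hq]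
  rw [h3] at h2
  rw [← h1.unique h2]
  exact hSz.hasSum

theorem HasCoeffs.analyticAt {a : ℕ × ℕ → ℂ} {f : ℂ × ℂ → ℂ} (h : HasCoeffs a f) :
    AnalyticAt ℂ f 0 := by
  obtain ⟨r, hr, hs, hf⟩ := h
  have hT : ∀ n (q : ℕ × ℕ), q ∈ Finset.HasAntidiagonal.antidiagonal n ↔ q.1 + q.2 = n := fun n q =>
    Finset.HasAntidiagonal.mem_antidiagonal
  -- `M n i` is the product of `i` first and `n - i` second coordinates as a multilinear map of norm
  -- at most one. It need not be symmetric, since only its diagonal values are used.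
  let M : (n i : ℕ) → ContinuousMultilinearMap ℂ (fun _ : Fin n => ℂ × ℂ) ℂ := fun n i =>
    (ContinuousMultilinearMap.mkPiAlgebraFin ℂ n ℂ).compContinuousLinearMap fun m =>
      if (m : ℕ) < i then ContinuousLinearMap.fst ℂ ℂ ℂ else ContinuousLinearMap.snd ℂ ℂ ℂ
  have hM : ∀ n i, ‖M n i‖ ≤ 1 := fun n i => by
    refine (ContinuousMultilinearMap.norm_compContinuousLinearMap_le _ _).trans ?_
    rw [ContinuousMultilinearMap.norm_mkPiAlgebraFin, one_mul]
    refine Finset.prod_le_one (fun _ _ => norm_nonneg _) fun m _ => ?_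
    split_ifs
    · exact ContinuousLinearMap.norm_fst_le ..
    · exact ContinuousLinearMap.norm_snd_le ..
  let p : FormalMultilinearSeries ℂ (ℂ × ℂ) ℂ := fun n =>
    ∑ q ∈ Finset.HasAntidiagonal.antidiagonal n, a q • M n q.1
  have hMz : ∀ (z : ℂ × ℂ) (i j : ℕ), (M (i + j) i fun _ => z) = z.1 ^ i * z.2 ^ j := by
    intro z i j
    simp only [M, ContinuousMultilinearMap.compContinuousLinearMap_apply,
      ContinuousMultilinearMap.mkPiAlgebraFin_apply, List.prod_ofFn]
    rw [Fin.prod_univ_add]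
    simp
  let r' : NNReal := ⟨r, hr.le⟩
  have hrad : (r' : ENNReal) ≤ p.radius := by
    refine p.le_radius_of_summable ?_
    refine Summable.of_nonneg_of_le (fun n => by positivity) (fun n => ?_)
      (summable_fiberwise hT hs)
    calc ‖p n‖ * (r' : ℝ) ^ n ≤ (∑ q ∈ Finset.HasAntidiagonal.antidiagonal n, ‖a q‖) * r ^ n := by
          refine mul_le_mul_of_nonneg_right ((norm_sum_le _ _).trans
            (Finset.sum_le_sum fun q _ => ?_)) (by positivity)
          rw [norm_smul]
          exact mul_le_of_le_one_right (norm_nonneg _) (hM _ _)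
      _ = _ := by
          rw [Finset.sum_mul]
          refine Finset.sum_congr rfl fun q hq => ?_
          rw [Finset.HasAntidiagonal.mem_antidiagonal.mp hq]
  refine ⟨p, r', hrad, ENNReal.coe_pos.mpr hr, fun {z} hz => ?_⟩
  rw [zero_add]
  have hz' : ‖z‖ < r := by
    rw [Metric.mem_eball, edist_zero_right, enorm_eq_nnnorm, ENNReal.coe_lt_coe,
      ← NNReal.coe_lt_coe] at hz
    exact hz
  have h1 := hasSum_fiberwise hT (hf z ((norm_fst_le z).trans hz'.le) ((norm_snd_le z).trans hz'.le))
  refine hasSum_of_eq (fun n => ?_) h1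
  have h2 : (p n fun _ => z) = ∑ q ∈ Finset.HasAntidiagonal.antidiagonal n,
      a q * M n q.1 fun _ => z := by
    simp [p]
  rw [h2]
  refine Finset.sum_congr rfl fun q hq => ?_
  obtain ⟨i, j⟩ := q
  rw [Finset.HasAntidiagonal.mem_antidiagonal] at hq
  subst hq
  rw [hMz]

theorem HasCoeffs.congr {a : ℕ × ℕ → ℂ} {f g : ℂ × ℂ → ℂ} (h : HasCoeffs a f)
    (hfg : f =ᶠ[𝓝 0] g) : HasCoeffs a g := by
  obtain ⟨r, hr, hs, hf⟩ := h
  obtain ⟨ε, hε, hball⟩ := Metric.eventually_nhds_iff.mp hfg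
  have hm : 0 < min r (ε / 2) := by positivity
  refine ⟨min r (ε / 2), hm, ?_, fun z h1 h2 => ?_⟩
  · refine Summable.of_nonneg_of_le (fun p => by positivity) (fun p => ?_) hs
    gcongr
    exact min_le_left _ _
  · rw [← hball (y := z)]
    · exact hf z (h1.trans (min_le_left _ _)) (h2.trans (min_le_left _ _))
    · rw [dist_zero_right, Prod.norm_def]
      have := min_le_right r (ε / 2)
      refine max_lt ?_ ?_ <;> linarith

theorem HasCoeffs.linear_comb {a b : ℕ × ℕ → ℂ} {f g : ℂ × ℂ → ℂ} (hf : HasCoeffs a f)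
    (hg : HasCoeffs b g) (s t : ℂ) :
    HasCoeffs (fun p => s * a p + t * b p) (fun z => s * f z + t * g z) := by
  obtain ⟨r, hr, hs, hf⟩ := hf
  obtain ⟨r', hr', hs', hg⟩ := hg
  have hm : 0 < min r r' := by positivity
  have hab : ∀ ρ : ℝ, 0 < ρ → ρ ≤ r → ρ ≤ r' →
      Summable fun p : ℕ × ℕ => (‖s‖ * ‖a p‖ + ‖t‖ * ‖b p‖) * ρ ^ (p.1 + p.2) := by
    intro ρ h0 h1 h2
    refine Summable.of_nonneg_of_le (fun p => by positivity) (fun p => ?_)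
      ((hs.mul_left ‖s‖).add (hs'.mul_left ‖t‖))
    rw [add_mul, mul_assoc, mul_assoc]
    gcongr
  refine ⟨min r r', hm, ?_, fun z h1 h2 => ?_⟩
  · refine Summable.of_nonneg_of_le (fun p => by positivity) (fun p => ?_)
      (hab _ hm (min_le_left _ _) (min_le_right _ _))
    gcongr
    refine (norm_add_le _ _).trans ?_
    rw [norm_mul, norm_mul]
  · have h3 := (hf z (h1.trans (min_le_left _ _)) (h2.trans (min_le_left _ _))).mul_left s
    have h4 := (hg z (h1.trans (min_le_right _ _)) (h2.trans (min_le_right _ _))).mul_left t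
    refine hasSum_of_eq (fun p => ?_) (h3.add h4)
    ring

/-- A series in monomials with pairwise distinct exponents. -/
theorem hasCoeffs_extend {a : ℕ × ℕ → ℂ} {e : ℕ × ℕ → ℕ × ℕ} (he : Function.Injective e)
    {f : ℂ × ℂ → ℂ} {r : ℝ} (hr : 0 < r)
    (hs : Summable fun p => ‖a p‖ * r ^ ((e p).1 + (e p).2))
    (hf : ∀ z : ℂ × ℂ, ‖z.1‖ ≤ r → ‖z.2‖ ≤ r →
      HasSum (fun p => a p * (z.1 ^ (e p).1 * z.2 ^ (e p).2)) (f z)) :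
    HasCoeffs (Function.extend e a 0) f := by
  refine ⟨r, hr, ?_, fun z h1 h2 => ?_⟩
  · rw [← he.summable_iff]
    · refine hs.congr fun p => ?_
      simp [he.extend_apply]
    · intro x hx
      rw [Function.extend_apply' _ _ _ (by simpa using hx)]
      simp
  · rw [← he.hasSum_iff]
    · convert hf z h1 h2 using 2 with p
      simp [he.extend_apply]
    · intro x hx
      rw [Function.extend_apply' _ _ _ (by simpa using hx)]
      simp

/-- Multiplication by a monomial. -/
theorem HasCoeffs.monomial_mul {a : ℕ × ℕ → ℂ} {f : ℂ × ℂ → ℂ} (h : HasCoeffs a f) (i j : ℕ) :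
    HasCoeffs (Function.extend (fun p : ℕ × ℕ => (p.1 + i, p.2 + j)) a 0)
      (fun z => z.1 ^ i * z.2 ^ j * f z) := by
  obtain ⟨r, hr, hs, hf⟩ := h
  refine hasCoeffs_extend (fun p q h => ?_) hr ?_ fun z h1 h2 => ?_
  · simp only [Prod.mk.injEq, add_left_inj] at h
    exact Prod.ext h.1 h.2
  · refine (hs.mul_right (r ^ (i + j))).congr fun p => ?_
    ring
  · refine hasSum_of_eq (fun p => ?_) ((hf z h1 h2).mul_left (z.1 ^ i * z.2 ^ j))
    ring

/-- The exponents of the pull-back of a monomial by `chartMap V W`. -/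
def chartExp (V W p : ℕ × ℕ) : ℕ × ℕ := (V.1 * p.1 + V.2 * p.2, W.1 * p.1 + W.2 * p.2)

/-- Distinct exponents stay distinct, so coefficients are relocated and never added. With a radius
at most `1`, a monomial of positive degree stays bounded by `r` and raising exponents only improves
convergence. -/
theorem HasCoeffs.comp_chartMap {a : ℕ × ℕ → ℂ} {f : ℂ × ℂ → ℂ} (h : HasCoeffs a f)
    {V W : ℕ × ℕ} (h1 : 0 < V.1 + W.1) (h2 : 0 < V.2 + W.2)
    (he : Function.Injective (chartExp V W)) :
    HasCoeffs (Function.extend (chartExp V W) a 0) (fun z => f (chartMap V W z)) := by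
  obtain ⟨r, hr, hs, hf⟩ := h
  have hm : 0 < min 1 r := by positivity
  have key : ∀ (x y : ℂ) (i j : ℕ), 0 < i + j → ‖x‖ ≤ min 1 r → ‖y‖ ≤ min 1 r →
      ‖x ^ i * y ^ j‖ ≤ r := by
    intro x y i j hij hx hy
    rw [norm_mul, norm_pow, norm_pow]
    calc ‖x‖ ^ i * ‖y‖ ^ j ≤ (min 1 r) ^ i * (min 1 r) ^ j := by gcongr
      _ = (min 1 r) ^ (i + j) := (pow_add _ _ _).symm
      _ ≤ (min 1 r) ^ 1 := pow_le_pow_of_le_one hm.le (min_le_left _ _) hij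
      _ ≤ r := by rw [pow_one]; exact min_le_right _ _
  refine hasCoeffs_extend he hm ?_ fun z hz1 hz2 => ?_
  · refine Summable.of_nonneg_of_le (fun p => by positivity) (fun p => ?_) hs
    gcongr ?_ * ?_
    calc (min 1 r) ^ ((chartExp V W p).1 + (chartExp V W p).2) ≤ (min 1 r) ^ (p.1 + p.2) := by
          refine pow_le_pow_of_le_one hm.le (min_le_left _ _) ?_
          simp only [chartExp]
          nlinarith [Nat.mul_le_mul_right p.1 h1, Nat.mul_le_mul_right p.2 h2]
      _ ≤ r ^ (p.1 + p.2) := by gcongr; exact min_le_right _ _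
  · convert hf (chartMap V W z) (key _ _ _ _ h1 hz1 hz2) (key _ _ _ _ h2 hz1 hz2) using 2 with p
    simp only [chartExp, chartMap]
    ring

/-- The Taylor coefficients of the restriction to a quasi-homogeneous parametrized curve. -/
theorem HasCoeffs.iteratedDeriv_curve {a : ℕ × ℕ → ℂ} {f : ℂ × ℂ → ℂ} (h : HasCoeffs a f)
    {k l : ℕ} (hk : 0 < k) (hl : 0 < l) (e m : ℕ) (T : Finset (ℕ × ℕ))
    (hT : ∀ p, p ∈ T ↔ k * p.1 + l * p.2 + e = m) (z : ℂ × ℂ) :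
    iteratedDeriv m (fun t : ℂ => t ^ e * f (t ^ k * z.1, t ^ l * z.2)) 0 / (m.factorial : ℂ) =
      ∑ p ∈ T, a p * (z.1 ^ p.1 * z.2 ^ p.2) := by
  obtain ⟨r, hr, hs, hf⟩ := h
  let S : ℕ → Finset (ℕ × ℕ) := fun n =>
    (Finset.range (n + 1) ×ˢ Finset.range (n + 1)).filter fun p => k * p.1 + l * p.2 + e = n
  have hS : ∀ n p, p ∈ S n ↔ k * p.1 + l * p.2 + e = n := fun n p => by
    simp only [S, Finset.mem_filter, Finset.mem_product, Finset.mem_range, and_iff_right_iff_imp]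
    intro h
    have := Nat.le_mul_of_pos_left p.1 hk
    have := Nat.le_mul_of_pos_left p.2 hl
    omega
  let c : ℕ → ℂ := fun n => ∑ p ∈ S n, a p * (z.1 ^ p.1 * z.2 ^ p.2)
  have hc : HasFPowerSeriesAt (fun t : ℂ => t ^ e * f (t ^ k * z.1, t ^ l * z.2))
      (FormalMultilinearSeries.ofScalars ℂ c) 0 := by
    rw [hasFPowerSeriesAt_iff]
    have h1 : ∀ᶠ t : ℂ in 𝓝 0, ‖t ^ k * z.1‖ < r := by
      have : Tendsto (fun t : ℂ => ‖t ^ k * z.1‖) (𝓝 0) (𝓝 ‖(0 : ℂ) ^ k * z.1‖) :=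
        (by fun_prop : Continuous fun t : ℂ => ‖t ^ k * z.1‖).tendsto 0
      rw [zero_pow hk.ne', zero_mul, norm_zero] at this
      exact this.eventually_lt_const hr
    have h2 : ∀ᶠ t : ℂ in 𝓝 0, ‖t ^ l * z.2‖ < r := by
      have : Tendsto (fun t : ℂ => ‖t ^ l * z.2‖) (𝓝 0) (𝓝 ‖(0 : ℂ) ^ l * z.2‖) :=
        (by fun_prop : Continuous fun t : ℂ => ‖t ^ l * z.2‖).tendsto 0
      rw [zero_pow hl.ne', zero_mul, norm_zero] at this
      exact this.eventually_lt_const hr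
    filter_upwards [h1, h2] with t ht1 ht2
    have h3 := hasSum_fiberwise hS ((hf (t ^ k * z.1, t ^ l * z.2) ht1.le ht2.le).mul_left (t ^ e))
    rw [zero_add]
    refine hasSum_of_eq (fun n => ?_) h3
    rw [FormalMultilinearSeries.coeff_ofScalars, smul_eq_mul, Finset.mul_sum]
    refine Finset.sum_congr rfl fun p hp => ?_
    rw [← (hS n p).mp hp]
    simp only
    ring
  -- The series with coefficients `iteratedDeriv m / m!` and the series `c` represent the same germ,
  -- hence agree.
  have h1 := hc.analyticAt.hasFPowerSeriesAt
  have h2 := congrArg (fun p => FormalMultilinearSeries.coeff p m)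
    (hc.eq_formalMultilinearSeries h1)
  simp only [FormalMultilinearSeries.coeff_ofScalars] at h2
  rw [← h2]
  refine Finset.sum_congr (Finset.ext fun p => ?_) fun _ _ => rfl
  rw [hT, hS]

/-- On the lines `t ↦ (t x, t)` the coefficient of `t ^ (i + j)` of the difference is a polynomial
in `x`. It vanishes for every `x`, hence coefficient by coefficient. -/
theorem HasCoeffs.unique {a b : ℕ × ℕ → ℂ} {f g : ℂ × ℂ → ℂ} (hf : HasCoeffs a f)
    (hg : HasCoeffs b g) (hfg : f =ᶠ[𝓝 0] g) : a = b := by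
  have h0 := (hf.congr hfg).linear_comb hg 1 (-1)
  funext ⟨i, j⟩
  let P : Polynomial ℂ := ∑ i' ∈ Finset.range (i + j + 1),
    Polynomial.C (a (i', i + j - i') - b (i', i + j - i')) * Polynomial.X ^ i'
  have hP : P = 0 := by
    refine Polynomial.funext fun x => ?_
    have h1 := h0.iteratedDeriv_curve one_pos one_pos 0 (i + j) (Finset.HasAntidiagonal.antidiagonal (i + j))
      (fun p => by simp) (x, 1)
    have h2 : (fun t : ℂ => t ^ 0 * (1 * g (t ^ 1 * x, t ^ 1 * 1) + -1 * g (t ^ 1 * x, t ^ 1 * 1)))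
        = fun _ => 0 := by
      funext t; ring
    simp only at h1
    rw [h2] at h1
    simp only [iteratedDeriv_const] at h1
    rw [Finset.Nat.sum_antidiagonal_eq_sum_range_succ_mk] at h1
    simp only [P, Polynomial.eval_finsetSum, Polynomial.eval_mul, Polynomial.eval_C,
      Polynomial.eval_pow, Polynomial.eval_X, Polynomial.eval_zero]
    simp only [ite_self, zero_div, one_pow, mul_one] at h1
    rw [h1]
    refine Finset.sum_congr rfl fun i' _ => ?_
    ring
  have h1 : P.coeff i = a (i, j) - b (i, j) := by
    simp only [P, Polynomial.finsetSum_coeff, Polynomial.coeff_C_mul_X_pow]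
    rw [Finset.sum_eq_single i]
    · simp
    · intro i' _ hne
      simp [hne.symm]
    · intro h
      exact absurd (Finset.mem_range.mpr (by omega)) h
  rw [hP, Polynomial.coeff_zero] at h1
  exact (sub_eq_zero.mp h1.symm)

theorem HasCoeffs.coeff_fst {a : ℕ × ℕ → ℂ} {f : ℂ × ℂ → ℂ} (hf : HasCoeffs a f) (m : ℕ) :
    a (m, 0) = iteratedDeriv m (fun t : ℂ => f (t, 0)) 0 / (m.factorial : ℂ) := by
  have h1 := hf.iteratedDeriv_curve one_pos one_pos 0 m (Finset.HasAntidiagonal.antidiagonal m)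
      (fun p => by simp) (1, 0)
  simp only [pow_zero, one_mul, pow_one, mul_one, mul_zero] at h1
  rw [h1, Finset.sum_eq_single (m, 0)]
  · simp
  · rintro ⟨i, j⟩ hq hne
    have : j ≠ 0 := by
      rintro rfl
      simp_all
    simp [this]
  · simp

theorem HasCoeffs.coeff_snd {a : ℕ × ℕ → ℂ} {f : ℂ × ℂ → ℂ} (hf : HasCoeffs a f) (m : ℕ) :
    a (0, m) = iteratedDeriv m (fun t : ℂ => f (0, t)) 0 / (m.factorial : ℂ) := by
  have h1 := hf.iteratedDeriv_curve one_pos one_pos 0 m (Finset.HasAntidiagonal.antidiagonal m)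
      (fun p => by simp) (0, 1)
  simp only [pow_zero, one_mul, pow_one, mul_one, mul_zero] at h1
  rw [h1, Finset.sum_eq_single (0, m)]
  · simp
  · rintro ⟨i, j⟩ hq hne
    have : i ≠ 0 := by
      rintro rfl
      simp_all
    simp [this]
  · simp

theorem HasCoeffs.coeff_fst_eq_zero {a : ℕ × ℕ → ℂ} {f : ℂ × ℂ → ℂ} (hf : HasCoeffs a f)
    (h : ∀ᶠ x in 𝓝 (0 : ℂ), f (x, 0) = 0) (m : ℕ) : a (m, 0) = 0 := by
  have h' : (fun t : ℂ => f (t, 0)) =ᶠ[𝓝 0] fun _ => (0 : ℂ) := h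
  rw [hf.coeff_fst, h'.iteratedDeriv_eq]
  simp

theorem HasCoeffs.coeff_snd_eq_zero {a : ℕ × ℕ → ℂ} {f : ℂ × ℂ → ℂ} (hf : HasCoeffs a f)
    (h : ∀ᶠ x in 𝓝 (0 : ℂ), f (0, x) = 0) (m : ℕ) : a (0, m) = 0 := by
  have h' : (fun t : ℂ => f (0, t)) =ᶠ[𝓝 0] fun _ => (0 : ℂ) := h
  rw [hf.coeff_snd, h'.iteratedDeriv_eq]
  simp

theorem HasCoeffs.fderiv_fst {a : ℕ × ℕ → ℂ} {f : ℂ × ℂ → ℂ} (hf : HasCoeffs a f) :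
    fderiv ℂ f 0 (1, 0) = a (1, 0) := by
  rw [hf.coeff_fst, iteratedDeriv_one, Nat.factorial_one, Nat.cast_one, div_one]
  have h1 : HasFDerivAt f (fderiv ℂ f 0) 0 :=
    hf.analyticAt.differentiableAt.hasFDerivAt
  have h2 : HasDerivAt (fun t : ℂ => (t, (0 : ℂ))) (1, 0) 0 :=
    (hasDerivAt_id 0).prodMk (hasDerivAt_const _ _)
  exact (HasFDerivAt.comp_hasDerivAt_of_eq (0 : ℂ) h1 h2 rfl).deriv.symm

theorem HasCoeffs.fderiv_snd {a : ℕ × ℕ → ℂ} {f : ℂ × ℂ → ℂ} (hf : HasCoeffs a f) :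
    fderiv ℂ f 0 (0, 1) = a (0, 1) := by
  rw [hf.coeff_snd, iteratedDeriv_one, Nat.factorial_one, Nat.cast_one, div_one]
  have h1 : HasFDerivAt f (fderiv ℂ f 0) 0 :=
    hf.analyticAt.differentiableAt.hasFDerivAt
  have h2 : HasDerivAt (fun t : ℂ => ((0 : ℂ), t)) (0, 1) 0 :=
    (hasDerivAt_const _ _).prodMk (hasDerivAt_id 0)
  exact (HasFDerivAt.comp_hasDerivAt_of_eq (0 : ℂ) h1 h2 rfl).deriv.symm

theorem HasCoeffs.eventually_eq_zero_of_fst {a : ℕ × ℕ → ℂ} {f : ℂ × ℂ → ℂ}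
    (hf : HasCoeffs a f) (h : ∀ m, a (m, 0) = 0) : ∀ᶠ x in 𝓝 (0 : ℂ), f (x, 0) = 0 := by
  obtain ⟨r, hr, hs, hf⟩ := hf
  filter_upwards [Metric.closedBall_mem_nhds (0 : ℂ) hr] with x hx
  have h1 := hf (x, 0) (by simpa using hx) (by simpa using hr.le)
  refine h1.unique (hasSum_of_eq (fun p => ?_) hasSum_zero)
  obtain ⟨i, j⟩ := p
  cases j with
  | zero => simp [h]
  | succ j => simp

/-- A holomorphic germ vanishing on `{y = 0}` is divisible by `y`. -/
theorem exists_eq_snd_mul {f : ℂ × ℂ → ℂ} (hf : AnalyticAt ℂ f 0)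
    (h : ∀ᶠ x in 𝓝 (0 : ℂ), f (x, 0) = 0) :
    ∃ g : ℂ × ℂ → ℂ, AnalyticAt ℂ g 0 ∧ ∀ᶠ z in 𝓝 (0 : ℂ × ℂ), f z = z.2 * g z := by
  obtain ⟨a, ha⟩ := exists_hasCoeffs hf
  have ha0 := ha.coeff_fst_eq_zero h
  obtain ⟨r, hr, hs, hf⟩ := ha
  have hinj : Function.Injective fun p : ℕ × ℕ => (p.1, p.2 + 1) := fun p q h => by
    simp only [Prod.mk.injEq, add_left_inj] at h
    exact Prod.ext h.1 h.2
  have hs' : Summable fun p : ℕ × ℕ => ‖a (p.1, p.2 + 1)‖ * r ^ (p.1 + p.2) := by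
    have h1 := (hs.comp_injective hinj).mul_right r⁻¹
    refine h1.congr fun p => ?_
    simp only [Function.comp]
    field_simp
    ring
  let g : ℂ × ℂ → ℂ := fun z => ∑' p : ℕ × ℕ, a (p.1, p.2 + 1) * (z.1 ^ p.1 * z.2 ^ p.2)
  have hg : ∀ z : ℂ × ℂ, ‖z.1‖ ≤ r → ‖z.2‖ ≤ r →
      HasSum (fun p : ℕ × ℕ => a (p.1, p.2 + 1) * (z.1 ^ p.1 * z.2 ^ p.2)) (g z) := by
    intro z h1 h2
    refine Summable.hasSum (Summable.of_norm_bounded hs' fun p => ?_)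
    rw [norm_mul, norm_mul, norm_pow, norm_pow, pow_add]
    gcongr
  refine ⟨g, HasCoeffs.analyticAt ⟨r, hr, hs', hg⟩, ?_⟩
  filter_upwards [Metric.closedBall_mem_nhds (0 : ℂ × ℂ) hr] with z hz
  rw [mem_closedBall_zero_iff] at hz
  have h1 := hf z ((norm_fst_le z).trans hz) ((norm_snd_le z).trans hz)
  have h2 := (hg z ((norm_fst_le z).trans hz) ((norm_snd_le z).trans hz)).mul_left z.2
  rw [← hinj.hasSum_iff] at h1
  · refine h1.unique ?_
    refine hasSum_of_eq (fun p => ?_) h2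
    simp only [Function.comp]
    ring
  · rintro ⟨i, j⟩ hp
    cases j with
    | zero => simp [ha0]
    | succ j => exact absurd ⟨(i, j), rfl⟩ hp

/-! ### The equation `t φ' + c φ = t g` -/

/-- `t * radialIntegral c g t` is the holomorphic solution of `t φ' + c φ = t g`. -/
noncomputable def radialIntegral (c : ℂ) (g : ℂ → ℂ) (t : ℂ) : ℂ :=
  ∫ s in (0 : ℝ)..1, (s : ℂ) ^ c * g (s * t)

theorem ofReal_mul_mem_ball {r s : ℝ} {t : ℂ} (hs : s ∈ Set.Icc (0 : ℝ) 1)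
    (ht : t ∈ Metric.ball (0 : ℂ) r) : (s : ℂ) * t ∈ Metric.ball (0 : ℂ) r := by
  rw [mem_ball_zero_iff] at *
  rw [norm_mul, Complex.norm_real, Real.norm_of_nonneg hs.1]
  nlinarith [norm_nonneg t, hs.1, hs.2]

theorem continuous_ofReal_cpow {c : ℂ} (hc : 0 < c.re) : Continuous fun s : ℝ => (s : ℂ) ^ c :=
  Complex.continuous_ofReal_cpow_const hc

theorem continuousOn_radial_integrand {c : ℂ} (hc : 0 < c.re) {g : ℂ → ℂ} {r : ℝ}
    (hg : ContinuousOn g (Metric.ball 0 r)) {t : ℂ} (ht : t ∈ Metric.ball (0 : ℂ) r) :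
    ContinuousOn (fun s : ℝ => (s : ℂ) ^ c * g (s * t)) (Set.Icc 0 1) := by
  refine (continuous_ofReal_cpow hc).continuousOn.mul (hg.comp (by fun_prop) fun s hs => ?_)
  exact ofReal_mul_mem_ball hs ht

theorem intervalIntegrable_radial {c : ℂ} (hc : 0 < c.re) {g : ℂ → ℂ} {r : ℝ}
    (hg : ContinuousOn g (Metric.ball 0 r)) {t : ℂ} (ht : t ∈ Metric.ball (0 : ℂ) r) :
    IntervalIntegrable (fun s : ℝ => (s : ℂ) ^ c * g (s * t)) MeasureTheory.volume 0 1 := by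
  refine ContinuousOn.intervalIntegrable ?_
  rw [Set.uIcc_of_le zero_le_one]
  exact continuousOn_radial_integrand hc hg ht

theorem norm_cpow_le_one {c : ℂ} (hc : 0 < c.re) {s : ℝ} (hs : s ∈ Set.Ioc (0 : ℝ) 1) :
    ‖(s : ℂ) ^ c‖ ≤ 1 := by
  rw [Complex.norm_cpow_eq_rpow_re_of_pos hs.1]
  exact Real.rpow_le_one hs.1.le hs.2 hc.le

theorem norm_radialIntegral_le {c : ℂ} (hc : 0 < c.re) {g : ℂ → ℂ} {r M : ℝ}
    (hg : ∀ x ∈ Metric.ball (0 : ℂ) r, ‖g x‖ ≤ M) {t : ℂ} (ht : t ∈ Metric.ball (0 : ℂ) r) :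
    ‖radialIntegral c g t‖ ≤ M := by
  have h := intervalIntegral.norm_integral_le_of_norm_le_const (a := 0) (b := 1) (C := M)
    (f := fun s : ℝ => (s : ℂ) ^ c * g (s * t)) fun s hs => by
      rw [Set.uIoc_of_le zero_le_one] at hs
      have h1 := hg _ (ofReal_mul_mem_ball ⟨hs.1.le, hs.2⟩ ht)
      rw [norm_mul]
      calc ‖(s : ℂ) ^ c‖ * ‖g (s * t)‖ ≤ 1 * ‖g (s * t)‖ := by
            gcongr
            exact norm_cpow_le_one hc hs
        _ ≤ M := by rw [one_mul]; exact h1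
  simpa [radialIntegral] using h

theorem radialIntegral_sub {c : ℂ} (hc : 0 < c.re) {g h : ℂ → ℂ} {r : ℝ}
    (hg : ContinuousOn g (Metric.ball 0 r)) (hh : ContinuousOn h (Metric.ball 0 r))
    {t : ℂ} (ht : t ∈ Metric.ball (0 : ℂ) r) :
    radialIntegral c g t - radialIntegral c h t = radialIntegral c (fun x => g x - h x) t := by
  rw [radialIntegral, radialIntegral, ← intervalIntegral.integral_sub
    (intervalIntegrable_radial hc hg ht) (intervalIntegrable_radial hc hh ht)]
  simp only [radialIntegral, mul_sub]

theorem hasDerivAt_radialIntegral {c : ℂ} (hc : 0 < c.re) {g : ℂ → ℂ} {r : ℝ}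
    (hg : DifferentiableOn ℂ g (Metric.ball 0 r)) {t : ℂ} (ht : t ∈ Metric.ball (0 : ℂ) r) :
    HasDerivAt (radialIntegral c g) (∫ s in (0 : ℝ)..1, (s : ℂ) ^ c * (deriv g (s * t) * s)) t := by
  have hg' : ContinuousOn (deriv g) (Metric.ball 0 r) :=
    (hg.deriv Metric.isOpen_ball).continuousOn
  have ht' : ‖t‖ < r := by simpa using ht
  obtain ⟨r', h1, h2⟩ := exists_between ht'
  have hsub : Metric.closedBall (0 : ℂ) r' ⊆ Metric.ball 0 r := Metric.closedBall_subset_ball h2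
  obtain ⟨M, hM⟩ := (isCompact_closedBall (0 : ℂ) r').exists_bound_of_continuousOn (hg'.mono hsub)
  have hnhds : Metric.ball (0 : ℂ) r' ∈ 𝓝 t := Metric.isOpen_ball.mem_nhds (by simpa using h1)
  have hball : Metric.ball (0 : ℂ) r' ⊆ Metric.ball 0 r := Metric.ball_subset_ball h2.le
  refine (intervalIntegral.hasDerivAt_integral_of_dominated_loc_of_deriv_le
    (F := fun x (s : ℝ) => (s : ℂ) ^ c * g (s * x))
    (F' := fun x (s : ℝ) => (s : ℂ) ^ c * (deriv g (s * x) * s))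
    (bound := fun _ => M) hnhds ?_ (intervalIntegrable_radial hc hg.continuousOn ht) ?_ ?_
    intervalIntegrable_const ?_).2
  · filter_upwards [hnhds] with x hx
    exact (intervalIntegrable_iff.mp
      (intervalIntegrable_radial hc hg.continuousOn (hball hx))).aestronglyMeasurable
  · refine (intervalIntegrable_iff.mp
      (ContinuousOn.intervalIntegrable ?_)).aestronglyMeasurable
    rw [Set.uIcc_of_le zero_le_one]
    refine (continuous_ofReal_cpow hc).continuousOn.mul (ContinuousOn.mul ?_ (by fun_prop))
    exact hg'.comp (by fun_prop) fun s hs => ofReal_mul_mem_ball hs ht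
  · refine Eventually.of_forall fun s hs x hx => ?_
    rw [Set.uIoc_of_le zero_le_one] at hs
    rw [norm_mul, norm_mul]
    have h3 := hM _ (Metric.ball_subset_closedBall (ofReal_mul_mem_ball ⟨hs.1.le, hs.2⟩ hx))
    have h4 : ‖(s : ℂ)‖ ≤ 1 := by
      rw [Complex.norm_real, Real.norm_of_nonneg hs.1.le]; exact hs.2
    have h5 := norm_cpow_le_one hc hs
    have h6 : ‖deriv g (s * x)‖ * ‖(s : ℂ)‖ ≤ M * 1 :=
      mul_le_mul h3 h4 (norm_nonneg _) ((norm_nonneg _).trans h3)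
    nlinarith [norm_nonneg ((s : ℂ) ^ c), norm_nonneg (deriv g (s * x)), norm_nonneg (s : ℂ),
      mul_nonneg (norm_nonneg (deriv g (s * x))) (norm_nonneg (s : ℂ))]
  · refine Eventually.of_forall fun s hs x hx => ?_
    rw [Set.uIoc_of_le zero_le_one] at hs
    have h3 : HasDerivAt g (deriv g (s * x)) (s * x) :=
      (hg.differentiableAt (Metric.isOpen_ball.mem_nhds
        (ofReal_mul_mem_ball ⟨hs.1.le, hs.2⟩ (hball hx)))).hasDerivAt
    have h4 : HasDerivAt (fun x : ℂ => (s : ℂ) * x) s x := by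
      simpa using (hasDerivAt_id x).const_mul (s : ℂ)
    exact (h3.comp x h4).const_mul _

/-- This is the integral over `[0, 1]` of the derivative in `s` of `s ^ (c + 1) * g (s t)`,
multiplied by `t`. The boundary term at `s = 0` vanishes because the real part of `c + 1` is
positive. -/
theorem radialIntegral_ode {c : ℂ} (hc : 0 < c.re) {g : ℂ → ℂ} {r : ℝ}
    (hg : DifferentiableOn ℂ g (Metric.ball 0 r)) {t : ℂ} (ht : t ∈ Metric.ball (0 : ℂ) r) :
    t * deriv (fun x => x * radialIntegral c g x) t =
      -c * (t * radialIntegral c g t) + t * g t := by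
  have hg' : ContinuousOn (deriv g) (Metric.ball 0 r) :=
    (hg.deriv Metric.isOpen_ball).continuousOn
  have h1 := hasDerivAt_radialIntegral hc hg ht
  have h2 := ((hasDerivAt_id t).mul h1).deriv
  have h2' : deriv (fun x => x * radialIntegral c g x) t = _ := h2
  rw [h2']
  have hc1 : 0 < (c + 1).re := by simp; linarith
  have i1 : IntervalIntegrable (fun s : ℝ => (s : ℂ) ^ c * g (s * t)) MeasureTheory.volume 0 1 :=
    intervalIntegrable_radial hc hg.continuousOn ht
  have i2 : IntervalIntegrable (fun s : ℝ => (s : ℂ) ^ c * (deriv g (s * t) * s))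
      MeasureTheory.volume 0 1 := by
    refine ContinuousOn.intervalIntegrable ?_
    rw [Set.uIcc_of_le zero_le_one]
    refine (continuous_ofReal_cpow hc).continuousOn.mul (ContinuousOn.mul ?_ (by fun_prop))
    exact hg'.comp (by fun_prop) fun s hs => ofReal_mul_mem_ball hs ht
  have h3 : ∫ s in (0 : ℝ)..1, ((c + 1) * ((s : ℂ) ^ c * g (s * t)) +
      t * ((s : ℂ) ^ c * (deriv g (s * t) * s))) = g t := by
    rw [intervalIntegral.integral_eq_sub_of_hasDerivAt_of_le
      (f := fun s : ℝ => (s : ℂ) ^ (c + 1) * g (s * t)) zero_le_one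
      (continuousOn_radial_integrand hc1 hg.continuousOn ht) ?_
      ((i1.const_mul _).add (i2.const_mul _))]
    · have : c + 1 ≠ 0 := fun h => by rw [h] at hc1; simp at hc1
      simp [this]
    · intro s hs
      have hs0 : (s : ℂ) ≠ 0 := by exact_mod_cast hs.1.ne'
      have hc0 : c + 1 ≠ 0 := fun h => by rw [h] at hc1; simp at hc1
      have d1 : HasDerivAt (fun s : ℝ => (s : ℂ) ^ (c + 1)) ((c + 1) * (s : ℂ) ^ c) s := by
        have := hasDerivAt_ofReal_cpow_const' (x := s) (r := c) hs.1.ne'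
          (fun h => by rw [h] at hc; norm_num at hc)
        have h5 := this.const_mul (c + 1)
        have e : (fun y : ℝ => (c + 1) * ((y : ℂ) ^ (c + 1) / (c + 1))) =
            fun s : ℝ => (s : ℂ) ^ (c + 1) := by
          funext y; field_simp
        rwa [e] at h5
      have d2 : HasDerivAt (fun s : ℝ => g (s * t)) (deriv g (s * t) * t) s := by
        have h5 : HasDerivAt g (deriv g (s * t)) (s * t) :=
          (hg.differentiableAt (Metric.isOpen_ball.mem_nhds
            (ofReal_mul_mem_ball ⟨hs.1.le, hs.2.le⟩ ht))).hasDerivAt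
        have h6 : HasDerivAt (fun s : ℝ => (s : ℂ) * t) t s := by
          simpa using (Complex.ofRealCLM.hasDerivAt (x := s)).mul_const t
        exact h5.comp s h6
      refine (d1.mul d2).congr_deriv ?_
      rw [Complex.cpow_add _ _ hs0, Complex.cpow_one]
      ring
  rw [intervalIntegral.integral_add (i1.const_mul _) (i2.const_mul _),
    intervalIntegral.integral_const_mul, intervalIntegral.integral_const_mul] at h3
  have h4 : radialIntegral c g t = ∫ s in (0 : ℝ)..1, (s : ℂ) ^ c * g (s * t) := rfl
  rw [← h4] at h3
  simp only [id]
  linear_combination t * h3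

/-! ### The Briot–Bouquet equation -/

/-- Picard iterates for `t φ' = -c φ + t H(φ, t)`. -/
noncomputable def picard (c : ℂ) (H : ℂ × ℂ → ℂ) : ℕ → ℂ → ℂ
  | 0 => fun _ => 0
  | n + 1 => fun t => t * radialIntegral c (fun x => H (picard c H n x, x)) t

/-- For `Re c > 0` the kernel `s ^ c` is bounded by `1` on `(0, 1]`, so the equation is a
fixed-point problem for a contraction on holomorphic functions over a small disc. The Picard
iterates converge uniformly, which keeps the limit holomorphic. -/
theorem exists_solution_of_re_pos {c : ℂ} (hc : 0 < c.re) {H : ℂ × ℂ → ℂ}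
    (hH : AnalyticAt ℂ H 0) :
    ∃ φ : ℂ → ℂ, AnalyticAt ℂ φ 0 ∧ φ 0 = 0 ∧
      ∀ᶠ t in 𝓝 (0 : ℂ), t * deriv φ t = -c * φ t + t * H (φ t, t) := by
  obtain ⟨K, U, hU, hLip⟩ := hH.hasStrictFDerivAt.exists_lipschitzOnWith
  have hbd : ∀ᶠ z in 𝓝 (0 : ℂ × ℂ), ‖H z‖ < ‖H 0‖ + 1 :=
    hH.continuousAt.norm.eventually_lt_const (by linarith)
  have hall := hH.eventually_analyticAt.and (hbd.and hU)
  obtain ⟨R', hR', hball⟩ := Metric.eventually_nhds_iff_ball.mp hall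
  set M : ℝ := ‖H 0‖ + 1 with hMdef
  have hM : 0 < M := by positivity
  set R := R' / 2 with hRdef
  have hR : 0 < R := by positivity
  -- The three bounds keep the graphs inside the domain of `H`, make the ball of radius `R` stable,
  -- and give the contraction factor `1 / 2`.
  obtain ⟨r, hr, hrR, hrM, hrK⟩ : ∃ r : ℝ, 0 < r ∧ r ≤ R ∧ r * M ≤ R ∧ r * K ≤ 1 / 2 := by
    refine ⟨min R (min (R / M) (1 / (2 * (K + 1)))), by positivity, min_le_left _ _, ?_, ?_⟩
    · calc _ ≤ R / M * M := by
            gcongr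
            exact (min_le_right _ _).trans (min_le_left _ _)
        _ = R := by field_simp
    · calc _ ≤ 1 / (2 * ((K : ℝ) + 1)) * K := by
            gcongr
            exact (min_le_right _ _).trans (min_le_right _ _)
        _ ≤ 1 / 2 := by
            have : (0 : ℝ) ≤ K := K.2
            rw [div_mul_eq_mul_div, div_le_div_iff₀ (by positivity) (by positivity)]
            nlinarith
  have hmem : ∀ {w t : ℂ}, ‖w‖ ≤ R → t ∈ Metric.ball (0 : ℂ) r →
      (w, t) ∈ Metric.ball (0 : ℂ × ℂ) R' := by
    intro w t hw ht
    rw [mem_ball_zero_iff] at *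
    rw [Prod.norm_def]
    refine max_lt ?_ ?_ <;> simp only <;> linarith
  have hdiff : ∀ {z : ℂ → ℂ}, DifferentiableOn ℂ z (Metric.ball 0 r) →
      (∀ t ∈ Metric.ball (0 : ℂ) r, ‖z t‖ ≤ R) →
      DifferentiableOn ℂ (fun x => H (z x, x)) (Metric.ball 0 r) := by
    intro z hz hzR t ht
    have h1 := (hball _ (hmem (hzR t ht) ht)).1.differentiableAt
    have h2 := hz.differentiableAt (Metric.isOpen_ball.mem_nhds ht)
    exact (DifferentiableAt.comp (g := H) (f := fun x => (z x, x)) t h1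
      (h2.prodMk differentiableAt_id)).differentiableWithinAt
  have hbound : ∀ {z : ℂ → ℂ}, (∀ t ∈ Metric.ball (0 : ℂ) r, ‖z t‖ ≤ R) →
      ∀ t ∈ Metric.ball (0 : ℂ) r, ‖H (z t, t)‖ ≤ M := fun hzR t ht =>
    (hball _ (hmem (hzR t ht) ht)).2.1.le
  have hlip : ∀ {z y : ℂ → ℂ} {δ : ℝ}, (∀ t ∈ Metric.ball (0 : ℂ) r, ‖z t‖ ≤ R) →
      (∀ t ∈ Metric.ball (0 : ℂ) r, ‖y t‖ ≤ R) →
      (∀ t ∈ Metric.ball (0 : ℂ) r, ‖z t - y t‖ ≤ δ) →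
      ∀ t ∈ Metric.ball (0 : ℂ) r, ‖H (z t, t) - H (y t, t)‖ ≤ K * δ := by
    intro z y δ hz hy hzy t ht
    have h1 := hLip.dist_le_mul _ (hball _ (hmem (hz t ht) ht)).2.2 _
      (hball _ (hmem (hy t ht) ht)).2.2
    rw [dist_eq_norm] at h1
    refine h1.trans ?_
    have : dist (z t, t) (y t, t) = ‖z t - y t‖ := by
      rw [Prod.dist_eq, dist_self, dist_eq_norm, max_eq_left (norm_nonneg _)]
    rw [this]
    exact mul_le_mul_of_nonneg_left (hzy t ht) K.2
  have hcontr : ∀ {z y : ℂ → ℂ} {δ : ℝ}, DifferentiableOn ℂ z (Metric.ball 0 r) →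
      DifferentiableOn ℂ y (Metric.ball 0 r) → (∀ t ∈ Metric.ball (0 : ℂ) r, ‖z t‖ ≤ R) →
      (∀ t ∈ Metric.ball (0 : ℂ) r, ‖y t‖ ≤ R) → 0 ≤ δ →
      (∀ t ∈ Metric.ball (0 : ℂ) r, ‖z t - y t‖ ≤ δ) → ∀ t ∈ Metric.ball (0 : ℂ) r,
      ‖t * radialIntegral c (fun x => H (z x, x)) t -
        t * radialIntegral c (fun x => H (y x, x)) t‖ ≤ δ / 2 := by
    intro z y δ hz hy hzR hyR hδ hzy t ht
    rw [← mul_sub, radialIntegral_sub hc (hdiff hz hzR).continuousOn (hdiff hy hyR).continuousOn ht,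
      norm_mul]
    have h1 := norm_radialIntegral_le hc (hlip hzR hyR hzy) ht
    have h2 : ‖t‖ ≤ r := by simpa using (mem_ball_zero_iff.mp ht).le
    calc _ ≤ r * (K * δ) := by gcongr
      _ = r * K * δ := by ring
      _ ≤ 1 / 2 * δ := by gcongr
      _ = δ / 2 := by ring
  have hstep : ∀ {z : ℂ → ℂ}, DifferentiableOn ℂ z (Metric.ball 0 r) →
      (∀ t ∈ Metric.ball (0 : ℂ) r, ‖z t‖ ≤ R) →
      DifferentiableOn ℂ (fun t => t * radialIntegral c (fun x => H (z x, x)) t)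
        (Metric.ball 0 r) ∧
      ∀ t ∈ Metric.ball (0 : ℂ) r, ‖t * radialIntegral c (fun x => H (z x, x)) t‖ ≤ R := by
    intro z hz hzR
    refine ⟨fun t ht => ?_, fun t ht => ?_⟩
    · exact (differentiableAt_id.mul (hasDerivAt_radialIntegral hc
        (hdiff hz hzR) ht).differentiableAt).differentiableWithinAt
    · rw [norm_mul]
      have h1 := norm_radialIntegral_le hc (hbound hzR) ht
      have h2 : ‖t‖ ≤ r := (mem_ball_zero_iff.mp ht).le
      exact (mul_le_mul h2 h1 (norm_nonneg _) hr.le).trans hrM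
  have hP : ∀ n, DifferentiableOn ℂ (picard c H n) (Metric.ball 0 r) ∧
      ∀ t ∈ Metric.ball (0 : ℂ) r, ‖picard c H n t‖ ≤ R := by
    intro n
    induction n with
    | zero => exact ⟨differentiableOn_const _, fun t _ => by simpa [picard] using hR.le⟩
    | succ n ih => exact hstep ih.1 ih.2
  have hD : ∀ n, ∀ t ∈ Metric.ball (0 : ℂ) r,
      ‖picard c H (n + 1) t - picard c H n t‖ ≤ R * (1 / 2) ^ n := by
    intro n
    induction n with
    | zero =>
      intro t ht
      simpa [picard] using (hP 1).2 t ht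
    | succ n ih =>
      intro t ht
      refine (hcontr (hP (n + 1)).1 (hP n).1 (hP (n + 1)).2 (hP n).2 (by positivity) ih t ht).trans
        (le_of_eq ?_)
      ring
  have hlim : ∀ t ∈ Metric.ball (0 : ℂ) r, ∃ w, Tendsto (fun n => picard c H n t) atTop (𝓝 w) :=
    fun t ht => cauchySeq_tendsto_of_complete <|
      cauchySeq_of_le_geometric (1 / 2) R (by norm_num) fun n => by
        rw [dist_comm, dist_eq_norm]; exact hD n t ht
  classical
  choose! φ hφ using hlim
  have hdist : ∀ n, ∀ t ∈ Metric.ball (0 : ℂ) r, ‖picard c H n t - φ t‖ ≤ R * 2 * (1 / 2) ^ n := by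
    intro n t ht
    have := dist_le_of_le_geometric_of_tendsto (1 / 2) R (by norm_num) (fun n => by
        rw [dist_comm, dist_eq_norm]; exact hD n t ht) (hφ t ht) n
    rw [dist_eq_norm] at this
    refine this.trans (le_of_eq ?_)
    ring
  have hgeom : Tendsto (fun n : ℕ => R * 2 * (1 / 2 : ℝ) ^ n) atTop (𝓝 0) := by
    have := (tendsto_pow_atTop_nhds_zero_of_lt_one (r := (1 / 2 : ℝ)) (by norm_num)
      (by norm_num)).const_mul (R * 2)
    simpa using this
  have hunif : TendstoUniformlyOn (picard c H) φ atTop (Metric.ball 0 r) := by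
    rw [Metric.tendstoUniformlyOn_iff]
    intro ε hε
    filter_upwards [hgeom.eventually_lt_const hε] with n hn t ht
    rw [dist_comm, dist_eq_norm]
    exact (hdist n t ht).trans_lt hn
  have hφd : DifferentiableOn ℂ φ (Metric.ball 0 r) :=
    hunif.tendstoLocallyUniformlyOn.differentiableOn
      (Eventually.of_forall fun n => (hP n).1) Metric.isOpen_ball
  have hφR : ∀ t ∈ Metric.ball (0 : ℂ) r, ‖φ t‖ ≤ R := fun t ht =>
    le_of_tendsto (hφ t ht).norm (Eventually.of_forall fun n => (hP n).2 t ht)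
  have hfix : ∀ t ∈ Metric.ball (0 : ℂ) r,
      φ t = t * radialIntegral c (fun x => H (φ x, x)) t := by
    intro t ht
    refine tendsto_nhds_unique ((tendsto_add_atTop_iff_nat 1).mpr (hφ t ht)) ?_
    rw [tendsto_iff_norm_sub_tendsto_zero]
    refine squeeze_zero (fun _ => norm_nonneg _)
      (fun n => hcontr (hP n).1 hφd (hP n).2 hφR (by positivity) (hdist n) t ht) ?_
    simpa using hgeom.div_const 2
  have h0 : (0 : ℂ) ∈ Metric.ball (0 : ℂ) r := by simpa using hr
  refine ⟨φ, hφd.analyticAt (Metric.isOpen_ball.mem_nhds h0), by rw [hfix 0 h0, zero_mul], ?_⟩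
  filter_upwards [Metric.isOpen_ball.mem_nhds h0] with t ht
  have h1 := radialIntegral_ode hc (hdiff hφd hφR) ht
  have h2 : φ =ᶠ[𝓝 t] fun x => x * radialIntegral c (fun x => H (φ x, x)) x := by
    filter_upwards [Metric.isOpen_ball.mem_nhds ht] with x hx using hfix x hx
  rw [h2.deriv_eq, h1, ← hfix t ht]

theorem eventually_fst_axis {p : ℂ × ℂ → Prop} (h : ∀ᶠ z in 𝓝 (0 : ℂ × ℂ), p z) :
    ∀ᶠ x in 𝓝 (0 : ℂ), p (x, 0) :=
  (by fun_prop : Continuous fun x : ℂ => (x, (0 : ℂ))).tendsto' 0 0 rfl |>.eventually h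

/-- The substitution `w = t (y₀ + z)` lowers the exponent of a Briot–Bouquet equation by one. -/
theorem briotBouquet_reduction {F : ℂ × ℂ → ℂ} (hF : AnalyticAt ℂ F 0) (hF0 : F 0 = 0) {ρ : ℂ}
    (hρ : fderiv ℂ F 0 (1, 0) = ρ) (hρ1 : ρ ≠ 1) :
    ∃ (y₀ : ℂ) (H : ℂ × ℂ → ℂ), AnalyticAt ℂ H 0 ∧
      ∀ᶠ z in 𝓝 (0 : ℂ × ℂ),
        F (z.2 * (y₀ + z.1), z.2) = z.2 * (y₀ + z.1 + ((ρ - 1) * z.1 + z.2 * H z)) := by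
  -- `y₀` is the forced value of `φ' 0`: at first order, `t φ' = F (φ, t)` reads `y₀ = ρ y₀ +
  -- ∂F/∂t`.
  set y₀ : ℂ := fderiv ℂ F 0 (0, 1) / (1 - ρ) with hy₀
  have h1ρ : 1 - ρ ≠ 0 := sub_ne_zero.mpr hρ1.symm
  have hFG : AnalyticAt ℂ (fun z : ℂ × ℂ => F (z.2 * (y₀ + z.1), z.2)) 0 := by
    exact AnalyticAt.comp_of_eq (g := F) (f := fun z : ℂ × ℂ => (z.2 * (y₀ + z.1), z.2)) hF
      ((analyticAt_snd.mul (analyticAt_const.add analyticAt_fst)).prod analyticAt_snd)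
      (by ext <;> simp)
  obtain ⟨G, hG, hFG'⟩ := exists_eq_snd_mul hFG (Eventually.of_forall fun x => by
    simp only [zero_mul]
    exact hF0)
  have hG0 : ∀ᶠ x in 𝓝 (0 : ℂ), G (x, 0) = y₀ + x + (ρ - 1) * x := by
    have h2 := eventually_fst_axis (hFG'.eventually_nhds.and hG.eventually_analyticAt)
    filter_upwards [h2] with x hx
    have d1 : HasDerivAt (fun t : ℂ => F (t * (y₀ + x), t)) (ρ * (y₀ + x) + (1 - ρ) * y₀) 0 := by
      have e1 : HasFDerivAt F (fderiv ℂ F 0) 0 := hF.differentiableAt.hasFDerivAt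
      have e2 : HasDerivAt (fun t : ℂ => (t * (y₀ + x), t)) (y₀ + x, 1) 0 := by
        simpa using ((hasDerivAt_id (0 : ℂ)).mul_const (y₀ + x)).prodMk (hasDerivAt_id (0 : ℂ))
      have e3 := HasFDerivAt.comp_hasDerivAt_of_eq (0 : ℂ) e1 e2 (by ext <;> simp)
      have e4 : ((y₀ + x, 1) : ℂ × ℂ) = (y₀ + x) • ((1, 0) : ℂ × ℂ) + (0, 1) := by simp
      rw [e4, map_add, map_smul, hρ] at e3
      have e5 : fderiv ℂ F 0 (0, 1) = (1 - ρ) * y₀ := by rw [hy₀]; field_simp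
      rw [e5, smul_eq_mul, mul_comm (y₀ + x)] at e3
      exact e3
    have d2 : HasDerivAt (fun t : ℂ => t * G (x, t)) (G (x, 0)) 0 := by
      have e1 : DifferentiableAt ℂ (fun t : ℂ => G (x, t)) 0 :=
        DifferentiableAt.comp (0 : ℂ) hx.2.differentiableAt
          ((differentiableAt_const x).prodMk differentiableAt_id)
      exact ((hasDerivAt_id (0 : ℂ)).mul e1.hasDerivAt).congr_deriv (by simp)
    have d3 : (fun t : ℂ => F (t * (y₀ + x), t)) =ᶠ[𝓝 0] fun t => t * G (x, t) :=
      (by fun_prop : Continuous fun t : ℂ => (x, t)).tendsto 0 |>.eventually hx.1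
    have := d1.unique (d2.congr_of_eventuallyEq d3)
    rw [← this]
    ring
  have hK : AnalyticAt ℂ (fun z : ℂ × ℂ => G z - (y₀ + z.1 + (ρ - 1) * z.1)) 0 :=
    hG.sub ((analyticAt_const.add analyticAt_fst).add (analyticAt_const.mul analyticAt_fst))
  obtain ⟨H, hH, hKH⟩ := exists_eq_snd_mul hK (by
    filter_upwards [hG0] with x hx
    rw [hx, sub_self])
  refine ⟨y₀, H, hH, ?_⟩
  filter_upwards [hFG', hKH] with z h1 h2
  rw [h1]
  linear_combination z.2 * h2

theorem briotBouquet_of_reduction {F H : ℂ × ℂ → ℂ} {ρ y₀ : ℂ}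
    (h : ∀ᶠ z in 𝓝 (0 : ℂ × ℂ),
      F (z.2 * (y₀ + z.1), z.2) = z.2 * (y₀ + z.1 + ((ρ - 1) * z.1 + z.2 * H z)))
    {ψ : ℂ → ℂ} (hψ : AnalyticAt ℂ ψ 0) (hψ0 : ψ 0 = 0)
    (hode : ∀ᶠ t in 𝓝 (0 : ℂ), t * deriv ψ t = (ρ - 1) * ψ t + t * H (ψ t, t)) :
    ∃ φ : ℂ → ℂ, AnalyticAt ℂ φ 0 ∧ φ 0 = 0 ∧ ∀ᶠ t in 𝓝 (0 : ℂ), t * deriv φ t = F (φ t, t) := by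
  refine ⟨fun t => t * (y₀ + ψ t), analyticAt_id.mul (analyticAt_const.add hψ), by simp, ?_⟩
  have h1 : Tendsto (fun t : ℂ => (ψ t, t)) (𝓝 0) (𝓝 (0 : ℂ × ℂ)) := by
    have : ContinuousAt (fun t : ℂ => (ψ t, t)) 0 := hψ.continuousAt.prodMk continuousAt_id
    rw [ContinuousAt, hψ0] at this
    exact this
  filter_upwards [h1.eventually h, hode, hψ.eventually_analyticAt] with t h2 h3 h4
  have h5 : deriv (fun t => t * (y₀ + ψ t)) t = y₀ + ψ t + t * deriv ψ t := by
    have := (hasDerivAt_id t).mul (h4.differentiableAt.hasDerivAt.const_add y₀)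
    exact (this.congr_deriv (by simp)).deriv
  rw [h5]
  rw [h2]
  linear_combination t * h3

/-- Each substitution lowers `ρ` by one, until its real part is negative and the integral equation
applies. The positive integers are the values for which some stage would meet exponent `1`, where
`y₀` cannot be solved for. -/
theorem briotBouquet (N : ℕ) : ∀ {ρ : ℂ} {F : ℂ × ℂ → ℂ}, ρ.re < N + 1 →
    (∀ m : ℕ, 0 < m → ρ ≠ m) → AnalyticAt ℂ F 0 → F 0 = 0 → fderiv ℂ F 0 (1, 0) = ρ →
    ∃ φ : ℂ → ℂ, AnalyticAt ℂ φ 0 ∧ φ 0 = 0 ∧ ∀ᶠ t in 𝓝 (0 : ℂ), t * deriv φ t = F (φ t, t) := by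
  induction N with
  | zero =>
    intro ρ F hN hρ hF hF0 hd
    obtain ⟨y₀, H, hH, h⟩ := briotBouquet_reduction hF hF0 hd (by simpa using hρ 1 one_pos)
    obtain ⟨ψ, h1, h2, h3⟩ := exists_solution_of_re_pos (c := 1 - ρ) (by simpa using hN) hH
    refine briotBouquet_of_reduction h h1 h2 ?_
    filter_upwards [h3] with t ht
    rw [ht]
    ring
  | succ N ih =>
    intro ρ F hN hρ hF hF0 hd
    obtain ⟨y₀, H, hH, h⟩ := briotBouquet_reduction hF hF0 hd (by simpa using hρ 1 one_pos)
    have hd' : HasFDerivAt (fun z : ℂ × ℂ => (ρ - 1) * z.1 + z.2 * H z)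
        ((ρ - 1) • ContinuousLinearMap.fst ℂ ℂ ℂ +
          ((0 : ℂ × ℂ).2 • fderiv ℂ H 0 + H 0 • ContinuousLinearMap.snd ℂ ℂ ℂ)) 0 :=
      (hasFDerivAt_fst.const_mul (ρ - 1)).add
        (hasFDerivAt_snd.mul hH.differentiableAt.hasFDerivAt)
    obtain ⟨ψ, h1, h2, h3⟩ := ih (ρ := ρ - 1) (F := fun z => (ρ - 1) * z.1 + z.2 * H z)
      (by push_cast at hN; simp; linarith)
      (fun m hm h => hρ (m + 1) (by omega) (by push_cast; linear_combination h))
      ((analyticAt_const.mul analyticAt_fst).add (analyticAt_snd.mul hH)) (by simp)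
      (by rw [hd'.fderiv]; simp)
    exact briotBouquet_of_reduction h h1 h2 h3

/-- A singularity on the invariant line `y = 0` whose exponents have no positive integer quotient
carries an analytic invariant curve transverse to that line. -/
theorem exists_transverse_curve {η : Form} {p : ℂ} (hη : AnalyticAt ℂ η (p, 0))
    (hinv : ∀ᶠ x in 𝓝 p, (η (x, 0)).1 = 0) (h0 : (η (p, 0)).2 = 0)
    (ha : (fderiv ℂ η (p, 0) (0, 1)).1 ≠ 0)
    (hm : ∀ m : ℕ, 0 < m → (fderiv ℂ η (p, 0) (1, 0)).2 ≠ -m * (fderiv ℂ η (p, 0) (0, 1)).1) :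
    ∃ φ : ℂ → ℂ, AnalyticAt ℂ φ 0 ∧ φ 0 = p ∧
      ∀ᶠ t in 𝓝 (0 : ℂ), (η (φ t, t)).1 * deriv φ t + (η (φ t, t)).2 = 0 := by
  have htr : AnalyticAt ℂ (fun z : ℂ × ℂ => (p + z.1, z.2)) 0 :=
    (analyticAt_const.add analyticAt_fst).prod analyticAt_snd
  have hη' : AnalyticAt ℂ (fun z : ℂ × ℂ => η (p + z.1, z.2)) 0 := by
    exact AnalyticAt.comp_of_eq (g := η) (f := fun z : ℂ × ℂ => (p + z.1, z.2)) hη htr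
      (by ext <;> simp)
  have hA : AnalyticAt ℂ (fun z : ℂ × ℂ => (η (p + z.1, z.2)).1) 0 :=
    analyticAt_fst.comp hη'
  have hB : AnalyticAt ℂ (fun z : ℂ × ℂ => (η (p + z.1, z.2)).2) 0 :=
    analyticAt_snd.comp hη'
  have hfd : fderiv ℂ (fun z : ℂ × ℂ => η (p + z.1, z.2)) 0 = fderiv ℂ η (p, 0) := by
    have e : (fun z : ℂ × ℂ => η (p + z.1, z.2)) = fun z => η ((p, 0) + z) := by
      funext z; congr 1; ext <;> simp
    rw [e, fderiv_comp_add_left, add_zero]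
  have hηd := hη'.differentiableAt.hasFDerivAt
  rw [hfd] at hηd
  obtain ⟨A₁, hA₁, hAA⟩ := exists_eq_snd_mul hA (by
    have : Tendsto (fun x : ℂ => p + x) (𝓝 0) (𝓝 p) :=
      (by fun_prop : Continuous fun x : ℂ => p + x).tendsto' 0 p (by simp)
    exact this.eventually hinv)
  have hA₁0 : A₁ 0 = (fderiv ℂ η (p, 0) (0, 1)).1 := by
    have e1 : HasFDerivAt (fun z : ℂ × ℂ => (η (p + z.1, z.2)).1)
        ((ContinuousLinearMap.fst ℂ ℂ ℂ).comp (fderiv ℂ η (p, 0))) 0 :=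
      hasFDerivAt_fst.comp _ hηd
    have e2 : HasFDerivAt (fun z : ℂ × ℂ => z.2 * A₁ z)
        ((0 : ℂ × ℂ).2 • fderiv ℂ A₁ 0 + A₁ 0 • ContinuousLinearMap.snd ℂ ℂ ℂ) 0 :=
      hasFDerivAt_snd.mul hA₁.differentiableAt.hasFDerivAt
    have e3 := e1.unique (e2.congr_of_eventuallyEq hAA)
    have e4 := congrArg (fun L : ℂ × ℂ →L[ℂ] ℂ => L (0, 1)) e3
    simpa using e4.symm
  have hA₁ne : A₁ 0 ≠ 0 := hA₁0 ▸ ha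
  -- With `A = y A₁`, invariance of the curve `x = p + φ y` becomes `y φ' = F (φ, y)` with `F = -B /
  -- A₁`, whose exponent is minus the quotient of `∂B/∂x` by `∂A/∂y`.
  set F : ℂ × ℂ → ℂ := fun z => -((A₁ z)⁻¹ * (η (p + z.1, z.2)).2) with hFdef
  have hF : AnalyticAt ℂ F 0 := ((hA₁.inv hA₁ne).mul hB).neg
  have hF0 : F 0 = 0 := by simp [hFdef, h0]
  set ρ := fderiv ℂ F 0 (1, 0) with hρ
  have hρ' : ρ * (fderiv ℂ η (p, 0) (0, 1)).1 = -(fderiv ℂ η (p, 0) (1, 0)).2 := by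
    have e1 : HasFDerivAt (fun z : ℂ × ℂ => (η (p + z.1, z.2)).2)
        ((ContinuousLinearMap.snd ℂ ℂ ℂ).comp (fderiv ℂ η (p, 0))) 0 :=
      hasFDerivAt_snd.comp _ hηd
    have e2 : HasFDerivAt F (-((A₁ 0)⁻¹ • ((ContinuousLinearMap.snd ℂ ℂ ℂ).comp
        (fderiv ℂ η (p, 0))) + (η (p + (0 : ℂ × ℂ).1, (0 : ℂ × ℂ).2)).2 •
          fderiv ℂ (fun z => (A₁ z)⁻¹) 0)) 0 :=
      ((hA₁.inv hA₁ne).differentiableAt.hasFDerivAt.mul e1).neg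
    rw [hρ, e2.fderiv, ← hA₁0]
    simp [h0]
    field_simp
  have hρm : ∀ m : ℕ, 0 < m → ρ ≠ m := by
    intro m hm0 h
    apply hm m hm0
    rw [h] at hρ'
    linear_combination hρ'
  obtain ⟨N, hN⟩ := exists_nat_gt ρ.re
  obtain ⟨φ, h1, h2, h3⟩ := briotBouquet N (by linarith) hρm hF hF0 hρ.symm
  refine ⟨fun t => p + φ t, analyticAt_const.add h1, by simp [h2], ?_⟩
  have hφ : Tendsto (fun t : ℂ => (φ t, t)) (𝓝 0) (𝓝 (0 : ℂ × ℂ)) := by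
    have : ContinuousAt (fun t : ℂ => (φ t, t)) 0 := h1.continuousAt.prodMk continuousAt_id
    rw [ContinuousAt, h2] at this
    exact this
  filter_upwards [h3, hφ.eventually hAA, hφ.eventually (hA₁.continuousAt.eventually_ne hA₁ne)]
    with t h4 h5 h6
  rw [deriv_const_add]
  rw [h5]
  simp only [hFdef] at h4
  have h7 : t * A₁ (φ t, t) * deriv φ t = A₁ (φ t, t) * (t * deriv φ t) := by ring
  rw [h7, h4]
  field_simp
  ring

/-! ### Charts and exponents -/

/-- The order along a divisor of weight `V` of the monomial with exponent `P`. -/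
def dot (V P : ℕ × ℕ) : ℕ := V.1 * P.1 + V.2 * P.2

/-- The contraction with weight `V` of the logarithmic coefficients at `P`. -/
def pair (V : ℕ × ℕ) (A B : ℕ × ℕ → ℂ) (P : ℕ × ℕ) : ℂ := V.1 * A P + V.2 * B P

/-- Consecutive divisors in the chain meet transversally. -/
def Unimodular (V W : ℕ × ℕ) : Prop := V.1 * W.2 = V.2 * W.1 + 1

theorem Unimodular.fst_pos {V W : ℕ × ℕ} (h : Unimodular V W) : 0 < V.1 := by
  rcases Nat.eq_zero_or_pos V.1 with h0 | h0
  · rw [Unimodular, h0] at h; omega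
  · exact h0

theorem Unimodular.snd_pos {V W : ℕ × ℕ} (h : Unimodular V W) : 0 < W.2 := by
  rcases Nat.eq_zero_or_pos W.2 with h0 | h0
  · rw [Unimodular, h0] at h; omega
  · exact h0

/-- Cramer's rule with determinant one: the orders along two adjacent divisors determine a point of
the Newton diagram. -/
theorem Unimodular.eq_of_dot {V W : ℕ × ℕ} (h : Unimodular V W) {P Q : ℕ × ℕ}
    (hV : dot V P = dot V Q) (hW : dot W P = dot W Q) : P = Q := by
  simp only [Unimodular, dot] at h hV hW
  zify at h hV hW
  ext
  · zify
    linear_combination W.2 * hV - V.2 * hW - (P.1 - Q.1 : ℤ) * h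
  · zify
    linear_combination V.1 * hW - W.1 * hV - (P.2 - Q.2 : ℤ) * h

theorem Unimodular.injective {V W : ℕ × ℕ} (h : Unimodular V W) :
    Function.Injective (chartExp V W) := fun _ _ hPQ =>
  h.eq_of_dot (congrArg Prod.fst hPQ) (congrArg Prod.snd hPQ)

theorem Unimodular.eq_zero_of_pair {V W : ℕ × ℕ} (h : Unimodular V W) {A B : ℕ × ℕ → ℂ}
    {P : ℕ × ℕ} (hV : pair V A B P = 0) (hW : pair W A B P = 0) : A P = 0 ∧ B P = 0 := by
  simp only [Unimodular, pair] at h hV hW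
  have h' : (V.1 : ℂ) * W.2 = V.2 * W.1 + 1 := by exact_mod_cast h
  constructor
  · linear_combination W.2 * hV - V.2 * hW - A P * h'
  · linear_combination V.1 * hW - W.1 * hV - B P * h'

theorem Unimodular.pair_ne_zero {V W : ℕ × ℕ} (h : Unimodular V W) {A B : ℕ × ℕ → ℂ}
    {P : ℕ × ℕ} (hP : A P ≠ 0 ∨ B P ≠ 0) : pair V A B P ≠ 0 ∨ pair W A B P ≠ 0 := by
  by_contra! h0
  have := h.eq_zero_of_pair h0.1 h0.2
  tauto

theorem supp_of_pair_ne_zero {V : ℕ × ℕ} {A B : ℕ × ℕ → ℂ} {P : ℕ × ℕ}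
    (h : pair V A B P ≠ 0) : A P ≠ 0 ∨ B P ≠ 0 := by
  by_contra! h0
  simp [pair, h0.1, h0.2] at h

theorem chartMap_zero {V W : ℕ × ℕ} (h : Unimodular V W) : chartMap V W 0 = 0 := by
  simp [chartMap, h.fst_pos.ne', h.snd_pos.ne']

theorem chartMap_axis {V W : ℕ × ℕ} (hW1 : 0 < W.1) (hW2 : 0 < W.2) (x : ℂ) :
    chartMap V W (x, 0) = 0 := by
  simp [chartMap, hW1.ne', hW2.ne']

theorem natCast_mul_pow_pred (n : ℕ) (x : ℂ) : x * (n * x ^ (n - 1)) = n * x ^ n := by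
  cases n with
  | zero => simp
  | succ n => rw [Nat.add_sub_cancel, pow_succ]; ring

/-- In logarithmic form the pull-back is linear in the weights: `dx/x` becomes `V.1 dx/x + W.1
dy/y`. Multiplying by the coordinate also removes the truncated exponents `V.1 - 1`. -/
theorem fst_mul_pullback (ω : Form) (V W : ℕ × ℕ) (z : ℂ × ℂ) :
    z.1 * (pullback ω V W z).1 =
      V.1 * ((chartMap V W z).1 * (ω (chartMap V W z)).1) +
        V.2 * ((chartMap V W z).2 * (ω (chartMap V W z)).2) := by
  have h1 := natCast_mul_pow_pred V.1 z.1
  have h2 := natCast_mul_pow_pred V.2 z.1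
  simp only [pullback]
  have e1 : (chartMap V W z).1 = z.1 ^ V.1 * z.2 ^ W.1 := rfl
  have e2 : (chartMap V W z).2 = z.1 ^ V.2 * z.2 ^ W.2 := rfl
  generalize (ω (chartMap V W z)) = w
  rw [e1, e2]
  linear_combination w.1 * z.2 ^ W.1 * h1 + w.2 * z.2 ^ W.2 * h2

theorem snd_mul_pullback (ω : Form) (V W : ℕ × ℕ) (z : ℂ × ℂ) :
    z.2 * (pullback ω V W z).2 =
      W.1 * ((chartMap V W z).1 * (ω (chartMap V W z)).1) +
        W.2 * ((chartMap V W z).2 * (ω (chartMap V W z)).2) := by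
  have h1 := natCast_mul_pow_pred W.1 z.2
  have h2 := natCast_mul_pow_pred W.2 z.2
  simp only [pullback]
  have e1 : (chartMap V W z).1 = z.1 ^ V.1 * z.2 ^ W.1 := rfl
  have e2 : (chartMap V W z).2 = z.1 ^ V.2 * z.2 ^ W.2 := rfl
  generalize (ω (chartMap V W z)) = w
  rw [e1, e2]
  linear_combination w.1 * z.1 ^ V.1 * h1 + w.2 * z.1 ^ V.2 * h2

/-! ### Coefficients of the strict transform at the origin of a chart -/

/-- `A` and `B` are the coefficients of `ω = Σ x ^ i y ^ j (A dx / x + B dy / y)`. -/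
structure LogCoeffs (ω : Form) (A B : ℕ × ℕ → ℂ) : Prop where
  fst : HasCoeffs A (fun z => z.1 * (ω z).1)
  snd : HasCoeffs B (fun z => z.2 * (ω z).2)

/-- `IsStrictTransform` with the exponents of the exceptional monomial made explicit. -/
def IsStrictTransformWith (ω : Form) (V W : ℕ × ℕ) (η : Form) (α β : ℕ) : Prop :=
  ∀ P : ℂ × ℂ, chartMap V W P = 0 →
    AnalyticAt ℂ η P ∧
    (∀ᶠ z in 𝓝 P, pullback ω V W z = (z.1 ^ α * z.2 ^ β) • η z) ∧
    (∀ᶠ z in 𝓝[≠] P, η z ≠ 0)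

/-- The relation between the Taylor coefficients of the strict transform at the origin of a chart
and the logarithmic coefficients of the form. -/
structure StrictCoeffs (A B : ℕ × ℕ → ℂ) (V W : ℕ × ℕ) (η : Form) (α β : ℕ)
    (e₁ e₂ : ℕ × ℕ → ℂ) : Prop where
  fst : HasCoeffs e₁ (fun z => (η z).1)
  snd : HasCoeffs e₂ (fun z => (η z).2)
  fst_supp : ∀ P, pair V A B P ≠ 0 → ∃ i j, dot V P = i + (α + 1) ∧ dot W P = j + β
  fst_eq : ∀ P i j, dot V P = i + (α + 1) → dot W P = j + β → e₁ (i, j) = pair V A B P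
  fst_ex : ∀ i j, e₁ (i, j) ≠ 0 → ∃ P, dot V P = i + (α + 1) ∧ dot W P = j + β
  snd_supp : ∀ P, pair W A B P ≠ 0 → ∃ i j, dot V P = i + α ∧ dot W P = j + (β + 1)
  snd_eq : ∀ P i j, dot V P = i + α → dot W P = j + (β + 1) → e₂ (i, j) = pair W A B P
  snd_ex : ∀ i j, e₂ (i, j) ≠ 0 → ∃ P, dot V P = i + α ∧ dot W P = j + (β + 1)

/-- Each side vanishes off the range of its exponent map, so a non-zero coefficient on one side has
its exponent in the range of the other. -/
theorem extend_dictionary {V W : ℕ × ℕ} (h : Unimodular V W) {c e : ℕ × ℕ → ℂ} {m n : ℕ}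
    (heq : Function.extend (chartExp V W) c 0 =
      Function.extend (fun p : ℕ × ℕ => (p.1 + m, p.2 + n)) e 0) :
    (∀ P, c P ≠ 0 → ∃ i j, dot V P = i + m ∧ dot W P = j + n) ∧
    (∀ P i j, dot V P = i + m → dot W P = j + n → e (i, j) = c P) ∧
    (∀ i j, e (i, j) ≠ 0 → ∃ P, dot V P = i + m ∧ dot W P = j + n) := by
  have hs : Function.Injective (fun p : ℕ × ℕ => (p.1 + m, p.2 + n)) := fun p q h => by
    simp only [Prod.mk.injEq, add_left_inj] at h
    exact Prod.ext h.1 h.2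
  refine ⟨fun P hP => ?_, fun P i j h1 h2 => ?_, fun i j hij => ?_⟩
  · by_contra! hne
    have h1 := congrFun heq (chartExp V W P)
    rw [h.injective.extend_apply, Function.extend_apply'] at h1
    · exact hP h1
    · rintro ⟨⟨i, j⟩, hij⟩
      exact hne i j (congrArg Prod.fst hij).symm (congrArg Prod.snd hij).symm
  · have h3 := congrFun heq (chartExp V W P)
    have h4 : chartExp V W P = (fun p : ℕ × ℕ => (p.1 + m, p.2 + n)) (i, j) := Prod.ext h1 h2
    rw [h.injective.extend_apply, h4, hs.extend_apply] at h3
    exact h3.symm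
  · by_contra! hne
    have h1 := congrFun heq ((fun p : ℕ × ℕ => (p.1 + m, p.2 + n)) (i, j))
    rw [hs.extend_apply, Function.extend_apply'] at h1
    · exact hij h1.symm
    · rintro ⟨P, hP⟩
      exact hne P (congrArg Prod.fst hP) (congrArg Prod.snd hP)

/-- Two expansions of one germ are compared: the logarithmic series of `ω` pulled back, and the
Taylor series of `η` times the exceptional monomial. The shifts `α + 1` and `β + 1` come from the
extra factor `x` or `y` that passes from `dx`, `dy` to `dx/x`, `dy/y`. -/
theorem IsStrictTransformWith.exists_strictCoeffs {ω : Form} {V W : ℕ × ℕ} {η : Form} {α β : ℕ}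
    (hη : IsStrictTransformWith ω V W η α β) (h : Unimodular V W) {A B : ℕ × ℕ → ℂ}
    (hω : LogCoeffs ω A B) : ∃ e₁ e₂, StrictCoeffs A B V W η α β e₁ e₂ := by
  obtain ⟨han, heq, -⟩ := hη 0 (chartMap_zero h)
  obtain ⟨e₁, he₁⟩ := exists_hasCoeffs (f := fun z => (η z).1) (analyticAt_fst.comp han)
  obtain ⟨e₂, he₂⟩ := exists_hasCoeffs (f := fun z => (η z).2) (analyticAt_snd.comp han)
  have p1 : 0 < V.1 + W.1 := by have := h.fst_pos; omega
  have p2 : 0 < V.2 + W.2 := by have := h.snd_pos; omega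
  have key1 := ((hω.fst.linear_comb hω.snd V.1 V.2).comp_chartMap p1 p2 h.injective).unique
    (he₁.monomial_mul (α + 1) β) (by
      filter_upwards [heq] with z hz
      rw [← fst_mul_pullback, hz]
      simp only [Prod.smul_fst, smul_eq_mul]
      ring)
  have key2 := ((hω.fst.linear_comb hω.snd W.1 W.2).comp_chartMap p1 p2 h.injective).unique
    (he₂.monomial_mul α (β + 1)) (by
      filter_upwards [heq] with z hz
      rw [← snd_mul_pullback, hz]
      simp only [Prod.smul_snd, smul_eq_mul]
      ring)
  obtain ⟨a1, a2, a3⟩ := extend_dictionary h key1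
  obtain ⟨b1, b2, b3⟩ := extend_dictionary h key2
  exact ⟨e₁, e₂, he₁, he₂, a1, a2, a3, b1, b2, b3⟩

/-! ### Restriction to the divisor `y = 0` -/

/-- The exponents of order `m` along the divisor of weight `W`. -/
def face (W : ℕ × ℕ) (m : ℕ) : Finset (ℕ × ℕ) :=
  (Finset.range (m + 1) ×ˢ Finset.range (m + 1)).filter fun P => dot W P = m

theorem mem_face {W : ℕ × ℕ} (hW1 : 0 < W.1) (hW2 : 0 < W.2) {m : ℕ} {P : ℕ × ℕ} :
    P ∈ face W m ↔ dot W P = m := by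
  rw [face, Finset.mem_filter, Finset.mem_product, Finset.mem_range, Finset.mem_range,
    and_iff_right_iff_imp]
  intro h
  rw [dot] at h
  have := Nat.le_mul_of_pos_left P.1 hW1
  have := Nat.le_mul_of_pos_left P.2 hW2
  omega

theorem iteratedDeriv_pow_mul {G : ℂ → ℂ} (hG : AnalyticAt ℂ G 0) (m : ℕ) :
    iteratedDeriv m (fun t => t ^ m * G t) 0 / (m.factorial : ℂ) = G 0 := by
  obtain ⟨g, hg⟩ := exists_hasCoeffs (f := fun z => G z.1)
    (AnalyticAt.comp_of_eq (f := Prod.fst) hG analyticAt_fst rfl)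
  have h1 := hg.iteratedDeriv_curve one_pos one_pos m m {(0, 0)} (fun p => by
    rw [Finset.mem_singleton, Prod.ext_iff]; omega) (1, 0)
  have h2 := hg.coeff_fst 0
  simp at h1 h2
  rw [h1, h2]

theorem iteratedDeriv_succ_pow_mul {G : ℂ → ℂ} (hG : AnalyticAt ℂ G 0) (m : ℕ) :
    iteratedDeriv (m + 1) (fun t => t ^ m * G t) 0 / ((m + 1).factorial : ℂ) = deriv G 0 := by
  obtain ⟨g, hg⟩ := exists_hasCoeffs (f := fun z => G z.1)
    (AnalyticAt.comp_of_eq (f := Prod.fst) hG analyticAt_fst rfl)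
  have h1 := hg.iteratedDeriv_curve one_pos one_pos m (m + 1) {(1, 0), (0, 1)} (fun p => by
    rw [Finset.mem_insert, Finset.mem_singleton, Prod.ext_iff, Prod.ext_iff]; omega) (1, 0)
  have h2 := hg.coeff_fst 1
  simp [-Nat.cast_mul, Nat.factorial_succ] at h1 h2
  rw [← h2, ← h1]
  simp [Nat.factorial_succ]

/-- The image of the vertical line `t ↦ (x, t)` is a quasi-homogeneous curve of weight `W`, along
which the coefficient of `t ^ (β + 1)` is a sum over a face of the Newton diagram. -/
theorem IsStrictTransformWith.restrict_snd {ω : Form} {V W : ℕ × ℕ} {η : Form} {α β : ℕ}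
    (hη : IsStrictTransformWith ω V W η α β) {A B : ℕ × ℕ → ℂ} (hω : LogCoeffs ω A B)
    (hW1 : 0 < W.1) (hW2 : 0 < W.2) (x : ℂ) :
    x ^ α * (η (x, 0)).2 = ∑ P ∈ face W (β + 1), pair W A B P * x ^ dot V P := by
  obtain ⟨han, heq, -⟩ := hη (x, 0) (chartMap_axis hW1 hW2 x)
  have h1 := (hω.fst.linear_comb hω.snd W.1 W.2).iteratedDeriv_curve hW1 hW2 0 (β + 1)
    (face W (β + 1)) (fun P => mem_face hW1 hW2) (x ^ V.1, x ^ V.2)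
  have hx : Tendsto (fun t : ℂ => (x, t)) (𝓝 0) (𝓝 (x, 0)) :=
    (by fun_prop : Continuous fun t : ℂ => (x, t)).tendsto 0
  have hG : AnalyticAt ℂ (fun t => x ^ α * (η (x, t)).2) 0 := by
    refine analyticAt_const.mul (analyticAt_snd.comp ?_)
    exact AnalyticAt.comp (g := η) (f := fun t : ℂ => (x, t)) han
      (analyticAt_const.prod analyticAt_id)
  rw [← iteratedDeriv_pow_mul hG (β + 1)]
  have h2 : (fun t : ℂ => t ^ 0 * ((W.1 : ℂ) * ((t ^ W.1 * x ^ V.1, t ^ W.2 * x ^ V.2).1 *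
      (ω (t ^ W.1 * x ^ V.1, t ^ W.2 * x ^ V.2)).1) +
      W.2 * ((t ^ W.1 * x ^ V.1, t ^ W.2 * x ^ V.2).2 *
        (ω (t ^ W.1 * x ^ V.1, t ^ W.2 * x ^ V.2)).2))) =ᶠ[𝓝 0]
      fun t => t ^ (β + 1) * (x ^ α * (η (x, t)).2) := by
    filter_upwards [hx.eventually heq] with t ht
    have h3 := snd_mul_pullback ω V W (x, t)
    have h4 : chartMap V W (x, t) = (t ^ W.1 * x ^ V.1, t ^ W.2 * x ^ V.2) := by
      simp only [chartMap, mul_comm]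
    rw [h4, ht] at h3
    rw [pow_zero, one_mul, ← h3]
    simp only [Prod.smul_snd, smul_eq_mul]
    ring
  rw [← h2.iteratedDeriv_eq, h1]
  refine Finset.sum_congr rfl fun P _ => ?_
  simp only [pair, dot]
  ring

theorem IsStrictTransformWith.fst_mul_curve {ω : Form} {V W : ℕ × ℕ} {η : Form} {α β : ℕ}
    (hη : IsStrictTransformWith ω V W η α β) {A B : ℕ × ℕ → ℂ} (hω : LogCoeffs ω A B)
    (hW1 : 0 < W.1) (hW2 : 0 < W.2) (x : ℂ) (m : ℕ) :
    AnalyticAt ℂ (fun t => (η (x, t)).1) 0 ∧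
    iteratedDeriv m (fun t => t ^ β * (x ^ (α + 1) * (η (x, t)).1)) 0 / (m.factorial : ℂ) =
      ∑ P ∈ face W m, pair V A B P * x ^ dot V P := by
  obtain ⟨han, heq, -⟩ := hη (x, 0) (chartMap_axis hW1 hW2 x)
  have h1 := (hω.fst.linear_comb hω.snd V.1 V.2).iteratedDeriv_curve hW1 hW2 0 m
    (face W m) (fun P => mem_face hW1 hW2) (x ^ V.1, x ^ V.2)
  have hx : Tendsto (fun t : ℂ => (x, t)) (𝓝 0) (𝓝 (x, 0)) :=
    (by fun_prop : Continuous fun t : ℂ => (x, t)).tendsto 0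
  have hη1 : AnalyticAt ℂ (fun t => (η (x, t)).1) 0 := by
    refine analyticAt_fst.comp ?_
    exact AnalyticAt.comp (g := η) (f := fun t : ℂ => (x, t)) han
      (analyticAt_const.prod analyticAt_id)
  refine ⟨hη1, ?_⟩
  have h2 : (fun t : ℂ => t ^ 0 * ((V.1 : ℂ) * ((t ^ W.1 * x ^ V.1, t ^ W.2 * x ^ V.2).1 *
      (ω (t ^ W.1 * x ^ V.1, t ^ W.2 * x ^ V.2)).1) +
      V.2 * ((t ^ W.1 * x ^ V.1, t ^ W.2 * x ^ V.2).2 *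
        (ω (t ^ W.1 * x ^ V.1, t ^ W.2 * x ^ V.2)).2))) =ᶠ[𝓝 0]
      fun t => t ^ β * (x ^ (α + 1) * (η (x, t)).1) := by
    filter_upwards [hx.eventually heq] with t ht
    have h3 := fst_mul_pullback ω V W (x, t)
    have h4 : chartMap V W (x, t) = (t ^ W.1 * x ^ V.1, t ^ W.2 * x ^ V.2) := by
      simp only [chartMap, mul_comm]
    rw [h4, ht] at h3
    rw [pow_zero, one_mul, ← h3]
    simp only [Prod.smul_fst, smul_eq_mul]
    ring
  rw [← h2.iteratedDeriv_eq, h1]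
  refine Finset.sum_congr rfl fun P _ => ?_
  simp only [pair, dot]
  ring

theorem IsStrictTransformWith.restrict_fst {ω : Form} {V W : ℕ × ℕ} {η : Form} {α β : ℕ}
    (hη : IsStrictTransformWith ω V W η α β) {A B : ℕ × ℕ → ℂ} (hω : LogCoeffs ω A B)
    (hW1 : 0 < W.1) (hW2 : 0 < W.2) (x : ℂ) :
    x ^ (α + 1) * (η (x, 0)).1 = ∑ P ∈ face W β, pair V A B P * x ^ dot V P := by
  obtain ⟨h1, h2⟩ := hη.fst_mul_curve hω hW1 hW2 x β
  rw [← h2, iteratedDeriv_pow_mul (G := fun t => x ^ (α + 1) * (η (x, t)).1)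
    (analyticAt_const.mul h1)]

/-- The face is the same as for the restricted second coefficient; the quotient of the two sums,
divided by `x`, is what the Camacho–Sad index integrates. -/
theorem IsStrictTransformWith.restrict_deriv_fst {ω : Form} {V W : ℕ × ℕ} {η : Form} {α β : ℕ}
    (hη : IsStrictTransformWith ω V W η α β) {A B : ℕ × ℕ → ℂ} (hω : LogCoeffs ω A B)
    (hW1 : 0 < W.1) (hW2 : 0 < W.2) (x : ℂ) :
    x ^ (α + 1) * deriv (fun y => (η (x, y)).1) 0 =
      ∑ P ∈ face W (β + 1), pair V A B P * x ^ dot V P := by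
  obtain ⟨h1, h2⟩ := hη.fst_mul_curve hω hW1 hW2 x (β + 1)
  rw [← h2, iteratedDeriv_succ_pow_mul (G := fun t => x ^ (α + 1) * (η (x, t)).1)
    (analyticAt_const.mul h1),
    deriv_const_mul _ h1.differentiableAt]

/-! ### Newton vertices -/

/-- `P` is the vertex of the Newton diagram of the form selected by the chart `V`, `W`. -/
structure IsVertex (A B : ℕ × ℕ → ℂ) (V W P : ℕ × ℕ) : Prop where
  le_fst : ∀ Q, (A Q ≠ 0 ∨ B Q ≠ 0) → dot V P ≤ dot V Q
  le_snd : ∀ Q, (A Q ≠ 0 ∨ B Q ≠ 0) → dot W P ≤ dot W Q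
  fst_ne : 0 < V.1 → 0 < V.2 → pair V A B P ≠ 0
  snd_ne : 0 < W.1 → 0 < W.2 → pair W A B P ≠ 0

/-- Both linear coefficients sit over the same exponent, of orders `α + 1` and `β + 1`. Invariance
of the two axes forbids smaller orders elsewhere in the support. -/
theorem StrictCoeffs.exists_vertex_corner {A B : ℕ × ℕ → ℂ} {V W : ℕ × ℕ} {η : Form} {α β : ℕ}
    {e₁ e₂ : ℕ × ℕ → ℂ} (S : StrictCoeffs A B V W η α β e₁ e₂) (hVW : Unimodular V W)
    (h1 : ∀ i, e₁ (i, 0) = 0) (h2 : ∀ j, e₂ (0, j) = 0) (h3 : e₁ (0, 1) ≠ 0)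
    (h4 : e₂ (1, 0) ≠ 0) : ∃ P, IsVertex A B V W P ∧ dot V P = α + 1 := by
  obtain ⟨P, hP1, hP2⟩ := S.fst_ex _ _ h3
  have h5 := S.fst_eq P 0 1 hP1 hP2
  have h6 := S.snd_eq P 1 0 (by omega) (by omega)
  have key : ∀ Q, (A Q ≠ 0 ∨ B Q ≠ 0) → α + 1 ≤ dot V Q ∧ β + 1 ≤ dot W Q := by
    intro Q hQ
    rcases hVW.pair_ne_zero hQ with h | h
    · obtain ⟨i, j, hi, hj⟩ := S.fst_supp Q h
      have h7 := S.fst_eq Q i j hi hj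
      have : j ≠ 0 := by
        rintro rfl
        exact h (h7 ▸ h1 i)
      omega
    · obtain ⟨i, j, hi, hj⟩ := S.snd_supp Q h
      have h7 := S.snd_eq Q i j hi hj
      have : i ≠ 0 := by
        rintro rfl
        exact h (h7 ▸ h2 j)
      omega
  refine ⟨P, ⟨fun Q hQ => ?_, fun Q hQ => ?_, fun _ _ => h5 ▸ h3, fun _ _ => h6 ▸ h4⟩, by omega⟩
  · have := (key Q hQ).1; omega
  · have := (key Q hQ).2; omega

/-- The end of the chain at a regular point: the constant term of the second coefficient plays the
role of the corner, one order lower along `V`. Since `V.2 = 0`, the condition `fst_ne` is void. -/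
theorem StrictCoeffs.exists_vertex_regular {A B : ℕ × ℕ → ℂ} {V W : ℕ × ℕ} {η : Form} {α β : ℕ}
    {e₁ e₂ : ℕ × ℕ → ℂ} (S : StrictCoeffs A B V W η α β e₁ e₂) (hVW : Unimodular V W)
    (hV : V.2 = 0) (h1 : ∀ i, e₁ (i, 0) = 0) (h3 : e₂ (0, 0) ≠ 0) :
    ∃ P, IsVertex A B V W P ∧ dot V P = α := by
  obtain ⟨P, hP1, hP2⟩ := S.snd_ex _ _ h3
  have h5 := S.snd_eq P 0 0 hP1 hP2
  have key : ∀ Q, (A Q ≠ 0 ∨ B Q ≠ 0) → α ≤ dot V Q ∧ β + 1 ≤ dot W Q := by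
    intro Q hQ
    rcases hVW.pair_ne_zero hQ with h | h
    · obtain ⟨i, j, hi, hj⟩ := S.fst_supp Q h
      have h7 := S.fst_eq Q i j hi hj
      have : j ≠ 0 := by
        rintro rfl
        exact h (h7 ▸ h1 i)
      omega
    · obtain ⟨i, j, hi, hj⟩ := S.snd_supp Q h
      omega
  refine ⟨P, ⟨fun Q hQ => ?_, fun Q hQ => ?_, fun _ h => by omega, fun _ _ => h5 ▸ h3⟩, by omega⟩
  · have := (key Q hQ).1; omega
  · have := (key Q hQ).2; omega

/-- The order along an invariant divisor is read off from the Newton diagram. -/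
theorem StrictCoeffs.order_eq {A B : ℕ × ℕ → ℂ} {V W : ℕ × ℕ} {η : Form} {α β : ℕ}
    {e₁ e₂ : ℕ × ℕ → ℂ} (S : StrictCoeffs A B V W η α β e₁ e₂)
    (hiso : ∀ᶠ z in 𝓝[≠] (0 : ℂ × ℂ), η z ≠ 0) {m : ℕ}
    (hm : ∀ Q, (A Q ≠ 0 ∨ B Q ≠ 0) → m ≤ dot W Q) {P : ℕ × ℕ} (hP : dot W P = m)
    (hP0 : pair W A B P ≠ 0) : β + 1 = m := by
  obtain ⟨i, j, -, hj⟩ := S.snd_supp P hP0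
  -- If `β + 1 < m`, both coefficients of `η` would vanish along `y = 0`, against the isolated
  -- zeros.
  by_contra hne
  have h1 : ∀ i, e₁ (i, 0) = 0 := by
    intro i
    by_contra h
    obtain ⟨Q, h1, h2⟩ := S.fst_ex _ _ h
    rw [S.fst_eq Q i 0 h1 h2] at h
    have := hm Q (supp_of_pair_ne_zero h)
    omega
  have h2 : ∀ i, e₂ (i, 0) = 0 := by
    intro i
    by_contra h
    obtain ⟨Q, h1, h2⟩ := S.snd_ex _ _ h
    rw [S.snd_eq Q i 0 h1 h2] at h
    have := hm Q (supp_of_pair_ne_zero h)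
    omega
  have h3 := S.fst.eventually_eq_zero_of_fst h1
  have h4 := S.snd.eventually_eq_zero_of_fst h2
  have h5 : Tendsto (fun x : ℂ => (x, (0 : ℂ))) (𝓝[≠] 0) (𝓝[≠] 0) := by
    refine tendsto_nhdsWithin_of_tendsto_nhds_of_eventually_within _ ?_ ?_
    · exact ((by fun_prop : Continuous fun x : ℂ => (x, (0 : ℂ))).tendsto' 0 0 rfl).mono_left
        nhdsWithin_le_nhds
    · filter_upwards [self_mem_nhdsWithin] with x hx h
      exact hx (congrArg Prod.fst h)
  have h6 := ((h5.eventually hiso).and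
    ((h3.and h4).filter_mono nhdsWithin_le_nhds)).exists
  obtain ⟨x, hx1, hx2, hx3⟩ := h6
  exact hx1 (Prod.ext hx2 hx3)

/-! ### Separatrices produced by the singularities of the strict transform -/

/-- The linear part of `B ∂x - A ∂y` is triangular, with eigenvalues `∂B/∂x` and `-∂A/∂y`. Neither
vanishes, and their quotient is not a positive integer. -/
theorem IsReducedNonSaddleNode.exponents {η : Form} {P : ℂ × ℂ} (h : IsReducedNonSaddleNode η P)
    (h0 : (fderiv ℂ η P (1, 0)).1 = 0) :
    (fderiv ℂ η P (0, 1)).1 ≠ 0 ∧ (fderiv ℂ η P (1, 0)).2 ≠ 0 ∧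
      ∀ m : ℕ, 0 < m → (fderiv ℂ η P (1, 0)).2 ≠ -m * (fderiv ℂ η P (0, 1)).1 := by
  obtain ⟨μ₁, μ₂, h1, h2, hs, hp, hr⟩ := h
  rw [h0] at hp
  generalize (fderiv ℂ η P (1, 0)).2 = b at *
  generalize (fderiv ℂ η P (0, 1)).1 = a at *
  have hp' : μ₁ * μ₂ = -(b * a) := by rw [hp]; ring
  have hne : b * a ≠ 0 := fun h => by
    rw [h, neg_zero] at hp'
    exact mul_ne_zero h1 h2 hp'
  refine ⟨right_ne_zero_of_mul hne, left_ne_zero_of_mul hne, fun m hm hb => ?_⟩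
  have hm' : (m : ℂ) ≠ 0 := by exact_mod_cast hm.ne'
  -- The characteristic polynomial at `μ₁`: either `μ₁` is `b` and `μ₂` is `-a`, or the reverse,
  -- which is why `m` and `1 / m` must both be excluded.
  have hfac : (μ₁ - b) * (μ₁ + a) = 0 := by linear_combination μ₁ * hs - hp'
  rcases mul_eq_zero.mp hfac with h | h
  · apply hr m (by exact_mod_cast hm)
    push_cast
    have : μ₂ = -a := by linear_combination hs - h
    rw [this]
    linear_combination h + hb
  · apply hr (1 / m) (by positivity)
    push_cast
    have : μ₂ = b := by linear_combination hs - h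
    rw [this, hb]
    field_simp
    linear_combination h

theorem hasDerivAt_fst {δ : ℂ → ℂ × ℂ} {δ' : ℂ × ℂ} {t : ℂ} (h : HasDerivAt δ δ' t) :
    HasDerivAt (fun t => (δ t).1) δ'.1 t :=
  HasFDerivAt.comp_hasDerivAt (l := Prod.fst) (l' := ContinuousLinearMap.fst ℂ ℂ ℂ) t
    hasFDerivAt_fst h

theorem hasDerivAt_snd {δ : ℂ → ℂ × ℂ} {δ' : ℂ × ℂ} {t : ℂ} (h : HasDerivAt δ δ' t) :
    HasDerivAt (fun t => (δ t).2) δ'.2 t :=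
  HasFDerivAt.comp_hasDerivAt (l := Prod.snd) (l' := ContinuousLinearMap.snd ℂ ℂ ℂ) t
    hasFDerivAt_snd h

theorem hasDerivAt_pow_mul_pow {f g : ℂ → ℂ} {f' g' t : ℂ} (hf : HasDerivAt f f' t)
    (hg : HasDerivAt g g' t) (m n : ℕ) :
    HasDerivAt (fun t => f t ^ m * g t ^ n)
      (m * f t ^ (m - 1) * f' * g t ^ n + f t ^ m * (n * g t ^ (n - 1) * g')) t :=
  (hf.fun_pow m).mul (hg.fun_pow n)

theorem pullback_curve (ω : Form) (V W : ℕ × ℕ) {δ : ℂ → ℂ × ℂ} {t : ℂ}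
    (hδ : DifferentiableAt ℂ δ t) :
    (ω (chartMap V W (δ t))).1 * (deriv (fun t => chartMap V W (δ t)) t).1 +
      (ω (chartMap V W (δ t))).2 * (deriv (fun t => chartMap V W (δ t)) t).2 =
    (pullback ω V W (δ t)).1 * (deriv δ t).1 + (pullback ω V W (δ t)).2 * (deriv δ t).2 := by
  have h1 : HasDerivAt (fun t => (δ t).1) (deriv δ t).1 t :=
    hasDerivAt_fst hδ.hasDerivAt
  have h2 : HasDerivAt (fun t => (δ t).2) (deriv δ t).2 t :=
    hasDerivAt_snd hδ.hasDerivAt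
  have h3 : HasDerivAt (fun t => chartMap V W (δ t)) _ t :=
    (hasDerivAt_pow_mul_pow h1 h2 V.1 W.1).prodMk (hasDerivAt_pow_mul_pow h1 h2 V.2 W.2)
  rw [h3.deriv]
  simp only [pullback]
  ring

theorem analyticAt_chartMap (V W : ℕ × ℕ) (z : ℂ × ℂ) : AnalyticAt ℂ (chartMap V W) z :=
  ((analyticAt_fst.pow _).mul (analyticAt_snd.pow _)).prod
    ((analyticAt_fst.pow _).mul (analyticAt_snd.pow _))

theorem IsStrictTransformWith.isSeparatrix {ω : Form} {V W : ℕ × ℕ} {η : Form} {α β : ℕ}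
    (hη : IsStrictTransformWith ω V W η α β) {δ : ℂ → ℂ × ℂ} (hδ : AnalyticAt ℂ δ 0)
    (h0 : chartMap V W (δ 0) = 0)
    (hinv : ∀ᶠ t in 𝓝 (0 : ℂ), (η (δ t)).1 * (deriv δ t).1 + (η (δ t)).2 * (deriv δ t).2 = 0)
    (hne : ∀ᶠ t in 𝓝[≠] (0 : ℂ), chartMap V W (δ t) ≠ 0) :
    IsSeparatrix ω (fun t => chartMap V W (δ t)) := by
  refine ⟨⟨(analyticAt_chartMap V W _).comp hδ, h0, hne⟩, ?_⟩
  filter_upwards [hinv, hδ.eventually_analyticAt, hδ.continuousAt.eventually (hη _ h0).2.1]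
    with t h1 h2 h3
  rw [pullback_curve ω V W h2.differentiableAt, h3]
  simp only [Prod.smul_fst, Prod.smul_snd, smul_eq_mul]
  linear_combination ((δ t).1 ^ α * (δ t).2 ^ β) * h1

/-- A strict transform with invariant exceptional divisor and reduced singularities. -/
structure IsGood (ω : Form) (V W : ℕ × ℕ) (η : Form) (α β : ℕ) : Prop where
  strict : IsStrictTransformWith ω V W η α β
  nonDicritical : NonDicritical V W η
  reduced : ∀ P : ℂ × ℂ, chartMap V W P = 0 → η P = 0 → IsReducedNonSaddleNode η P

theorem IsGood.fst_eq_zero {ω : Form} {V W : ℕ × ℕ} {η : Form} {α β : ℕ}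
    (hg : IsGood ω V W η α β) (hW1 : 0 < W.1) (hW2 : 0 < W.2) (x : ℂ) : (η (x, 0)).1 = 0 :=
  hg.nonDicritical.2 ⟨hW1, hW2⟩ x

theorem fderiv_fst_of_axis {η : Form} {p : ℂ} (h : DifferentiableAt ℂ η (p, 0)) :
    deriv (fun x => (η (x, 0)).1) p = (fderiv ℂ η (p, 0) (1, 0)).1 ∧
    deriv (fun x => (η (x, 0)).2) p = (fderiv ℂ η (p, 0) (1, 0)).2 := by
  have h1 : HasDerivAt (fun x : ℂ => (x, (0 : ℂ))) (1, 0) p :=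
    (hasDerivAt_id p).prodMk (hasDerivAt_const _ _)
  have h2 : HasDerivAt (fun x : ℂ => η (x, 0)) (fderiv ℂ η (p, 0) (1, 0)) p :=
    HasFDerivAt.comp_hasDerivAt_of_eq p h.hasFDerivAt h1 rfl
  exact ⟨(hasDerivAt_fst h2).deriv, (hasDerivAt_snd h2).deriv⟩

theorem IsGood.exponents {ω : Form} {V W : ℕ × ℕ} {η : Form} {α β : ℕ}
    (hg : IsGood ω V W η α β) (hW1 : 0 < W.1) (hW2 : 0 < W.2) {p : ℂ} (hp : (η (p, 0)).2 = 0) :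
    (fderiv ℂ η (p, 0) (0, 1)).1 ≠ 0 ∧ (fderiv ℂ η (p, 0) (1, 0)).2 ≠ 0 ∧
      ∀ m : ℕ, 0 < m →
        (fderiv ℂ η (p, 0) (1, 0)).2 ≠ -m * (fderiv ℂ η (p, 0) (0, 1)).1 := by
  refine IsReducedNonSaddleNode.exponents (hg.reduced (p, 0) (chartMap_axis hW1 hW2 p)
    (Prod.ext (hg.fst_eq_zero hW1 hW2 p) hp)) ?_
  rw [← (fderiv_fst_of_axis (hg.strict (p, 0) (chartMap_axis hW1 hW2 p)).1.differentiableAt).1]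
  simp [hg.fst_eq_zero hW1 hW2]

/-- The premise on `chartMap` guards against a transverse curve that is itself an exceptional
component, as can happen at a corner. -/
theorem IsGood.exists_separatrix {ω : Form} {V W : ℕ × ℕ} {η : Form} {α β : ℕ}
    (hg : IsGood ω V W η α β) (hW1 : 0 < W.1) (hW2 : 0 < W.2) {p : ℂ} (hp : (η (p, 0)).2 = 0) :
    ∃ φ : ℂ → ℂ, AnalyticAt ℂ φ 0 ∧ φ 0 = p ∧
      ((∀ᶠ t in 𝓝[≠] (0 : ℂ), chartMap V W (φ t, t) ≠ 0) →
        IsSeparatrix ω fun t => chartMap V W (φ t, t)) := by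
  obtain ⟨h1, -, h3⟩ := hg.exponents hW1 hW2 hp
  obtain ⟨φ, hφ, hφ0, hinv⟩ := exists_transverse_curve
    (hg.strict (p, 0) (chartMap_axis hW1 hW2 p)).1
    (Eventually.of_forall fun x => hg.fst_eq_zero hW1 hW2 x) hp h1 h3
  refine ⟨φ, hφ, hφ0, fun hne => ?_⟩
  refine hg.strict.isSeparatrix (δ := fun t => (φ t, t)) (hφ.prod analyticAt_id) ?_ ?_ hne
  · rw [hφ0]; exact chartMap_axis hW1 hW2 p
  · filter_upwards [hinv, hφ.eventually_analyticAt] with t ht h4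
    have h5 : HasDerivAt (fun t => (φ t, t)) (deriv φ t, 1) t :=
      h4.differentiableAt.hasDerivAt.prodMk (hasDerivAt_id t)
    rw [h5.deriv]
    simpa using ht

/-- The part of the hypotheses on separatrices which concerns one side of the principal
component: apart from the axes, `x ^ l / y ^ k` has a non-zero limit along the separatrices. -/
structure SepHyp (k l ε₀ εinf : ℕ) (ω : Form) : Prop where
  analytic : AnalyticAt ℂ ω 0
  isolated : ∀ᶠ z in 𝓝[≠] (0 : ℂ × ℂ), ω z ≠ 0
  invariant_x : ε₀ = 1 → ∀ᶠ y in 𝓝 (0 : ℂ), (ω (0, y)).2 = 0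
  invariant_y : εinf = 1 → ∀ᶠ x in 𝓝 (0 : ℂ), (ω (x, 0)).1 = 0
  separatrices : ∀ γ : ℂ → ℂ × ℂ, IsSeparatrix ω γ →
    (ε₀ = 1 ∧ ∀ᶠ t in 𝓝 (0 : ℂ), (γ t).1 = 0) ∨
    (εinf = 1 ∧ ∀ᶠ t in 𝓝 (0 : ℂ), (γ t).2 = 0) ∨
    ∃ τ : ℂ, τ ≠ 0 ∧ Tendsto (fun t => (γ t).1 ^ l / (γ t).2 ^ k) (𝓝[≠] 0) (𝓝 τ)

theorem SepHyp.exists_logCoeffs {k l ε₀ εinf : ℕ} {ω : Form} (H : SepHyp k l ε₀ εinf ω) :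
    ∃ A B, LogCoeffs ω A B := by
  obtain ⟨A, hA⟩ := exists_hasCoeffs (f := fun z => z.1 * (ω z).1)
    (analyticAt_fst.mul (analyticAt_fst.comp H.analytic))
  obtain ⟨B, hB⟩ := exists_hasCoeffs (f := fun z => z.2 * (ω z).2)
    (analyticAt_snd.mul (analyticAt_snd.comp H.analytic))
  exact ⟨A, B, hA, hB⟩

/-- Away from the principal component there are no singularities outside the corners. -/
theorem SepHyp.no_root {k l ε₀ εinf : ℕ} {ω : Form} (H : SepHyp k l ε₀ εinf ω) {V W : ℕ × ℕ}
    {η : Form} {α β : ℕ} (hg : IsGood ω V W η α β) (hW1 : 0 < W.1) (hW2 : 0 < W.2)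
    (hlt : W.2 * k < W.1 * l) {p : ℂ} (hp0 : p ≠ 0) : (η (p, 0)).2 ≠ 0 := by
  intro hp
  obtain ⟨φ, hφ, hφ0, hsep⟩ := hg.exists_separatrix hW1 hW2 hp
  have hφne : ∀ᶠ t in 𝓝[≠] (0 : ℂ), φ t ≠ 0 ∧ t ≠ 0 :=
    ((hφ.continuousAt.eventually_ne (hφ0 ▸ hp0)).filter_mono nhdsWithin_le_nhds).and
      self_mem_nhdsWithin
  have hne1 : ∀ᶠ t in 𝓝[≠] (0 : ℂ), (chartMap V W (φ t, t)).1 ≠ 0 := by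
    filter_upwards [hφne] with t ht
    exact mul_ne_zero (pow_ne_zero _ ht.1) (pow_ne_zero _ ht.2)
  have hne2 : ∀ᶠ t in 𝓝[≠] (0 : ℂ), (chartMap V W (φ t, t)).2 ≠ 0 := by
    filter_upwards [hφne] with t ht
    exact mul_ne_zero (pow_ne_zero _ ht.1) (pow_ne_zero _ ht.2)
  have hs := hsep (by
    filter_upwards [hne1] with t ht h
    exact ht (by rw [h]; rfl))
  rcases H.separatrices _ hs with ⟨-, h⟩ | ⟨-, h⟩ | ⟨τ, hτ, h⟩
  · obtain ⟨t, h1, h2⟩ := ((h.filter_mono nhdsWithin_le_nhds).and hne1).exists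
    exact h2 h1
  · obtain ⟨t, h1, h2⟩ := ((h.filter_mono nhdsWithin_le_nhds).and hne2).exists
    exact h2 h1
  -- Along the curve, `x ^ l / y ^ k` is a unit times `t ^ (e + 1)`, so its limit is zero.
  · obtain ⟨e, he⟩ := Nat.exists_eq_add_of_lt hlt
    have h1 : ContinuousAt (fun t => (φ t ^ V.1) ^ l / (φ t ^ V.2) ^ k * t ^ (e + 1)) 0 := by
      refine ContinuousAt.mul (ContinuousAt.div ((hφ.continuousAt.pow _).pow _)
        ((hφ.continuousAt.pow _).pow _) ?_) (by fun_prop)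
      rw [hφ0]
      exact pow_ne_zero _ (pow_ne_zero _ hp0)
    have h2 : Tendsto (fun t => (φ t ^ V.1) ^ l / (φ t ^ V.2) ^ k * t ^ (e + 1)) (𝓝[≠] 0)
        (𝓝 0) := by
      have := h1.tendsto.mono_left (nhdsWithin_le_nhds (s := {0}ᶜ))
      simpa using this
    have h3 := h.congr' (f₂ := fun t => (φ t ^ V.1) ^ l / (φ t ^ V.2) ^ k * t ^ (e + 1)) (by
      filter_upwards [hφne] with t ht
      simp only [chartMap]
      have a1 : (φ t ^ V.2) ^ k ≠ 0 := pow_ne_zero _ (pow_ne_zero _ ht.1)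
      have a2 : (t ^ W.2) ^ k ≠ 0 := pow_ne_zero _ (pow_ne_zero _ ht.2)
      rw [mul_pow, mul_pow, ← pow_mul t W.1 l, he, pow_add, pow_add, pow_mul]
      field_simp
      ring)
    exact hτ (tendsto_nhds_unique h3 h2)

/-- An axis which is not a separatrix carries no singularity of the strict transform. -/
theorem SepHyp.no_root_end {k l εinf : ℕ} {ω : Form} (H : SepHyp k l 0 εinf ω) (hl : 0 < l)
    {q : ℕ} (hq : 0 < q) {η : Form} {α β : ℕ} (hg : IsGood ω (1, 0) (q, 1) η α β)
    (hle : k ≤ q * l) : (η (0, 0)).2 ≠ 0 := by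
  intro hp
  obtain ⟨φ, hφ, hφ0, hsep⟩ := hg.exists_separatrix hq one_pos hp
  have hc : ∀ t, chartMap (1, 0) (q, 1) (φ t, t) = (φ t * t ^ q, t) := fun t => by
    simp [chartMap]
  simp only [hc] at hsep
  have hs := hsep (by
    filter_upwards [self_mem_nhdsWithin] with t ht h
    exact ht (congrArg Prod.snd h))
  rcases H.separatrices _ hs with ⟨h, -⟩ | ⟨-, h⟩ | ⟨τ, hτ, h⟩
  · omega
  · obtain ⟨t, h1, h2⟩ := ((h.filter_mono nhdsWithin_le_nhds).and
      (self_mem_nhdsWithin : {0}ᶜ ∈ 𝓝[≠] (0 : ℂ))).exists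
    exact h2 h1
  -- Here `e = 0` is possible, when the axis is adjacent to the principal component; the limit is
  -- still zero because `φ 0 = 0`.
  · obtain ⟨e, he⟩ := Nat.exists_eq_add_of_le hle
    have h1 : ContinuousAt (fun t => φ t ^ l * t ^ e) 0 :=
      (hφ.continuousAt.pow _).mul (by fun_prop)
    have h2 : Tendsto (fun t => φ t ^ l * t ^ e) (𝓝[≠] 0) (𝓝 0) := by
      have := h1.tendsto.mono_left (nhdsWithin_le_nhds (s := {0}ᶜ))
      simpa [hφ0, hl.ne'] using this
    have h3 := h.congr' (f₂ := fun t => φ t ^ l * t ^ e) (by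
      filter_upwards [self_mem_nhdsWithin] with t ht
      have a2 : t ^ k ≠ 0 := pow_ne_zero _ ht
      rw [mul_pow, ← pow_mul, he, pow_add]
      field_simp)
    exact hτ (tendsto_nhds_unique h3 h2)

theorem SepHyp.not_zero_on_axis {k l ε₀ εinf : ℕ} {ω : Form} (H : SepHyp k l ε₀ εinf ω) :
    ¬ ∀ᶠ y in 𝓝[≠] (0 : ℂ), ω (0, y) = 0 := by
  intro h
  have h5 : Tendsto (fun x : ℂ => ((0 : ℂ), x)) (𝓝[≠] 0) (𝓝[≠] 0) := by
    refine tendsto_nhdsWithin_of_tendsto_nhds_of_eventually_within _ ?_ ?_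
    · exact ((by fun_prop : Continuous fun x : ℂ => ((0 : ℂ), x)).tendsto' 0 0 rfl).mono_left
        nhdsWithin_le_nhds
    · filter_upwards [self_mem_nhdsWithin] with x hx h
      exact hx (congrArg Prod.snd h)
  obtain ⟨y, h1, h2⟩ := ((h5.eventually H.isolated).and h).exists
  exact h1 h2

/-! ### The end of the chain of divisors -/

/-- The factor `0 ^ α` is `1` for `α = 0` and `0` otherwise; the second case would make `ω` vanish
along the axis. -/
theorem IsStrictTransformWith.pullback_axis {ω : Form} {q : ℕ} {η : Form} {α β : ℕ}
    (hη : IsStrictTransformWith ω (1, 0) (q, 1) η α β) :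
    ∀ᶠ y in 𝓝 (0 : ℂ), (ω (0, y)).1 * y ^ q = 0 ^ α * y ^ β * (η (0, y)).1 ∧
      (0 < q → (ω (0, y)).2 = 0 ^ α * y ^ β * (η (0, y)).2) := by
  have h1 : Tendsto (fun y : ℂ => ((0 : ℂ), y)) (𝓝 0) (𝓝 0) :=
    (by fun_prop : Continuous fun x : ℂ => ((0 : ℂ), x)).tendsto' 0 0 rfl
  filter_upwards [h1.eventually (hη 0 (by simp [chartMap])).2.1] with y hy
  rcases Nat.eq_zero_or_pos q with rfl | hq
  · have e1 := congrArg Prod.fst hy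
    simp [pullback, chartMap] at e1 ⊢
    exact e1
  · have e1 := congrArg Prod.fst hy
    have e2 := congrArg Prod.snd hy
    simp [pullback, chartMap] at e1 e2
    exact ⟨e1, fun _ => e2⟩

theorem IsGood.exists_vertex_corner {ω : Form} {V W : ℕ × ℕ} {η : Form} {α β : ℕ}
    (hg : IsGood ω V W η α β) (hVW : Unimodular V W) {A B : ℕ × ℕ → ℂ} (hω : LogCoeffs ω A B)
    (hW1 : 0 < W.1) (hW2 : 0 < W.2) (hV : ∀ᶠ y in 𝓝 (0 : ℂ), (η (0, y)).2 = 0) :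
    ∃ P, IsVertex A B V W P ∧ dot V P = α + 1 := by
  obtain ⟨e₁, e₂, S⟩ := hg.strict.exists_strictCoeffs hVW hω
  have h0 : (η (0, 0)).2 = 0 := hV.self_of_nhds
  obtain ⟨h1, h2, -⟩ := hg.exponents hW1 hW2 h0
  have hd : DifferentiableAt ℂ η (0 : ℂ × ℂ) :=
    (hg.strict 0 (chartMap_zero hVW)).1.differentiableAt
  have f1 : fderiv ℂ (fun z => (η z).1) 0 (0, 1) = (fderiv ℂ η (0, 0) (0, 1)).1 := by
    have : HasFDerivAt (fun z => (η z).1) ((ContinuousLinearMap.fst ℂ ℂ ℂ).comp (fderiv ℂ η 0))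
      0 := hasFDerivAt_fst.comp _ hd.hasFDerivAt
    rw [this.fderiv]
    rfl
  have f2 : fderiv ℂ (fun z => (η z).2) 0 (1, 0) = (fderiv ℂ η (0, 0) (1, 0)).2 := by
    have : HasFDerivAt (fun z => (η z).2) ((ContinuousLinearMap.snd ℂ ℂ ℂ).comp (fderiv ℂ η 0))
      0 := hasFDerivAt_snd.comp _ hd.hasFDerivAt
    rw [this.fderiv]
    rfl
  refine S.exists_vertex_corner hVW
    (S.fst.coeff_fst_eq_zero (Eventually.of_forall (hg.fst_eq_zero hW1 hW2)))
    (S.snd.coeff_snd_eq_zero hV) ?_ ?_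
  · rw [← S.fst.fderiv_snd, f1]; exact h1
  · rw [← S.snd.fderiv_fst, f2]; exact h2

/-- The zeros of `ω` being isolated, `α = 0`. If `ε₀ = 0`, there is no singularity at the origin and
the vertex has order `0` along `{x = 0}`. If `ε₀ = 1`, that axis is invariant, so the origin behaves
like a corner and the order is `α + 1 = 1`. -/
theorem SepHyp.exists_vertex_end {k l ε₀ εinf : ℕ} {ω : Form} (H : SepHyp k l ε₀ εinf ω)
    (hl : 0 < l) (hε₀ : ε₀ ≤ 1) {q : ℕ} (hq : 0 < q) {η : Form} {α β : ℕ}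
    (hg : IsGood ω (1, 0) (q, 1) η α β) (hle : k ≤ q * l) {A B : ℕ × ℕ → ℂ}
    (hω : LogCoeffs ω A B) : ∃ P, IsVertex A B (1, 0) (q, 1) P ∧ P.1 = ε₀ := by
  have hVW : Unimodular (1, 0) (q, 1) := by simp [Unimodular]
  have hax := hg.strict.pullback_axis
  have h0 : (η (0, 0)).1 = 0 := hg.fst_eq_zero hq one_pos 0
  have hdot : ∀ P, dot (1, 0) P = P.1 := fun P => by simp [dot]
  have hα : α = 0 := by
    by_contra hα
    refine H.not_zero_on_axis ?_
    filter_upwards [hax.filter_mono nhdsWithin_le_nhds, self_mem_nhdsWithin] with y hy hy0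
    rw [zero_pow hα, zero_mul, zero_mul, zero_mul] at hy
    exact Prod.ext ((mul_eq_zero.mp hy.1).resolve_right (pow_ne_zero _ hy0)) (hy.2 hq)
  subst hα
  rcases Nat.le_one_iff_eq_zero_or_eq_one.mp hε₀ with rfl | rfl
  · obtain ⟨e₁, e₂, S⟩ := hg.strict.exists_strictCoeffs hVW hω
    have h1 := H.no_root_end hl hq hg hle
    obtain ⟨P, hP, hP1⟩ := S.exists_vertex_regular hVW rfl
      (S.fst.coeff_fst_eq_zero (Eventually.of_forall (hg.fst_eq_zero hq one_pos)))
      (by rw [S.snd.coeff_fst 0]; simpa using h1)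
    exact ⟨P, hP, by rw [← hdot, hP1]⟩
  · have h1 : ∀ᶠ y in 𝓝[≠] (0 : ℂ), (η (0, y)).2 = 0 := by
      filter_upwards [hax.filter_mono nhdsWithin_le_nhds, self_mem_nhdsWithin,
        (H.invariant_x rfl).filter_mono nhdsWithin_le_nhds] with y hy hy0 hi
      have := hy.2 hq
      rw [hi, pow_zero, one_mul] at this
      exact (mul_eq_zero.mp this.symm).resolve_left (pow_ne_zero _ hy0)
    have han : AnalyticAt ℂ (fun y => (η (0, y)).2) 0 :=
      analyticAt_snd.comp (AnalyticAt.comp_of_eq (g := η) (f := fun y : ℂ => ((0 : ℂ), y))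
        (hg.strict 0 (chartMap_zero hVW)).1 (analyticAt_const.prod analyticAt_id) rfl)
    have h2 : ∀ᶠ y in 𝓝 (0 : ℂ), (η (0, y)).2 = 0 :=
      han.frequently_zero_iff_eventually_zero.mp h1.frequently
    obtain ⟨P, hP, hP1⟩ := hg.exists_vertex_corner hVW hω hq one_pos h2
    exact ⟨P, hP, by rw [← hdot, hP1]⟩

/-! ### Vertices of consecutive charts -/

theorem exists_eq_monomial {F : Polynomial ℂ} (hF : F ≠ 0) (h : ∀ p, p ≠ 0 → F.eval p ≠ 0) :
    ∃ a n, F = Polynomial.C a * Polynomial.X ^ n := by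
  obtain ⟨G, hG, hG0⟩ := Polynomial.exists_eq_pow_rootMultiplicity_mul_and_not_dvd F hF 0
  rw [Polynomial.C_0, sub_zero] at hG hG0
  have hd : G.degree = 0 := by
    by_contra hd
    obtain ⟨p, hp⟩ := IsAlgClosed.exists_root G hd
    by_cases hp0 : p = 0
    · subst hp0
      exact hG0 (by rwa [Polynomial.X_dvd_iff, Polynomial.coeff_zero_eq_eval_zero])
    · refine h p hp0 ?_
      rw [hG, Polynomial.eval_mul, hp.eq_zero, mul_zero]
  rw [Polynomial.eq_C_of_degree_eq_zero hd] at hG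
  exact ⟨_, _, hG.trans (mul_comm _ _)⟩

/-- The polynomial `Σ c P X ^ e P`. -/
noncomputable def sumPoly (T : Finset (ℕ × ℕ)) (c : ℕ × ℕ → ℂ) (e : ℕ × ℕ → ℕ) : Polynomial ℂ :=
  ∑ P ∈ T, Polynomial.C (c P) * Polynomial.X ^ e P

theorem eval_sumPoly (T : Finset (ℕ × ℕ)) (c : ℕ × ℕ → ℂ) (e : ℕ × ℕ → ℕ) (x : ℂ) :
    (sumPoly T c e).eval x = ∑ P ∈ T, c P * x ^ e P := by
  simp [sumPoly, Polynomial.eval_finsetSum]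

theorem coeff_sumPoly {T : Finset (ℕ × ℕ)} {c : ℕ × ℕ → ℂ} {e : ℕ × ℕ → ℕ}
    (he : ∀ P ∈ T, ∀ Q ∈ T, e P = e Q → P = Q) {P : ℕ × ℕ} (hP : P ∈ T) :
    (sumPoly T c e).coeff (e P) = c P := by
  simp only [sumPoly, Polynomial.finsetSum_coeff, Polynomial.coeff_C_mul_X_pow]
  rw [Finset.sum_eq_single P]
  · simp
  · intro Q hQ hne
    rw [if_neg]
    intro h
    exact hne (he Q hQ P hP h.symm)
  · exact fun h => absurd hP h

/-- Over `ℂ`, only a monomial has no non-zero root, and distinct exponents prevent the two terms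
from cancelling. -/
theorem exists_root_of_two_terms {T : Finset (ℕ × ℕ)} {c : ℕ × ℕ → ℂ} {e : ℕ × ℕ → ℕ}
    (he : ∀ P ∈ T, ∀ Q ∈ T, e P = e Q → P = Q) {P Q : ℕ × ℕ} (hP : P ∈ T) (hQ : Q ∈ T)
    (hPQ : P ≠ Q) (hcP : c P ≠ 0) (hcQ : c Q ≠ 0) :
    ∃ p : ℂ, p ≠ 0 ∧ ∑ R ∈ T, c R * p ^ e R = 0 := by
  by_contra! h
  have hP' := coeff_sumPoly (c := c) he hP
  have hQ' := coeff_sumPoly (c := c) he hQ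
  obtain ⟨a, n, hF⟩ := exists_eq_monomial (F := sumPoly T c e)
    (fun h0 => hcP (by rw [← hP', h0, Polynomial.coeff_zero]))
    (fun p hp => by rw [eval_sumPoly]; exact h p hp)
  rw [hF, Polynomial.coeff_C_mul_X_pow] at hP' hQ'
  split_ifs at hP' hQ' with h1 h2
  · exact hPQ (he P hP Q hQ (h1.trans h2.symm))
  all_goals first | exact hcQ hQ'.symm | exact hcP hP'.symm

/-- Both vertices minimise the order along `W`, so both contribute to the restriction to that
divisor. Two different monomials would create a singularity off the corners, which `no_root`
excludes. -/
theorem SepHyp.vertex_eq {k l ε₀ εinf : ℕ} {ω : Form} (H : SepHyp k l ε₀ εinf ω) {V W U : ℕ × ℕ}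
    {η : Form} {α β : ℕ} (hg : IsGood ω V W η α β) (hVW : Unimodular V W) (hW1 : 0 < W.1)
    (hW2 : 0 < W.2) (hlt : W.2 * k < W.1 * l) {A B : ℕ × ℕ → ℂ} (hω : LogCoeffs ω A B)
    {P Q : ℕ × ℕ} (hP : IsVertex A B V W P) (hQ : IsVertex A B W U Q) : P = Q := by
  by_contra hPQ
  obtain ⟨e₁, e₂, S⟩ := hg.strict.exists_strictCoeffs hVW hω
  have hcP := hP.snd_ne hW1 hW2
  have hcQ := hQ.fst_ne hW1 hW2
  have hPQ' : dot W Q = dot W P :=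
    le_antisymm (hQ.le_fst P (supp_of_pair_ne_zero hcP)) (hP.le_snd Q (supp_of_pair_ne_zero hcQ))
  have hβ := S.order_eq (hg.strict 0 (chartMap_zero hVW)).2.2 hP.le_snd rfl hcP
  have hface : ∀ R, R ∈ face W (β + 1) ↔ dot W R = dot W P := fun R => by
    rw [mem_face hW1 hW2, hβ]
  obtain ⟨p, hp0, hp⟩ := exists_root_of_two_terms (T := face W (β + 1)) (c := pair W A B)
    (e := dot V) (fun R hR R' hR' h => hVW.eq_of_dot h
      (((hface R).mp hR).trans ((hface R').mp hR').symm))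
    ((hface P).mpr rfl) ((hface Q).mpr hPQ') hPQ hcP hcQ
  rw [← hg.strict.restrict_snd hω hW1 hW2] at hp
  exact H.no_root hg hW1 hW2 hlt hp0
    ((mul_eq_zero.mp hp).resolve_left (pow_ne_zero _ hp0))

/-- There is a single Newton vertex on each side of the principal component. -/
theorem SepHyp.exists_vertex_side {k l ε₀ εinf : ℕ} {ω : Form} (H : SepHyp k l ε₀ εinf ω)
    (hl : 0 < l) (hε₀ : ε₀ ≤ 1) {A B : ℕ × ℕ → ℂ} (hω : LogCoeffs ω A B) :
    ∀ (R : List (ℕ × ℕ)) (W V : ℕ × ℕ),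
      List.IsChain (fun W V => Unimodular V W ∧ ∃ η α β, IsGood ω V W η α β) (W :: V :: R) →
      0 < W.1 → 0 < W.2 → (∀ E ∈ V :: R, E = (1, 0) ∨ E = (0, 1) ∨ (0 < E.1 ∧ 0 < E.2)) →
      (V :: R).getLast? = some (1, 0) → W.2 * k ≤ W.1 * l →
      ∃ P, IsVertex A B V W P ∧ P.1 = ε₀ := by
  intro R
  induction R with
  | nil =>
    intro W V hc hW1 hW2 _ hlast hle
    obtain rfl : V = (1, 0) := by simpa using hlast
    obtain ⟨⟨hVW, η, α, β, hg⟩, -⟩ := List.isChain_cons_cons.mp hc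
    obtain ⟨q, w⟩ := W
    obtain rfl : w = 1 := by simpa [Unimodular] using hVW
    exact H.exists_vertex_end hl hε₀ hW1 hg (by simpa using hle) hω
  | cons V' R ih =>
    intro W V hc hW1 hW2 hE hlast hle
    obtain ⟨⟨hVW, η, α, β, hg⟩, hc'⟩ := List.isChain_cons_cons.mp hc
    obtain ⟨⟨hVV, -⟩, -⟩ := List.isChain_cons_cons.mp hc'
    have hV : 0 < V.1 ∧ 0 < V.2 := ⟨hVW.fst_pos, hVV.snd_pos⟩
    -- By unimodularity the slope strictly increases along the chain, so equality holds at most at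
    -- the starting divisor and `no_root` applies to all later ones.
    have hlt : V.2 * k < V.1 * l := by
      simp only [Unimodular] at hVW
      have h1 : W.2 * (V.2 * k) < W.2 * (V.1 * l) := by
        calc W.2 * (V.2 * k) = V.2 * (W.2 * k) := by ring
          _ ≤ V.2 * (W.1 * l) := Nat.mul_le_mul_left _ hle
          _ < (V.2 * W.1 + 1) * l := by nlinarith
          _ = W.2 * (V.1 * l) := by rw [← hVW]; ring
      exact lt_of_mul_lt_mul_left h1 (Nat.zero_le _)
    obtain ⟨Q, hQ, hQ1⟩ := ih V V' hc' hV.1 hV.2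
      (fun E h => hE E (List.mem_cons_of_mem _ h)) (by simpa using hlast) hlt.le
    obtain ⟨P, hP, -⟩ := hg.exists_vertex_corner hVW hω hW1 hW2
      (Eventually.of_forall (hg.nonDicritical.1 hV))
    obtain ⟨⟨_, η', α', β', hg'⟩, -⟩ := List.isChain_cons_cons.mp hc'
    have : Q = P := H.vertex_eq hg' hVV hV.1 hV.2 hlt hω hQ hP
    exact ⟨P, hP, this ▸ hQ1⟩

/-! ### Exchange of the coordinates -/

/-- The pull-back of a form by the exchange of the coordinates. -/
def swapForm (ω : Form) : Form := fun z => (ω z.swap).swap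

theorem analyticAt_swap (z : ℂ × ℂ) : AnalyticAt ℂ (Prod.swap : ℂ × ℂ → ℂ × ℂ) z :=
  analyticAt_snd.prod analyticAt_fst

theorem analyticAt_swapForm {ω : Form} {P : ℂ × ℂ} (h : AnalyticAt ℂ ω P.swap) :
    AnalyticAt ℂ (swapForm ω) P :=
  (analyticAt_swap _).comp (AnalyticAt.comp (g := ω) (f := Prod.swap) h (analyticAt_swap P))

theorem tendsto_swap (P : ℂ × ℂ) : Tendsto (Prod.swap : ℂ × ℂ → ℂ × ℂ) (𝓝 P) (𝓝 P.swap) :=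
  continuous_swap.tendsto P

theorem tendsto_swap_punctured (P : ℂ × ℂ) :
    Tendsto (Prod.swap : ℂ × ℂ → ℂ × ℂ) (𝓝[≠] P) (𝓝[≠] P.swap) := by
  refine tendsto_nhdsWithin_of_tendsto_nhds_of_eventually_within _
    ((tendsto_swap P).mono_left nhdsWithin_le_nhds) ?_
  filter_upwards [self_mem_nhdsWithin] with z hz h
  exact hz (Prod.swap_injective h)

theorem swap_eq_zero {z : ℂ × ℂ} (h : z.swap = 0) : z = 0 := by
  rw [← Prod.swap_swap z, h]; rfl

theorem chartMap_swap (V W : ℕ × ℕ) (z : ℂ × ℂ) :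
    chartMap W.swap V.swap z = (chartMap V W z.swap).swap := by
  simp only [chartMap, Prod.fst_swap, Prod.snd_swap, Prod.swap_prod_mk, mul_comm]

theorem pullback_swapForm (ω : Form) (V W : ℕ × ℕ) (z : ℂ × ℂ) :
    pullback (swapForm ω) W.swap V.swap z = swapForm (pullback ω V W) z := by
  simp only [pullback, swapForm, chartMap_swap, Prod.swap_swap, Prod.fst_swap, Prod.snd_swap,
    Prod.swap_prod_mk]
  ext <;> simp only <;> ring

theorem IsStrictTransformWith.dual {ω : Form} {V W : ℕ × ℕ} {η : Form} {α β : ℕ}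
    (h : IsStrictTransformWith ω V W η α β) :
    IsStrictTransformWith (swapForm ω) W.swap V.swap (swapForm η) β α := by
  intro P hP
  rw [chartMap_swap] at hP
  obtain ⟨h1, h2, h3⟩ := h P.swap (swap_eq_zero hP)
  refine ⟨analyticAt_swapForm h1, ?_, ?_⟩
  · filter_upwards [(tendsto_swap P).eventually h2] with z hz
    rw [pullback_swapForm, swapForm, swapForm, hz]
    ext <;> simp [mul_comm]
  · filter_upwards [(tendsto_swap_punctured P).eventually h3] with z hz h
    exact hz (swap_eq_zero h)

theorem fderiv_swapForm {η : Form} {P : ℂ × ℂ} (h : DifferentiableAt ℂ η P.swap) (v : ℂ × ℂ) :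
    fderiv ℂ (swapForm η) P v = (fderiv ℂ η P.swap v.swap).swap := by
  let S : ℂ × ℂ →L[ℂ] ℂ × ℂ :=
    (ContinuousLinearMap.snd ℂ ℂ ℂ).prod (ContinuousLinearMap.fst ℂ ℂ ℂ)
  have h1 : HasFDerivAt S S P := S.hasFDerivAt
  have h2 : HasFDerivAt (fun z => η (S z)) ((fderiv ℂ η P.swap).comp S) P :=
    HasFDerivAt.comp (g := η) P h.hasFDerivAt h1
  have h3 : HasFDerivAt (fun z => S (η (S z))) (S.comp ((fderiv ℂ η P.swap).comp S)) P :=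
    HasFDerivAt.comp (g := S) P S.hasFDerivAt h2
  have h4 : swapForm η = fun z => S (η (S z)) := rfl
  rw [h4, h3.fderiv]
  rfl

theorem IsReducedNonSaddleNode.dual {η : Form} {P : ℂ × ℂ} (hd : DifferentiableAt ℂ η P.swap)
    (h : IsReducedNonSaddleNode η P.swap) : IsReducedNonSaddleNode (swapForm η) P := by
  obtain ⟨μ₁, μ₂, h1, h2, hs, hp, hr⟩ := h
  -- Exchanging the coordinates turns the field `B ∂x - A ∂y` into its opposite, so both eigenvalues
  -- change sign and their quotient is kept.
  refine ⟨-μ₁, -μ₂, neg_ne_zero.mpr h1, neg_ne_zero.mpr h2, ?_, ?_, fun r hr0 h => ?_⟩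
  · rw [fderiv_swapForm hd, fderiv_swapForm hd]
    simp only [Prod.swap_prod_mk, Prod.fst_swap, Prod.snd_swap]
    linear_combination -hs
  · rw [fderiv_swapForm hd, fderiv_swapForm hd]
    simp only [Prod.swap_prod_mk, Prod.fst_swap, Prod.snd_swap]
    linear_combination hp
  · exact hr r hr0 (by linear_combination -h)

theorem IsGood.dual {ω : Form} {V W : ℕ × ℕ} {η : Form} {α β : ℕ} (h : IsGood ω V W η α β) :
    IsGood (swapForm ω) W.swap V.swap (swapForm η) β α := by
  refine ⟨h.strict.dual, ⟨fun hW y => ?_, fun hV x => ?_⟩, fun P hP hP0 => ?_⟩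
  · simpa [swapForm] using h.nonDicritical.2 ⟨hW.2, hW.1⟩ y
  · simpa [swapForm] using h.nonDicritical.1 ⟨hV.2, hV.1⟩ x
  · rw [chartMap_swap] at hP
    have hP' := swap_eq_zero hP
    exact (h.reduced P.swap hP' (swap_eq_zero hP0)).dual (h.strict _ hP').1.differentiableAt

theorem IsSeparatrix.dual {ω : Form} {γ : ℂ → ℂ × ℂ} (h : IsSeparatrix (swapForm ω) γ) :
    IsSeparatrix ω (fun t => (γ t).swap) := by
  obtain ⟨⟨h1, h2, h3⟩, h4⟩ := h
  refine ⟨⟨(analyticAt_swap _).comp h1, (congrArg Prod.swap h2).trans rfl, ?_⟩, ?_⟩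
  · filter_upwards [h3] with t ht h
    exact ht (swap_eq_zero h)
  · filter_upwards [h4, h1.eventually_analyticAt] with t ht han
    have h5 : HasDerivAt (fun t => (γ t).swap) ((deriv γ t).2, (deriv γ t).1) t :=
      (hasDerivAt_snd han.differentiableAt.hasDerivAt).prodMk
        (hasDerivAt_fst han.differentiableAt.hasDerivAt)
    rw [h5.deriv]
    simp only [swapForm, Prod.fst_swap, Prod.snd_swap] at ht
    linear_combination ht

/-- The limit `τ` of `x ^ l / y ^ k` becomes `τ⁻¹`; asking only that it be non-zero makes the
hypothesis symmetric, so that one side of the principal component suffices. -/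
theorem SepHyp.dual {k l ε₀ εinf : ℕ} {ω : Form} (H : SepHyp k l ε₀ εinf ω) :
    SepHyp l k εinf ε₀ (swapForm ω) := by
  refine ⟨analyticAt_swapForm H.analytic, ?_, H.invariant_y, H.invariant_x, fun γ hγ => ?_⟩
  · filter_upwards [(tendsto_swap_punctured 0).eventually H.isolated] with z hz h
    exact hz (swap_eq_zero h)
  · rcases H.separatrices _ hγ.dual with h | h | ⟨τ, hτ, h⟩
    · exact Or.inr (Or.inl h)
    · exact Or.inl h
    · refine Or.inr (Or.inr ⟨τ⁻¹, inv_ne_zero hτ, ?_⟩)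
      simpa using h.inv₀ hτ

theorem HasCoeffs.swap {a : ℕ × ℕ → ℂ} {f : ℂ × ℂ → ℂ} (h : HasCoeffs a f) :
    HasCoeffs (fun p => a p.swap) (fun z => f z.swap) := by
  obtain ⟨r, hr, hs, hf⟩ := h
  refine ⟨r, hr, ?_, fun z h1 h2 => ?_⟩
  · refine ((Equiv.prodComm ℕ ℕ).summable_iff.mpr hs).congr fun p => ?_
    simp [add_comm]
  · refine hasSum_of_eq (fun p => ?_) ((Equiv.prodComm ℕ ℕ).hasSum_iff.mpr (hf z.swap h2 h1))
    simp [mul_comm]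

theorem LogCoeffs.dual {ω : Form} {A B : ℕ × ℕ → ℂ} (h : LogCoeffs ω A B) :
    LogCoeffs (swapForm ω) (fun p => B p.swap) (fun p => A p.swap) :=
  ⟨h.snd.swap, h.fst.swap⟩

theorem IsVertex.dual {A B : ℕ × ℕ → ℂ} {V W P : ℕ × ℕ}
    (h : IsVertex (fun p => B p.swap) (fun p => A p.swap) W.swap V.swap P) :
    IsVertex A B V W P.swap := by
  have e1 : ∀ U Q : ℕ × ℕ, dot U.swap Q = dot U Q.swap := fun U Q => by simp [dot, add_comm]
  have e2 : ∀ U Q : ℕ × ℕ, pair U.swap (fun p => B p.swap) (fun p => A p.swap) Q =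
      pair U A B Q.swap := fun U Q => by simp [pair, add_comm]
  refine ⟨fun Q hQ => ?_, fun Q hQ => ?_, fun h1 h2 => ?_, fun h1 h2 => ?_⟩
  · have := h.le_snd Q.swap (by simpa using hQ.symm)
    rwa [e1, e1, Prod.swap_swap] at this
  · have := h.le_fst Q.swap (by simpa using hQ.symm)
    rwa [e1, e1, Prod.swap_swap] at this
  · have := h.snd_ne h2 h1
    rwa [e2] at this
  · have := h.fst_ne h2 h1
    rwa [e2] at this

/-! ### The chain of divisors -/

/-- What is used of the chain of divisors. -/
structure DivisorSpec (k l u v : ℕ) (D : List (ℕ × ℕ)) : Prop where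
  chain : D.IsChain fun W V => Unimodular V W
  mem : ∀ E ∈ D, E = (1, 0) ∨ E = (0, 1) ∨ (0 < E.1 ∧ 0 < E.2)
  head : D.head? = some (0, 1)
  last : D.getLast? = some (1, 0)
  principal : ∃ L R, D = L ++ (v, u) :: (k, l) :: (k - v, l - u) :: R

/-- The blow-up `(x, y) = (X Y, Y)` acts on weights by `(p, q) ↦ (p + q, q)`, of determinant one. It
sends the first weight `(0, 1)` to `(1, 1)`, which is adjacent to the new strict transform `(0, 1)`
placed in front. -/
theorem DivisorSpec.of_lt {k l u v : ℕ} {D : List (ℕ × ℕ)} (hlk : l < k) (hu : u ≤ l)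
    (hv : v ≤ k) (hvu : u ≤ v) (h1 : v - u ≤ k - l) (h : DivisorSpec (k - l) l u (v - u) D) :
    DivisorSpec k l u v ((0, 1) :: D.map fun w => (w.1 + w.2, w.2)) := by
  refine ⟨?_, ?_, rfl, ?_, ?_⟩
  · have h2 : (D.map fun w => (w.1 + w.2, w.2)).IsChain fun W V => Unimodular V W := by
      rw [List.isChain_map]
      refine h.chain.imp fun W V hVW => ?_
      simp only [Unimodular] at *
      linarith
    have h3 := h.head
    cases D with
    | nil => simp at h3
    | cons E D =>
      obtain rfl : E = (0, 1) := by simpa using h3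
      rw [List.map_cons] at h2 ⊢
      exact List.isChain_cons_cons.mpr ⟨by simp [Unimodular], h2⟩
  · intro E hE
    rcases List.mem_cons.mp hE with rfl | hE
    · simp
    · obtain ⟨E', hE', rfl⟩ := List.mem_map.mp hE
      rcases h.mem E' hE' with rfl | rfl | h2
      · simp
      · simp
      · exact Or.inr (Or.inr ⟨by simp only; omega, h2.2⟩)
  · have h3 := h.last
    rw [List.getLast?_cons, List.getLast?_map, h3]
    rfl
  · obtain ⟨L, R, hD⟩ := h.principal
    refine ⟨(0, 1) :: L.map fun w => (w.1 + w.2, w.2), R.map fun w => (w.1 + w.2, w.2), ?_⟩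
    rw [hD]
    simp only [List.map_append, List.map_cons, List.cons_append, List.cons.injEq, true_and,
      List.append_cancel_left_eq, Prod.mk.injEq, and_true]
    omega

theorem DivisorSpec.of_gt {k l u v : ℕ} {D : List (ℕ × ℕ)} (hlk : k < l) (hu : u ≤ l)
    (hv : v ≤ k) (hvu : v ≤ u) (h1 : u - v ≤ l - k) (h : DivisorSpec k (l - k) (u - v) v D) :
    DivisorSpec k l u v ((D.map fun w => (w.1, w.1 + w.2)) ++ [(1, 0)]) := by
  refine ⟨?_, ?_, ?_, ?_, ?_⟩
  · have h2 : (D.map fun w => (w.1, w.1 + w.2)).IsChain fun W V => Unimodular V W := by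
      rw [List.isChain_map]
      refine h.chain.imp fun W V hVW => ?_
      simp only [Unimodular] at *
      linarith
    rw [List.isChain_append]
    refine ⟨h2, by simp, ?_⟩
    rw [List.getLast?_map, h.last]
    simp [Unimodular]
  · intro E hE
    rcases List.mem_append.mp hE with hE | hE
    · obtain ⟨E', hE', rfl⟩ := List.mem_map.mp hE
      rcases h.mem E' hE' with rfl | rfl | h2
      · simp
      · simp
      · exact Or.inr (Or.inr ⟨h2.1, by simp only; omega⟩)
    · exact Or.inl (by simpa using hE)
  · rw [List.head?_append, List.head?_map, h.head]
    rfl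
  · simp
  · obtain ⟨L, R, hD⟩ := h.principal
    refine ⟨L.map fun w => (w.1, w.1 + w.2), (R.map fun w => (w.1, w.1 + w.2)) ++ [(1, 0)], ?_⟩
    rw [hD]
    simp only [List.map_append, List.map_cons, List.cons_append, List.cons.injEq, true_and,
      List.append_assoc, List.append_cancel_left_eq, Prod.mk.injEq, and_true]
    omega

/-- Induction along the subtractive Euclidean algorithm, which transforms the Bézout pair `(u, v)`
together with `(k, l)`. It stops at `k = l`, where the Bézout relation forces `k = l = u = 1` and `v
= 0`. -/
theorem divisorSpec (N : ℕ) : ∀ {k l u v : ℕ}, k + l ≤ N → 0 < k → 0 < l →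
    k * u = l * v + 1 → u ≤ l → v ≤ k → DivisorSpec k l u v (divisors k l) := by
  induction N with
  | zero => intros; omega
  | succ N ih =>
    intro k l u v hN hk hl huv hu hv
    rw [divisors]
    by_cases hkl : k = l
    · subst hkl
      have hk1 : k = 1 := by
        have : k ∣ 1 := (Nat.dvd_add_right (Dvd.intro v rfl)).mp (huv ▸ Dvd.intro u rfl)
        exact Nat.dvd_one.mp this
      subst hk1
      obtain rfl : u = 1 := by omega
      obtain rfl : v = 0 := by omega
      rw [if_pos (by simp)]
      refine ⟨by simp [Unimodular], by simp, rfl, rfl, [], [], rfl⟩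
    · rw [if_neg (by omega)]
      have hu' : (l - u) + u = l := by omega
      have hv' : (k - v) + v = k := by omega
      set a := l - u
      set b := k - v
      -- The complementary pair satisfies the mirrored Bézout relation, which yields the bounds
      -- needed for the truncated subtractions.
      have hab : l * b = k * a + 1 := by
        have e1 : l * (b + v) = l * k := by rw [hv']
        have e2 : k * (a + u) = l * k := by rw [hu', mul_comm]
        rw [mul_add] at e1 e2
        omega
      split_ifs with hlk
      · have hvu : u ≤ v := by nlinarith
        have h1 : v - u ≤ k - l := by
          have : a ≤ b := by nlinarith
          omega
        refine DivisorSpec.of_lt hlk hu hv hvu h1 (ih (by omega) (by omega) hl ?_ hu h1)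
        obtain ⟨w, rfl⟩ := Nat.exists_eq_add_of_le hvu
        obtain ⟨m, rfl⟩ := Nat.exists_eq_add_of_lt hlk
        have e1 : l + m + 1 - l = m + 1 := by omega
        rw [e1, Nat.add_sub_cancel_left]
        linarith
      · have hkl' : k < l := by omega
        have hvu : v ≤ u := by nlinarith
        have h1 : u - v ≤ l - k := by
          have : b ≤ a := by nlinarith
          omega
        refine DivisorSpec.of_gt hkl' hu hv hvu h1 (ih (by omega) hk (by omega) ?_ h1 hv)
        obtain ⟨w, rfl⟩ := Nat.exists_eq_add_of_le hvu
        obtain ⟨m, rfl⟩ := Nat.exists_eq_add_of_lt hkl'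
        have e1 : k + m + 1 - k = m + 1 := by omega
        rw [e1, Nat.add_sub_cancel_left]
        linarith

theorem isChain_of_infix {α : Type*} {R : α → α → Prop} :
    ∀ {D : List α}, (∀ a b, [a, b] <:+: D → R a b) → D.IsChain R
  | [], _ => List.isChain_nil
  | [a], _ => List.isChain_singleton a
  | a :: b :: D, h => List.isChain_cons_cons.mpr ⟨h a b ⟨[], D, rfl⟩,
      isChain_of_infix fun c d hcd => h c d (hcd.trans (List.suffix_cons _ _).isInfix)⟩

/-- The chain is cut at the principal component. The part after it is treated directly; the part
before it is reversed and its coordinates exchanged, so that it also runs outwards to an axis. -/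
theorem SepHyp.exists_vertices {k l ε₀ εinf u v : ℕ} {ω : Form} (H : SepHyp k l ε₀ εinf ω)
    (hk : 0 < k) (hl : 0 < l) (huv : k * u = l * v + 1) (hu : u ≤ l) (hv : v ≤ k)
    (hε₀ : ε₀ ≤ 1) (hεinf : εinf ≤ 1)
    (hgood : ∀ V W, IsChart k l V W → ∃ η α β, IsGood ω V W η α β) {A B : ℕ × ℕ → ℂ}
    (hω : LogCoeffs ω A B) :
    IsChart k l (k - v, l - u) (k, l) ∧
    (∃ P, IsVertex A B (k - v, l - u) (k, l) P ∧ P.1 = ε₀) ∧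
    (∃ P, IsVertex A B (k, l) (v, u) P ∧ P.2 = εinf) := by
  have hD := divisorSpec (k + l) le_rfl hk hl huv hu hv
  obtain ⟨L, R, hLR⟩ := hD.principal
  have hch : (divisors k l).IsChain fun W V => Unimodular V W ∧ ∃ η α β, IsGood ω V W η α β :=
    isChain_of_infix fun W V hWV =>
      ⟨by simpa using hD.chain.infix hWV, hgood V W hWV⟩
  refine ⟨⟨L ++ [(v, u)], R, by rw [hLR]; simp⟩, ?_, ?_⟩
  · have hs : (k, l) :: (k - v, l - u) :: R <:+ divisors k l := ⟨L ++ [(v, u)], by rw [hLR]; simp⟩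
    refine H.exists_vertex_side hl hε₀ hω R (k, l) (k - v, l - u) (hch.infix hs.isInfix) hk hl
      (fun E hE => hD.mem E (hs.subset (List.mem_cons_of_mem _ hE))) ?_ (by simp [mul_comm])
    have := hD.last
    rw [hLR] at this
    simpa using this
  · have hs : L ++ [(v, u), (k, l)] <+: divisors k l := ⟨(k - v, l - u) :: R, by rw [hLR]; simp⟩
    have hrev : (L ++ [(v, u), (k, l)]).reverse.map Prod.swap =
        (l, k) :: (u, v) :: (L.reverse.map Prod.swap) := by simp
    have hc : ((l, k) :: (u, v) :: (L.reverse.map Prod.swap)).IsChain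
        fun W V => Unimodular V W ∧ ∃ η α β, IsGood (swapForm ω) V W η α β := by
      rw [← hrev, List.isChain_map, List.isChain_reverse]
      refine (hch.infix hs.isInfix).imp fun W V h => ⟨?_, ?_⟩
      · have := h.1
        simp only [Unimodular, Prod.fst_swap, Prod.snd_swap] at *
        linarith
      · obtain ⟨η, α, β, hg⟩ := h.2
        exact ⟨_, _, _, hg.dual⟩
    obtain ⟨P, hP, hP1⟩ := H.dual.exists_vertex_side hk hεinf hω.dual _ _ _ hc hl hk
      (fun E hE => by
        have h1 : E ∈ (L ++ [(v, u), (k, l)]).reverse.map Prod.swap := by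
          rw [hrev]; exact List.mem_cons_of_mem _ hE
        obtain ⟨E', hE', rfl⟩ := List.mem_map.mp h1
        rcases hD.mem E' (hs.subset (List.mem_reverse.mp hE')) with rfl | rfl | h2
        · simp
        · simp
        · exact Or.inr (Or.inr ⟨h2.2, h2.1⟩)) (by
        have h1 := hD.head
        rw [hLR] at h1
        cases L with
        | nil => simp at h1; simp [h1]
        | cons E L =>
          obtain rfl : E = (0, 1) := by simpa using h1
          rw [List.getLast?_cons]
          simp) (by simp [mul_comm])
    exact ⟨P.swap, IsVertex.dual (V := (k, l)) (W := (v, u)) hP, hP1⟩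

/-! ### The points of the principal component on the separatrices -/

/-- Unimodularity gives `V.1 * l = V.2 * k + 1`, so the powers of `z.2` cancel and a single factor
`z.1` remains: `x ^ l / y ^ k` is the coordinate on the principal component. -/
theorem ratio_chartMap {V : ℕ × ℕ} {k l : ℕ} (h : Unimodular V (k, l)) {z : ℂ × ℂ}
    (h1 : z.1 ≠ 0) (h2 : z.2 ≠ 0) :
    (chartMap V (k, l) z).1 ^ l / (chartMap V (k, l) z).2 ^ k = z.1 := by
  simp only [Unimodular] at h
  simp only [chartMap]
  rw [mul_pow, mul_pow, ← pow_mul, ← pow_mul, ← pow_mul, ← pow_mul, h, pow_succ, mul_comm l k]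
  field_simp

theorem PassesThrough.tendsto {V : ℕ × ℕ} {k l : ℕ} (hk : 0 < k) (hl : 0 < l)
    (h : Unimodular V (k, l)) {γ : ℂ → ℂ × ℂ} (hγ : IsCurve γ) {p : ℂ} (hp : p ≠ 0)
    (hγp : PassesThrough V (k, l) γ (p, 0)) :
    Tendsto (fun t => (γ t).1 ^ l / (γ t).2 ^ k) (𝓝[≠] 0) (𝓝 p) := by
  obtain ⟨δ, hδ, hδ0, hδγ⟩ := hγp
  have h1 : Tendsto (fun t => (δ t).1) (𝓝 0) (𝓝 p) := by
    have := (continuous_fst.tendsto _).comp hδ.continuousAt.tendsto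
    rw [hδ0] at this
    exact this
  refine (h1.mono_left nhdsWithin_le_nhds).congr' ?_
  filter_upwards [hγ.2.2, hδγ.filter_mono nhdsWithin_le_nhds,
    (h1.eventually_ne hp).filter_mono nhdsWithin_le_nhds] with t h2 h3 h4
  have h5 : (δ t).2 ≠ 0 := fun h5 => h2 (by rw [← h3]; simp [chartMap, h5, hk.ne', hl.ne'])
  rw [← h3, ratio_chartMap h h4 h5]

theorem unimodular_sub {k l u v : ℕ} (huv : k * u = l * v + 1) (hu : u ≤ l) (hv : v ≤ k) :
    Unimodular (k - v, l - u) (k, l) := by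
  have h1 : (k - v) + v = k := by omega
  have h2 : (l - u) + u = l := by omega
  simp only [Unimodular]
  set a := k - v
  set b := l - u
  have e1 : l * (a + v) = l * k := by rw [h1]
  have e2 : k * (b + u) = l * k := by rw [h2, mul_comm]
  rw [mul_add] at e1 e2
  rw [mul_comm a, mul_comm b]
  omega

theorem MemQ.sepHyp {k l u v n ε₀ εinf : ℕ} {s c : Fin n → ℂ} {ω : Form}
    (h : MemQ k l u v n ε₀ εinf s c ω) (hk : 0 < k) (hl : 0 < l)
    (hV : Unimodular (k - v, l - u) (k, l)) : SepHyp k l ε₀ εinf ω := by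
  refine ⟨h.analytic, h.isolated, h.invariant_x, h.invariant_y, fun γ hγ => ?_⟩
  rcases h.separatrices γ hγ with h1 | h1 | ⟨i, hi⟩
  · exact Or.inl h1
  · exact Or.inr (Or.inl h1)
  · have hc : 1 / c i ≠ 0 := one_div_ne_zero (h.c_ne_zero i)
    exact Or.inr (Or.inr ⟨_, hc, hi.tendsto hk hl hV hγ.1 hc⟩)

theorem MemQ.exists_isGood {k l u v n ε₀ εinf : ℕ} {s c : Fin n → ℂ} {ω : Form}
    (h : MemQ k l u v n ε₀ εinf s c ω) (V W : ℕ × ℕ) (hVW : IsChart k l V W) :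
    ∃ η α β, IsGood ω V W η α β := by
  obtain ⟨η, ⟨α, β, h1⟩, h2, h3⟩ := h.desingularized V W hVW
  exact ⟨η, α, β, h1, h2, h3⟩

/-- The left side vanishes to order one less than `f`, the right side at least to the order of `f`.
-/
theorem not_order_lt {f G : ℂ → ℂ} (hf : AnalyticAt ℂ f 0) (hf0 : f 0 = 0)
    (hne : ¬ ∀ᶠ t in 𝓝 (0 : ℂ), f t = 0) {b : ℂ → ℂ} (hb : ContinuousAt b 0) (hb0 : b 0 ≠ 0)
    (hG : ContinuousAt G 0) (h : ∀ᶠ t in 𝓝[≠] (0 : ℂ), b t * deriv f t = f t * G t) : False := by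
  obtain ⟨N, g, hg, hg0, hfg⟩ := hf.exists_eventuallyEq_pow_smul_nonzero_iff.mpr hne
  simp only [sub_zero, smul_eq_mul] at hfg
  obtain ⟨N, rfl⟩ : ∃ M, N = M + 1 := by
    refine Nat.exists_eq_succ_of_ne_zero fun h0 => ?_
    have := hfg.self_of_nhds
    rw [hf0, h0, pow_zero, one_mul] at this
    exact hg0 this.symm
  have h1 : ∀ᶠ t in 𝓝[≠] (0 : ℂ), b t * ((N + 1) * g t + t * deriv g t) = t * (g t * G t) := by
    filter_upwards [h, hfg.eventually_nhds.filter_mono nhdsWithin_le_nhds,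
      hg.eventually_analyticAt.filter_mono nhdsWithin_le_nhds, self_mem_nhdsWithin]
      with t h1 h2 h3 h4
    have h5 : deriv f t = (N + 1) * t ^ N * g t + t ^ (N + 1) * deriv g t := by
      have h2' : f =ᶠ[𝓝 t] fun t => t ^ (N + 1) * g t := h2
      rw [h2'.deriv_eq]
      have := (hasDerivAt_pow (N + 1) t).mul h3.differentiableAt.hasDerivAt
      exact (this.congr_deriv (by simp)).deriv
    rw [h5, h2.self_of_nhds] at h1
    refine mul_left_cancel₀ (pow_ne_zero N h4) ?_
    linear_combination h1
  have hdg : ContinuousAt (deriv g) 0 := hg.deriv.continuousAt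
  have h2 : ContinuousAt (fun t => b t * ((N + 1) * g t + t * deriv g t)) 0 :=
    hb.mul ((continuousAt_const.mul hg.continuousAt).add (continuousAt_id.mul hdg))
  have h3 : ContinuousAt (fun t => t * (g t * G t)) 0 :=
    continuousAt_id.mul (hg.continuousAt.mul hG)
  have h4 := tendsto_nhds_unique
    ((h2.tendsto.mono_left (nhdsWithin_le_nhds (s := {0}ᶜ))).congr' h1)
    (h3.tendsto.mono_left nhdsWithin_le_nhds)
  simp only [zero_mul, add_zero] at h4
  have hN : ((N : ℂ) + 1) ≠ 0 := by exact_mod_cast N.succ_ne_zero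
  exact mul_ne_zero hb0 (mul_ne_zero hN hg0) h4

/-- A separatrix meets an invariant divisor in a singular point. -/
theorem IsGood.root_of_separatrix {ω : Form} {V W : ℕ × ℕ} {η : Form} {α β : ℕ}
    (hg : IsGood ω V W η α β) (hW1 : 0 < W.1) (hW2 : 0 < W.2) {γ : ℂ → ℂ × ℂ}
    (hγ : IsSeparatrix ω γ) {p : ℂ} (hp : p ≠ 0) (hγp : PassesThrough V W γ (p, 0)) :
    (η (p, 0)).2 = 0 := by
  by_contra hB
  obtain ⟨δ, hδ, hδ0, hδγ⟩ := hγp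
  have hst := hg.strict (p, 0) (chartMap_axis hW1 hW2 p)
  have htr : AnalyticAt ℂ (fun z : ℂ × ℂ => ((p, 0) + z)) 0 := analyticAt_const.add analyticAt_id
  have hA : AnalyticAt ℂ (fun z : ℂ × ℂ => (η ((p, 0) + z)).1) 0 :=
    analyticAt_fst.comp (AnalyticAt.comp_of_eq (g := η) (f := fun z : ℂ × ℂ => ((p, 0) + z))
      hst.1 htr (by simp))
  obtain ⟨A₁, hA₁, hAA⟩ := exists_eq_snd_mul hA (Eventually.of_forall fun x => by
    simpa using hg.fst_eq_zero hW1 hW2 (p + x))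
  have hδ1 : AnalyticAt ℂ (fun t => (δ t).1) 0 := analyticAt_fst.comp hδ
  have hδ2 : AnalyticAt ℂ (fun t => (δ t).2) 0 := analyticAt_snd.comp hδ
  have hsub : Tendsto (fun t => δ t - (p, 0)) (𝓝 0) (𝓝 0) := by
    have : ContinuousAt (fun t => δ t - (p, 0)) 0 := hδ.continuousAt.sub continuousAt_const
    rw [ContinuousAt, hδ0, sub_self] at this
    exact this
  have hδt : Tendsto δ (𝓝 0) (𝓝 (p, 0)) := hδ0 ▸ hδ.continuousAt.tendsto
  have hne2 : ∀ᶠ t in 𝓝[≠] (0 : ℂ), (δ t).2 ≠ 0 := by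
    filter_upwards [hγ.1.2.2, hδγ.filter_mono nhdsWithin_le_nhds] with t h2 h3 h5
    exact h2 (by rw [← h3]; simp [chartMap, h5, hW1.ne', hW2.ne'])
  have hne1 : ∀ᶠ t in 𝓝 (0 : ℂ), (δ t).1 ≠ 0 :=
    hδ1.continuousAt.eventually_ne (by rw [hδ0]; exact hp)
  have hB' : ContinuousAt (fun t => (η (δ t)).2) 0 := by
    have : ContinuousAt η (δ 0) := hδ0 ▸ hst.1.continuousAt
    exact continuous_snd.continuousAt.comp (this.comp hδ.continuousAt)
  have hG : ContinuousAt (fun t => -(A₁ (δ t - (p, 0)) * deriv (fun t => (δ t).1) t)) 0 := by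
    refine (ContinuousAt.mul ?_ hδ1.deriv.continuousAt).neg
    have : ContinuousAt A₁ (δ 0 - (p, 0)) := by
      rw [hδ0, sub_self]; exact hA₁.continuousAt
    exact ContinuousAt.comp (g := A₁) (f := fun t => δ t - (p, 0)) this
      (hδ.continuousAt.sub continuousAt_const)
  -- With `A = y A₁`, invariance of the curve reads `B y' = -y A₁ x'`; a non-zero `B` contradicts
  -- the orders of vanishing in `t`.
  refine not_order_lt hδ2 (by rw [hδ0]) ?_ hB' (by rw [hδ0]; exact hB) hG ?_
  · intro h
    obtain ⟨t, h1, h2⟩ := ((h.filter_mono nhdsWithin_le_nhds).and hne2).exists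
    exact h2 h1
  · filter_upwards [hne2, hne1.filter_mono nhdsWithin_le_nhds,
      hδ.eventually_analyticAt.filter_mono nhdsWithin_le_nhds,
      hδγ.eventually_nhds.filter_mono nhdsWithin_le_nhds, hγ.2.filter_mono nhdsWithin_le_nhds,
      (hδt.eventually hst.2.1).filter_mono nhdsWithin_le_nhds,
      (hsub.eventually hAA).filter_mono nhdsWithin_le_nhds] with t h2 h1 han hev hinv hpb hAt
    have hev' : (fun t => chartMap V W (δ t)) =ᶠ[𝓝 t] γ := hev
    have h3 := pullback_curve ω V W han.differentiableAt
    rw [hev'.deriv_eq, hev.self_of_nhds, hinv, hpb] at h3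
    simp only [Prod.smul_fst, Prod.smul_snd, smul_eq_mul] at h3
    have hm : (δ t).1 ^ α * (δ t).2 ^ β ≠ 0 := mul_ne_zero (pow_ne_zero _ h1) (pow_ne_zero _ h2)
    rw [add_sub_cancel] at hAt
    have e2 : (δ t - (p, 0)).2 = (δ t).2 := by simp
    rw [e2] at hAt
    rw [hAt] at h3
    rw [(hasDerivAt_snd han.differentiableAt.hasDerivAt).deriv,
      (hasDerivAt_fst han.differentiableAt.hasDerivAt).deriv]
    refine mul_left_cancel₀ hm ?_
    linear_combination -h3

/-! ### Residues -/

/-- By Cauchy's formula the circle integrals are constant for small radii, so the limit defining the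
residue is that of a constant. -/
theorem residue_eq {h g : ℂ → ℂ} {p : ℂ} (hg : AnalyticAt ℂ g p)
    (hh : ∀ᶠ x in 𝓝[≠] p, h x = (x - p)⁻¹ * g x) : residue h p = g p := by
  obtain ⟨R₁, hR₁, h1⟩ := Metric.eventually_nhds_iff_ball.mp hg.eventually_analyticAt
  obtain ⟨R₂, hR₂, h2⟩ := Metric.eventually_nhds_iff_ball.mp (eventually_nhdsWithin_iff.mp hh)
  refine Tendsto.limUnder_eq (tendsto_const_nhds.congr' ?_)
  have hmin : 0 < min R₁ R₂ := lt_min hR₁ hR₂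
  filter_upwards [Ioo_mem_nhdsGT hmin] with r hr
  have hr1 : r < R₁ := hr.2.trans_le (min_le_left _ _)
  have hr2 : r < R₂ := hr.2.trans_le (min_le_right _ _)
  have e1 : (∮ x in C(p, r), h x) = ∮ x in C(p, r), (x - p)⁻¹ • g x := by
    refine circleIntegral.integral_congr hr.1.le fun x hx => ?_
    have hx' : dist x p = r := hx
    exact h2 x (by rw [Metric.mem_ball, hx']; exact hr2) (fun h => by
      rw [Set.mem_singleton_iff.mp h, dist_self] at hx'
      exact hr.1.ne hx')
  have hd : DifferentiableOn ℂ g (Metric.closedBall p r) := fun x hx =>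
    (h1 x (Metric.closedBall_subset_ball hr1 hx)).differentiableAt.differentiableWithinAt
  rw [e1, hd.circleIntegral_sub_inv_smul (Metric.mem_ball_self hr.1), smul_eq_mul]
  have hpi : (2 * (Real.pi : ℂ) * Complex.I) ≠ 0 := by simp [Real.pi_ne_zero]
  field_simp

/-- The logarithmic coefficients of order less than `m` along the divisor of weight `W` vanish, and
`m` is the order of the contraction with `W`. -/
structure HasOrder (A B : ℕ × ℕ → ℂ) (W : ℕ × ℕ) (m : ℕ) : Prop where
  le : ∀ Q, (A Q ≠ 0 ∨ B Q ≠ 0) → m ≤ dot W Q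
  exists_ne : ∃ P, dot W P = m ∧ pair W A B P ≠ 0

/-- The Camacho–Sad index in terms of the logarithmic coefficients. -/
theorem IsStrictTransformWith.indexY_eq {ω : Form} {V W : ℕ × ℕ} {η : Form} {α β : ℕ}
    (hη : IsStrictTransformWith ω V W η α β) (hVW : Unimodular V W) {A B : ℕ × ℕ → ℂ}
    (hω : LogCoeffs ω A B) (hW1 : 0 < W.1) (hW2 : 0 < W.2) {m : ℕ} (hm : HasOrder A B W m)
    {p : ℂ} {g : ℂ → ℂ} (hg : AnalyticAt ℂ g p)
    (hF : ∀ᶠ x in 𝓝[≠] p, x ≠ 0 ∧ ∑ P ∈ face W m, pair W A B P * x ^ dot V P ≠ 0 ∧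
      (∑ P ∈ face W m, pair V A B P * x ^ dot V P) * (x - p) =
        g x * (x * ∑ P ∈ face W m, pair W A B P * x ^ dot V P)) :
    indexY η p = -g p := by
  obtain ⟨e₁, e₂, S⟩ := hη.exists_strictCoeffs hVW hω
  obtain ⟨P₀, hP₀, hP₀'⟩ := hm.exists_ne
  have hβ := S.order_eq (hη 0 (chartMap_zero hVW)).2.2 hm.le hP₀ hP₀'
  subst hβ
  rw [indexY, residue_eq hg]
  filter_upwards [hF, self_mem_nhdsWithin] with x ⟨hx, hF, hG⟩ hxp
  have hxp' : x - p ≠ 0 := sub_ne_zero.mpr hxp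
  have han := (hη (x, 0) (chartMap_axis hW1 hW2 x)).1
  have hline : AnalyticAt ℂ (fun y : ℂ => η (x, y)) 0 :=
    AnalyticAt.comp (g := η) (f := fun t : ℂ => (x, t)) han (analyticAt_const.prod analyticAt_id)
  have hd1 : DifferentiableAt ℂ (fun y => (η (x, y)).1) 0 :=
    (analyticAt_fst.comp hline).differentiableAt
  have hd2 : DifferentiableAt ℂ (fun y => (η (x, y)).2) 0 :=
    (analyticAt_snd.comp hline).differentiableAt
  have h0 : (η (x, 0)).1 = 0 := by
    have h1 := hη.restrict_fst hω hW1 hW2 x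
    rw [Finset.sum_eq_zero] at h1
    · exact (mul_eq_zero.mp h1).resolve_left (pow_ne_zero _ hx)
    · intro P hP
      rw [mem_face hW1 hW2] at hP
      have : pair V A B P = 0 := by
        by_contra h
        have := hm.le P (supp_of_pair_ne_zero h)
        omega
      rw [this, zero_mul]
  have h2 := hη.restrict_snd hω hW1 hW2 x
  have h3 := hη.restrict_deriv_fst hω hW1 hW2 x
  rw [← h2] at hF hG
  rw [← h3] at hG
  have hB : (η (x, 0)).2 ≠ 0 := right_ne_zero_of_mul hF
  have hα : x ^ α ≠ 0 := pow_ne_zero _ hx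
  -- Since `η` has vanishing first coefficient on `y = 0`, the derivative of the denominator does
  -- not contribute.
  have h4 : deriv (fun y => (η (x, y)).1 / (η (x, y)).2) 0 =
      deriv (fun y => (η (x, y)).1) 0 / (η (x, 0)).2 := by
    have := (hd1.hasDerivAt.div hd2.hasDerivAt hB).deriv
    rw [h0, zero_mul, sub_zero] at this
    refine this.trans ?_
    field_simp
  rw [h4]
  field_simp
  refine mul_left_cancel₀ (mul_ne_zero hα hx) ?_
  rw [pow_succ] at hG
  linear_combination hG

/-! ### The initial part of the contraction -/

/-- Simplicity of the roots `1 / c i` leaves a cofactor without non-zero roots, hence a monomial.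
The factors are normalised to constant term one. -/
theorem eq_monomial_mul_prod {n : ℕ} {c : Fin n → ℂ} (hc0 : ∀ i, c i ≠ 0)
    (hc : Function.Injective c) {F : Polynomial ℂ} (hF : F ≠ 0)
    (h1 : ∀ i, F.eval (1 / c i) = 0) (h2 : ∀ i, F.derivative.eval (1 / c i) ≠ 0)
    (h3 : ∀ p, p ≠ 0 → F.eval p = 0 → ∃ i, p = 1 / c i) :
    ∃ a N, a ≠ 0 ∧ F = Polynomial.C a * Polynomial.X ^ N *
      ∏ i, (1 - Polynomial.C (c i) * Polynomial.X) := by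
  have hinj : Function.Injective fun i => 1 / c i := fun i j hij => hc (by simpa using hij)
  have hdvd : ∏ i, (Polynomial.X - Polynomial.C (1 / c i)) ∣ F := by
    refine Finset.prod_dvd_of_coprime (fun i _ j _ hij => ?_) fun i _ => ?_
    · exact Polynomial.pairwise_coprime_X_sub_C hinj hij
    · exact Polynomial.dvd_iff_isRoot.mpr (h1 i)
  obtain ⟨H, hH⟩ := hdvd
  have hprod : ∏ i, (1 - Polynomial.C (c i) * Polynomial.X) =
      Polynomial.C (∏ i, (-c i)) * ∏ i, (Polynomial.X - Polynomial.C (1 / c i)) := by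
    rw [map_prod, ← Finset.prod_mul_distrib]
    refine Finset.prod_congr rfl fun i _ => ?_
    have : Polynomial.C (c i) * Polynomial.C (1 / c i) = 1 := by
      rw [← Polynomial.C_mul, mul_one_div_cancel (hc0 i), Polynomial.C_1]
    rw [Polynomial.C_neg]
    linear_combination -this
  have hne : ∏ i, (-c i) ≠ 0 := Finset.prod_ne_zero_iff.mpr fun i _ => neg_ne_zero.mpr (hc0 i)
  obtain ⟨a, N, hHa⟩ := exists_eq_monomial (F := H)
    (fun h => hF (by rw [hH, h, mul_zero])) (fun p hp hp0 => by
      have hFp : F.eval p = 0 := by rw [hH, Polynomial.eval_mul, hp0, mul_zero]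
      obtain ⟨i, rfl⟩ := h3 p hp hFp
      refine h2 i ?_
      have hG0 : (∏ i, (Polynomial.X - Polynomial.C (1 / c i))).eval (1 / c i) = 0 := by
        rw [Polynomial.eval_prod]
        exact Finset.prod_eq_zero (Finset.mem_univ i) (by simp)
      rw [hH, Polynomial.derivative_mul, Polynomial.eval_add, Polynomial.eval_mul,
        Polynomial.eval_mul, hp0, hG0, mul_zero, zero_mul, add_zero])
  have ha : a ≠ 0 := by
    rintro rfl
    exact hF (by rw [hH, hHa, Polynomial.C_0, zero_mul, mul_zero])
  refine ⟨a / ∏ i, (-c i), N, div_ne_zero ha hne, ?_⟩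
  rw [hprod, hH, hHa]
  have : Polynomial.C a = Polynomial.C (a / ∏ i, (-c i)) * Polynomial.C (∏ i, (-c i)) := by
    rw [← Polynomial.C_mul, div_mul_cancel₀ _ hne]
  rw [this]
  ring

theorem coeff_prod_one_sub {n : ℕ} (c : Fin n → ℂ) (s : Finset (Fin n)) :
    (∏ i ∈ s, (1 - Polynomial.C (c i) * Polynomial.X)).natDegree ≤ s.card ∧
    (∏ i ∈ s, (1 - Polynomial.C (c i) * Polynomial.X)).coeff s.card = ∏ i ∈ s, (-c i) := by
  have h1 : ∀ i, (1 - Polynomial.C (c i) * Polynomial.X : Polynomial ℂ).natDegree ≤ 1 := fun i => by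
    compute_degree
  constructor
  · refine (Polynomial.natDegree_prod_le _ _).trans ?_
    refine (Finset.sum_le_sum fun i _ => h1 i).trans ?_
    simp
  · have := Polynomial.coeff_prod_of_natDegree_le s
      (fun i => (1 - Polynomial.C (c i) * Polynomial.X : Polynomial ℂ)) 1 (fun i _ => h1 i)
    rw [mul_one] at this
    rw [this]
    refine Finset.prod_congr rfl fun i _ => ?_
    simp [Polynomial.coeff_one]

theorem exists_of_coeff_sumPoly_ne_zero {T : Finset (ℕ × ℕ)} {c : ℕ × ℕ → ℂ} {e : ℕ × ℕ → ℕ}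
    {j : ℕ} (h : (sumPoly T c e).coeff j ≠ 0) : ∃ P ∈ T, c P ≠ 0 ∧ e P = j := by
  rw [sumPoly, Polynomial.finsetSum_coeff] at h
  obtain ⟨P, hP, h1⟩ := Finset.exists_ne_zero_of_sum_ne_zero h
  rw [Polynomial.coeff_C_mul_X_pow] at h1
  split_ifs at h1 with h2
  · exact ⟨P, hP, h1, h2.symm⟩
  · exact absurd rfl h1

/-- The exponents of the initial part. -/
def initialExp (k l n ε₀ εinf r : ℕ) : ℕ × ℕ := (ε₀ + l * r, εinf + k * (n - r))

/-- The shape of the initial part of the form. -/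
structure InitialPart (k l n ε₀ εinf d : ℕ) (c : Fin n → ℂ) (A B : ℕ × ℕ → ℂ) (c₀ : ℂ) :
    Prop where
  ne_zero : c₀ ≠ 0
  le : ∀ Q, (A Q ≠ 0 ∨ B Q ≠ 0) → d ≤ dot (k, l) Q
  mem : ∀ Q, (A Q ≠ 0 ∨ B Q ≠ 0) → dot (k, l) Q = d → ∃ r ≤ n, Q = initialExp k l n ε₀ εinf r
  contraction : ∑ r ∈ Finset.range (n + 1),
      Polynomial.C (pair (k, l) A B (initialExp k l n ε₀ εinf r)) * Polynomial.X ^ r =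
    Polynomial.C c₀ * ∏ i, (1 - Polynomial.C (c i) * Polynomial.X)

theorem dot_initialExp {k l n ε₀ εinf r : ℕ} (hr : r ≤ n) :
    dot (k, l) (initialExp k l n ε₀ εinf r) = n * k * l + k * ε₀ + l * εinf := by
  obtain ⟨q, rfl⟩ := Nat.exists_eq_add_of_le hr
  simp only [dot, initialExp, Nat.add_sub_cancel_left]
  ring

theorem dot_initialExp_right {V : ℕ × ℕ} {k l n ε₀ εinf r : ℕ} (h : Unimodular V (k, l))
    (hr : r ≤ n) : dot V (initialExp k l n ε₀ εinf r) =
      dot V (initialExp k l n ε₀ εinf 0) + r := by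
  obtain ⟨q, rfl⟩ := Nat.exists_eq_add_of_le hr
  simp only [Unimodular] at h
  simp only [dot, initialExp, Nat.add_sub_cancel_left, Nat.sub_zero, mul_zero, add_zero]
  zify at h ⊢
  linear_combination (r : ℤ) * h

theorem dot_initialExp_left {U : ℕ × ℕ} {k l n ε₀ εinf r : ℕ} (h : Unimodular (k, l) U)
    (hr : r ≤ n) : dot U (initialExp k l n ε₀ εinf r) =
      dot U (initialExp k l n ε₀ εinf n) + (n - r) := by
  obtain ⟨q, rfl⟩ := Nat.exists_eq_add_of_le hr
  simp only [Unimodular] at h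
  simp only [dot, initialExp, Nat.add_sub_cancel_left, Nat.sub_self, mul_zero, add_zero]
  zify at h ⊢
  linear_combination (q : ℤ) * h

theorem sum_face_initialExp {k l n ε₀ εinf d : ℕ} {A B : ℕ × ℕ → ℂ}
    (h : ∀ Q, (A Q ≠ 0 ∨ B Q ≠ 0) → dot (k, l) Q = d → ∃ r ≤ n, Q = initialExp k l n ε₀ εinf r)
    (hk : 0 < k) (hl : 0 < l)
    (hd : d = n * k * l + k * ε₀ + l * εinf) {g : ℕ × ℕ → ℂ}
    (hg : ∀ Q, A Q = 0 → B Q = 0 → g Q = 0) :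
    ∑ P ∈ face (k, l) d, g P =
      ∑ r ∈ Finset.range (n + 1), g (initialExp k l n ε₀ εinf r) := by
  symm
  refine Finset.sum_of_injOn (initialExp k l n ε₀ εinf) ?_ ?_ ?_ fun _ _ => rfl
  · intro r _ r' _ hrr
    have h1 : ε₀ + l * r = ε₀ + l * r' := congrArg Prod.fst hrr
    exact Nat.eq_of_mul_eq_mul_left hl (Nat.add_left_cancel h1)
  · intro r hr
    rw [Finset.mem_coe, mem_face hk hl, hd]
    exact dot_initialExp (Nat.lt_succ_iff.mp (Finset.mem_range.mp hr))
  · intro P hP hPr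
    by_contra hgP
    have hsupp : A P ≠ 0 ∨ B P ≠ 0 := by
      by_contra! h0
      exact hgP (hg P h0.1 h0.2)
    obtain ⟨r, hr, rfl⟩ := h P hsupp ((mem_face hk hl).mp hP)
    exact hPr ⟨r, Finset.mem_coe.mpr (Finset.mem_range.mpr (Nat.lt_succ_of_le hr)), rfl⟩

/-- The restriction of the strict transform to the principal component. -/
theorem MemQ.principal_polynomial {k l u v n ε₀ εinf : ℕ} {s c : Fin n → ℂ} {ω : Form}
    (h : MemQ k l u v n ε₀ εinf s c ω) (hk : 0 < k) (hl : 0 < l)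
    (hV : Unimodular (k - v, l - u) (k, l)) {η : Form} {α β : ℕ}
    (hg : IsGood ω (k - v, l - u) (k, l) η α β) {F : Polynomial ℂ} (hF0 : F ≠ 0)
    (hF : ∀ x, F.eval x = x ^ α * (η (x, 0)).2) :
    ∃ a N, a ≠ 0 ∧ F = Polynomial.C a * Polynomial.X ^ N *
      ∏ i, (1 - Polynomial.C (c i) * Polynomial.X) := by
  have hc : ∀ i, 1 / c i ≠ 0 := fun i => one_div_ne_zero (h.c_ne_zero i)
  have hroot : ∀ i, (η (1 / c i, 0)).2 = 0 := fun i => by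
    obtain ⟨γ, hγ, hγi⟩ := h.cuspidal i
    exact hg.root_of_separatrix hk hl hγ (hc i) hγi
  refine eq_monomial_mul_prod h.c_ne_zero h.c_injective hF0 (fun i => ?_) (fun i => ?_)
    fun p hp hFp => ?_
  · rw [hF, hroot, mul_zero]
  -- At `1 / c i` the derivative of `F` is a power of `1 / c i` times the eigenvalue `∂B/∂x`, which
  -- is non-zero without saddle-nodes.
  · have han := (hg.strict (1 / c i, 0) (chartMap_axis hk hl _)).1
    have hd : DifferentiableAt ℂ (fun x => (η (x, 0)).2) (1 / c i) := by
      refine (analyticAt_snd.comp ?_).differentiableAt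
      exact AnalyticAt.comp (g := η) (f := fun t : ℂ => (t, (0 : ℂ))) han
        (analyticAt_id.prod analyticAt_const)
    rw [← Polynomial.deriv]
    have e : (fun x => F.eval x) = fun x => x ^ α * (η (x, 0)).2 := funext hF
    have e2 := ((hasDerivAt_pow α (1 / c i)).mul hd.hasDerivAt).deriv
    rw [hroot, mul_zero, zero_add, (fderiv_fst_of_axis han.differentiableAt).2] at e2
    rw [e]
    refine fun h0 => mul_ne_zero (pow_ne_zero α (hc i)) (hg.exponents hk hl (hroot i)).2.1
      (e2.symm.trans h0)
  · rw [hF] at hFp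
    have hp' := (mul_eq_zero.mp hFp).resolve_left (pow_ne_zero _ hp)
    -- Any non-zero root `p` carries a separatrix along which `x ^ l / y ^ k` tends to `p`; it is
    -- not an axis, so the limit must be one of the `1 / c i`.
    obtain ⟨φ, hφ, hφ0, hsep⟩ := hg.exists_separatrix hk hl hp'
    have hφp : Tendsto φ (𝓝[≠] 0) (𝓝 p) :=
      hφ0 ▸ hφ.continuousAt.tendsto.mono_left nhdsWithin_le_nhds
    have hne : ∀ᶠ t in 𝓝[≠] (0 : ℂ), φ t ≠ 0 ∧ t ≠ 0 :=
      (hφp.eventually_ne hp).and self_mem_nhdsWithin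
    have hne1 : ∀ᶠ t in 𝓝[≠] (0 : ℂ), (chartMap (k - v, l - u) (k, l) (φ t, t)).1 ≠ 0 := by
      filter_upwards [hne] with t ht
      exact mul_ne_zero (pow_ne_zero _ ht.1) (pow_ne_zero _ ht.2)
    have hne2 : ∀ᶠ t in 𝓝[≠] (0 : ℂ), (chartMap (k - v, l - u) (k, l) (φ t, t)).2 ≠ 0 := by
      filter_upwards [hne] with t ht
      exact mul_ne_zero (pow_ne_zero _ ht.1) (pow_ne_zero _ ht.2)
    have hs := hsep (by
      filter_upwards [hne1] with t ht h
      exact ht (by rw [h]; rfl))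
    rcases h.separatrices _ hs with ⟨-, h'⟩ | ⟨-, h'⟩ | ⟨i, hi⟩
    · obtain ⟨t, h1, h2⟩ := ((h'.filter_mono nhdsWithin_le_nhds).and hne1).exists
      exact absurd h1 h2
    · obtain ⟨t, h1, h2⟩ := ((h'.filter_mono nhdsWithin_le_nhds).and hne2).exists
      exact absurd h1 h2
    · refine ⟨i, tendsto_nhds_unique hφp ((hi.tendsto hk hl hV hs.1 (hc i)).congr' ?_)⟩
      filter_upwards [hne] with t ht
      exact ratio_chartMap hV ht.1 ht.2

/-- The vertices from the two sides of the principal component are the ends of one edge. The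
polynomial on it, `a X ^ N ∏ (1 - c i X)`, gives their difference as `n (l, -k)`; the exponents `ε₀`
and `ε∞` then locate both. -/
theorem MemQ.exists_initialPart {k l u v n ε₀ εinf d : ℕ} {s c : Fin n → ℂ} {ω : Form}
    (h : MemQ k l u v n ε₀ εinf s c ω) (hk : 0 < k) (hl : 0 < l)
    (huv : k * u = l * v + 1) (hu : u ≤ l) (hv : v ≤ k) (hε₀ : ε₀ ≤ 1) (hεinf : εinf ≤ 1)
    (hd : d = n * k * l + k * ε₀ + l * εinf) {A B : ℕ × ℕ → ℂ} (hω : LogCoeffs ω A B) :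
    ∃ c₀, InitialPart k l n ε₀ εinf d c A B c₀ := by
  have hV := unimodular_sub huv hu hv
  have hU : Unimodular (k, l) (v, u) := huv
  obtain ⟨hchart, ⟨P, hP, hP1⟩, ⟨P', hP', hP1'⟩⟩ := (h.sepHyp hk hl hV).exists_vertices hk hl huv
    hu hv hε₀ hεinf h.exists_isGood hω
  obtain ⟨η, α, β, hg⟩ := h.exists_isGood _ _ hchart
  obtain ⟨e₁, e₂, S⟩ := hg.strict.exists_strictCoeffs hV hω
  have hcP := hP.snd_ne hk hl
  have hcP' := hP'.fst_ne hk hl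
  have hβ := S.order_eq (hg.strict 0 (chartMap_zero hV)).2.2 hP.le_snd rfl hcP
  have hPP : dot (k, l) P' = dot (k, l) P :=
    le_antisymm (hP'.le_fst P (supp_of_pair_ne_zero hcP)) (hP.le_snd P' (supp_of_pair_ne_zero hcP'))
  have hface : ∀ R, R ∈ face (k, l) (β + 1) ↔ dot (k, l) R = dot (k, l) P := fun R => by
    rw [mem_face hk hl, hβ]
  set F := sumPoly (face (k, l) (β + 1)) (pair (k, l) A B) (dot (k - v, l - u)) with hF
  have hinj : ∀ R ∈ face (k, l) (β + 1), ∀ R' ∈ face (k, l) (β + 1),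
      dot (k - v, l - u) R = dot (k - v, l - u) R' → R = R' := fun R hR R' hR' hRR =>
    hV.eq_of_dot hRR (((hface R).mp hR).trans ((hface R').mp hR').symm)
  have hFP : F.coeff (dot (k - v, l - u) P) ≠ 0 := by
    rw [hF, coeff_sumPoly hinj ((hface P).mpr rfl)]; exact hcP
  have hFP' : F.coeff (dot (k - v, l - u) P') ≠ 0 := by
    rw [hF, coeff_sumPoly hinj ((hface P').mpr hPP)]; exact hcP'
  obtain ⟨a, N, ha, hFa⟩ := h.principal_polynomial hk hl hV hg (F := F)
    (fun h0 => hFP (by rw [h0, Polynomial.coeff_zero]))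
    (fun x => by rw [hF, eval_sumPoly, hg.strict.restrict_snd hω hk hl])
  obtain ⟨hdeg, htop⟩ := coeff_prod_one_sub c Finset.univ
  rw [Finset.card_univ, Fintype.card_fin] at hdeg htop
  set G := ∏ i, (1 - Polynomial.C (c i) * Polynomial.X) with hG
  have hG0 : G.coeff 0 = 1 := by
    rw [Polynomial.coeff_zero_eq_eval_zero, hG, Polynomial.eval_prod]
    simp
  have hGn : G.coeff n ≠ 0 := by
    rw [htop]
    exact Finset.prod_ne_zero_iff.mpr fun i _ => neg_ne_zero.mpr (h.c_ne_zero i)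
  have hcoeff : ∀ j, F.coeff (j + N) = a * G.coeff j := fun j => by
    rw [hFa, mul_assoc, Polynomial.coeff_C_mul, Polynomial.coeff_X_pow_mul]
  have hcoeff' : ∀ j, j < N → F.coeff j = 0 := fun j hj => by
    rw [hFa, mul_assoc, Polynomial.coeff_C_mul, Polynomial.coeff_X_pow_mul', if_neg (by omega),
      mul_zero]
  -- The two neighbouring weights add up to `(k, l)`, so on the edge the least order along `(v, u)`
  -- is the greatest along `(k - v, l - u)`.
  have hsum : ∀ Q, dot (k - v, l - u) Q + dot (v, u) Q = dot (k, l) Q := fun Q => by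
    simp only [dot]
    zify [hu, hv]
    ring
  have hN : dot (k - v, l - u) P = N := by
    refine le_antisymm ?_ ?_
    · have h1 := hcoeff 0
      rw [hG0, mul_one, zero_add] at h1
      obtain ⟨Q, -, hQ2, hQ3⟩ := exists_of_coeff_sumPoly_ne_zero (j := N) (by
        rw [← hF, h1]; exact ha)
      rw [← hQ3]
      exact hP.le_fst Q (supp_of_pair_ne_zero hQ2)
    · by_contra! h1
      exact hFP (hcoeff' _ h1)
  have hN' : dot (k - v, l - u) P' = N + n := by
    refine le_antisymm ?_ ?_
    · by_contra! h1
      obtain ⟨j, hj⟩ := Nat.exists_eq_add_of_le (show N ≤ dot (k - v, l - u) P' by omega)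
      rw [hj, add_comm, hcoeff, Polynomial.coeff_eq_zero_of_natDegree_lt (by omega),
        mul_zero] at hFP'
      exact hFP' rfl
    · obtain ⟨Q, hQ1, hQ2, hQ3⟩ := exists_of_coeff_sumPoly_ne_zero (j := n + N) (by
        rw [← hF, hcoeff]; exact mul_ne_zero ha hGn)
      have h1 := hP'.le_snd Q (supp_of_pair_ne_zero hQ2)
      have h2 := hsum Q
      have h3 := hsum P'
      have h4 := (hface Q).mp hQ1
      omega
  have hpos : P = initialExp k l n ε₀ εinf 0 ∧ P' = initialExp k l n ε₀ εinf n := by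
    have h1 : P'.1 = P.1 + l * n := by
      have e1 : dot (k - v, l - u) P' = dot (k - v, l - u) P + n := by omega
      simp only [dot, Unimodular] at e1 hPP hV
      zify at e1 hPP hV ⊢
      linear_combination (l : ℤ) * e1 - ((l - u : ℕ) : ℤ) * hPP - ((P'.1 : ℤ) - P.1) * hV
    have h2 : P.2 = P'.2 + k * n := by
      have e1 : dot (k - v, l - u) P' = dot (k - v, l - u) P + n := by omega
      simp only [dot, Unimodular] at e1 hPP hV
      zify at e1 hPP hV ⊢
      linear_combination (k : ℤ) * e1 - ((k - v : ℕ) : ℤ) * hPP + ((P'.2 : ℤ) - P.2) * hV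
    constructor
    · ext <;> simp only [initialExp, mul_zero, add_zero, Nat.sub_zero] <;> omega
    · ext <;> simp only [initialExp, mul_zero, add_zero, Nat.sub_self] <;> omega
  obtain ⟨rfl, rfl⟩ := hpos
  have hdm : dot (k, l) (initialExp k l n ε₀ εinf 0) = d := by
    rw [dot_initialExp (Nat.zero_le n), hd]
  -- The two vertex inequalities confine the support of weight `d` to the segment between the
  -- vertices, and unimodularity lists its lattice points.
  have hmem : ∀ Q, (A Q ≠ 0 ∨ B Q ≠ 0) → dot (k, l) Q = d →
      ∃ r ≤ n, Q = initialExp k l n ε₀ εinf r := by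
    intro Q hQ hQd
    have h1 := hP.le_fst Q hQ
    have h2 := hP'.le_snd Q hQ
    have h3 := hsum Q
    have h4 := hsum (initialExp k l n ε₀ εinf n)
    obtain ⟨r, hr⟩ := Nat.exists_eq_add_of_le h1
    have hrn : r ≤ n := by omega
    refine ⟨r, hrn, hV.eq_of_dot ?_ ?_⟩
    · rw [dot_initialExp_right hV hrn, hr]
    · rw [dot_initialExp hrn, hQd, hd]
  refine ⟨a, ha, fun Q hQ => hdm ▸ hP.le_snd Q hQ, hmem, ?_⟩
  refine mul_left_cancel₀ (pow_ne_zero N Polynomial.X_ne_zero) (Eq.trans ?_ (Eq.trans hFa ?_))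
  · ext j
    rw [hF, sumPoly, Finset.mul_sum, Polynomial.finsetSum_coeff, Polynomial.finsetSum_coeff, hβ,
      hdm]
    rw [sum_face_initialExp hmem hk hl hd]
    · refine Finset.sum_congr rfl fun r hr => ?_
      have hr' : r ≤ n := Nat.lt_succ_iff.mp (Finset.mem_range.mp hr)
      rw [dot_initialExp_right hV hr', hN, pow_add]
      congr 1
      ring
    · intro Q h1 h2
      simp [pair, h1, h2]
  · ring

/-! ### Quasi-homogeneous components in terms of the logarithmic coefficients -/

theorem LogCoeffs.qhPart_radial {ω : Form} {A B : ℕ × ℕ → ℂ} (hω : LogCoeffs ω A B) {k l : ℕ}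
    (hk : 0 < k) (hl : 0 < l) (m : ℕ) (z : ℂ × ℂ) :
    qhPart k l m (radial k l ω) z =
      ∑ P ∈ face (k, l) m, pair (k, l) A B P * (z.1 ^ P.1 * z.2 ^ P.2) := by
  refine Eq.trans ?_ ((hω.fst.linear_comb hω.snd k l).iteratedDeriv_curve hk hl 0 m
    (face (k, l) m) (fun P => mem_face hk hl) z)
  simp only [qhPart, radial, pow_zero, one_mul, mul_assoc]

theorem LogCoeffs.fst_mul_formPart {ω : Form} {A B : ℕ × ℕ → ℂ} (hω : LogCoeffs ω A B) {k l : ℕ}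
    (hk : 0 < k) (hl : 0 < l) (m : ℕ) (z : ℂ × ℂ) :
    z.1 * (formPart k l m ω z).1 = ∑ P ∈ face (k, l) m, A P * (z.1 ^ P.1 * z.2 ^ P.2) := by
  rw [← hω.fst.iteratedDeriv_curve hk hl 0 m (face (k, l) m) (fun P => mem_face hk hl) z,
    formPart, ← mul_div_assoc, ← iteratedDeriv_const_mul_field]
  congr 2
  funext t
  ring

theorem LogCoeffs.snd_mul_formPart {ω : Form} {A B : ℕ × ℕ → ℂ} (hω : LogCoeffs ω A B) {k l : ℕ}
    (hk : 0 < k) (hl : 0 < l) (m : ℕ) (z : ℂ × ℂ) :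
    z.2 * (formPart k l m ω z).2 = ∑ P ∈ face (k, l) m, B P * (z.1 ^ P.1 * z.2 ^ P.2) := by
  rw [← hω.snd.iteratedDeriv_curve hk hl 0 m (face (k, l) m) (fun P => mem_face hk hl) z,
    formPart, ← mul_div_assoc, ← iteratedDeriv_const_mul_field]
  congr 2
  funext t
  ring

/-- The logarithmic identities determine the components only off the axes; shifting back to the
Taylor coefficients of `ω` itself gives vanishing on the axes too. -/
theorem LogCoeffs.formPart_eq_zero {ω : Form} {A B : ℕ × ℕ → ℂ} (hω : LogCoeffs ω A B)
    (han : AnalyticAt ℂ ω 0) {k l : ℕ} (hk : 0 < k) (hl : 0 < l) {m : ℕ}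
    (h : ∀ P, dot (k, l) P = m → A P = 0 ∧ B P = 0) (z : ℂ × ℂ) : formPart k l m ω z = 0 := by
  obtain ⟨a, ha⟩ := exists_hasCoeffs (f := fun z => (ω z).1) (analyticAt_fst.comp han)
  obtain ⟨b, hb⟩ := exists_hasCoeffs (f := fun z => (ω z).2) (analyticAt_snd.comp han)
  have hA := (ha.monomial_mul 1 0).unique hω.fst (Eventually.of_forall fun z => by ring)
  have hB := (hb.monomial_mul 0 1).unique hω.snd (Eventually.of_forall fun z => by ring)
  have hinj : ∀ i j : ℕ, Function.Injective fun p : ℕ × ℕ => (p.1 + i, p.2 + j) :=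
    fun i j p q hpq => by
      simp only [Prod.mk.injEq, add_left_inj] at hpq
      exact Prod.ext hpq.1 hpq.2
  have ha' : ∀ p : ℕ × ℕ, a p = A (p.1 + 1, p.2 + 0) := fun p => by
    rw [← hA]
    exact ((hinj 1 0).extend_apply a 0 p).symm
  have hb' : ∀ p : ℕ × ℕ, b p = B (p.1 + 0, p.2 + 1) := fun p => by
    rw [← hB]
    exact ((hinj 0 1).extend_apply b 0 p).symm
  have hT : ∀ e (p : ℕ × ℕ), p ∈ (Finset.range (m + 1) ×ˢ Finset.range (m + 1)).filter
      (fun p => k * p.1 + l * p.2 + e = m) ↔ k * p.1 + l * p.2 + e = m := fun e p => by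
    rw [Finset.mem_filter, Finset.mem_product, Finset.mem_range, Finset.mem_range,
      and_iff_right_iff_imp]
    intro hp
    have := Nat.le_mul_of_pos_left p.1 hk
    have := Nat.le_mul_of_pos_left p.2 hl
    omega
  refine Prod.ext ((ha.iteratedDeriv_curve hk hl k m _ (hT k) z).trans ?_)
    ((hb.iteratedDeriv_curve hk hl l m _ (hT l) z).trans ?_)
  · refine Finset.sum_eq_zero fun p hp => ?_
    rw [ha', (h _ ?_).1, zero_mul]
    rw [← (hT k p).mp hp, dot]
    ring
  · refine Finset.sum_eq_zero fun p hp => ?_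
    rw [hb', (h _ ?_).2, zero_mul]
    rw [← (hT l p).mp hp, dot]
    ring

/-! ### The polynomials of the initial part -/

/-- The polynomial `Σ g r X ^ r`. -/
noncomputable def edgePoly (n : ℕ) (g : ℕ → ℂ) : Polynomial ℂ :=
  ∑ r ∈ Finset.range (n + 1), Polynomial.C (g r) * Polynomial.X ^ r

theorem eval_edgePoly (n : ℕ) (g : ℕ → ℂ) (x : ℂ) :
    (edgePoly n g).eval x = ∑ r ∈ Finset.range (n + 1), g r * x ^ r := by
  simp [edgePoly, Polynomial.eval_finsetSum]

theorem coeff_edgePoly {n : ℕ} (g : ℕ → ℂ) {r : ℕ} (hr : r ≤ n) :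
    (edgePoly n g).coeff r = g r := by
  rw [edgePoly, Polynomial.finsetSum_coeff, Finset.sum_eq_single r]
  · simp
  · intro j _ hj
    rw [Polynomial.coeff_C_mul_X_pow, if_neg (Ne.symm hj)]
  · exact fun h => absurd (Finset.mem_range.mpr (Nat.lt_succ_of_le hr)) h

theorem natDegree_edgePoly_le (n : ℕ) (g : ℕ → ℂ) : (edgePoly n g).natDegree ≤ n := by
  refine Polynomial.natDegree_sum_le_of_forall_le _ _ fun r hr => ?_
  exact (Polynomial.natDegree_C_mul_X_pow_le _ _).trans
    (Nat.lt_succ_iff.mp (Finset.mem_range.mp hr))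

/-- Homogenization. -/
theorem sum_mul_pow_mul_pow (n : ℕ) (g : ℕ → ℂ) (x : ℂ) {y : ℂ} (hy : y ≠ 0) :
    ∑ r ∈ Finset.range (n + 1), g r * (x ^ r * y ^ (n - r)) =
      y ^ n * (edgePoly n g).eval (x / y) := by
  rw [eval_edgePoly, Finset.mul_sum]
  refine Finset.sum_congr rfl fun r hr => ?_
  obtain ⟨q, rfl⟩ := Nat.exists_eq_add_of_le (Nat.lt_succ_iff.mp (Finset.mem_range.mp hr))
  rw [Nat.add_sub_cancel_left, div_pow, pow_add]
  field_simp

theorem sum_mul_pow_mul_pow_eq_prod {n : ℕ} {g : ℕ → ℂ} {c : Fin n → ℂ} {c₀ : ℂ}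
    (h : edgePoly n g = Polynomial.C c₀ * ∏ i, (1 - Polynomial.C (c i) * Polynomial.X)) (x y : ℂ) :
    ∑ r ∈ Finset.range (n + 1), g r * (x ^ r * y ^ (n - r)) = c₀ * ∏ i, (y - c i * x) := by
  -- For `y = 0` the quotient `x / y` is unavailable; only the leading coefficient survives, and the
  -- two sides are compared through it.
  by_cases hy : y = 0
  · subst hy
    have htop := (coeff_prod_one_sub c Finset.univ).2
    rw [Finset.card_univ, Fintype.card_fin] at htop
    have hn := congrArg (fun F => Polynomial.coeff F n) h
    simp only [Polynomial.coeff_C_mul, htop, coeff_edgePoly g le_rfl] at hn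
    rw [Finset.sum_eq_single n]
    · rw [hn, Nat.sub_self, pow_zero, mul_one]
      simp only [zero_sub, ← neg_mul]
      rw [Finset.prod_mul_distrib, Finset.prod_const, Finset.card_univ, Fintype.card_fin]
      ring
    · intro r hr hrn
      have := Finset.mem_range.mp hr
      rw [zero_pow (by omega), mul_zero, mul_zero]
    · exact fun h => absurd (Finset.self_mem_range_succ n) h
  · rw [sum_mul_pow_mul_pow n g x hy, h, Polynomial.eval_mul, Polynomial.eval_C,
      Polynomial.eval_prod, mul_left_comm]
    congr 1
    have e : y ^ n = ∏ _i : Fin n, y := by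
      rw [Finset.prod_const, Finset.card_univ, Fintype.card_fin]
    rw [e, ← Finset.prod_mul_distrib]
    refine Finset.prod_congr rfl fun i _ => ?_
    simp only [Polynomial.eval_sub, Polynomial.eval_one, Polynomial.eval_mul, Polynomial.eval_C,
      Polynomial.eval_X]
    field_simp

/-- The Camacho–Sad index at a simple zero of the contraction. -/
theorem IsStrictTransformWith.indexY_mul_eval {ω : Form} {V W : ℕ × ℕ} {η : Form} {α β : ℕ}
    (hη : IsStrictTransformWith ω V W η α β) (hVW : Unimodular V W) {A B : ℕ × ℕ → ℂ}
    (hω : LogCoeffs ω A B) (hW1 : 0 < W.1) (hW2 : 0 < W.2) {m : ℕ} (hm : HasOrder A B W m)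
    {Q R H : Polynomial ℂ} {N : ℕ}
    (hQ : ∀ x, ∑ P ∈ face W m, pair W A B P * x ^ dot V P = x ^ N * Q.eval x)
    (hR : ∀ x, ∑ P ∈ face W m, pair V A B P * x ^ dot V P = x ^ N * R.eval x) {p : ℂ}
    (hQH : Polynomial.X * Q = (Polynomial.X - Polynomial.C p) * H) (hH : H.eval p ≠ 0) :
    indexY η p * H.eval p = -R.eval p := by
  have key : indexY η p = -(R.eval p / H.eval p) := by
    refine hη.indexY_eq hVW hω hW1 hW2 hm (g := fun x => R.eval x / H.eval x) ?_ ?_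
    · exact (AnalyticOnNhd.eval_polynomial R p (Set.mem_univ p)).div
        (AnalyticOnNhd.eval_polynomial H p (Set.mem_univ p)) hH
    · filter_upwards [self_mem_nhdsWithin,
        (H.continuous.continuousAt.eventually_ne hH).filter_mono nhdsWithin_le_nhds] with x hxp hx
      have hx' : x - p ≠ 0 := sub_ne_zero.mpr hxp
      have h1 := congrArg (Polynomial.eval x) hQH
      simp only [Polynomial.eval_mul, Polynomial.eval_sub, Polynomial.eval_X,
        Polynomial.eval_C] at h1
      have h2 : x * Q.eval x ≠ 0 := h1 ▸ mul_ne_zero hx' hx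
      have hx0 := left_ne_zero_of_mul h2
      rw [hQ, hR]
      refine ⟨hx0, mul_ne_zero (pow_ne_zero _ hx0) (right_ne_zero_of_mul h2), ?_⟩
      field_simp
      linear_combination -R.eval x * h1
  rw [key]
  field_simp

/-- Partial fractions. -/
theorem eq_of_residues {n : ℕ} {c : Fin n → ℂ} (hc0 : ∀ i, c i ≠ 0)
    (hc : Function.Injective c) {R : Polynomial ℂ} (hR : R.natDegree ≤ n) {lam : Fin n → ℂ}
    {lam₀ c₀ : ℂ} (h0 : R.eval 0 = -(lam₀ * c₀))
    (hi : ∀ i, R.eval (1 / c i) =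
      lam i * (c₀ * ∏ j ∈ Finset.univ.erase i, (1 - c j * (1 / c i)))) :
    R = Polynomial.C (-lam₀ * c₀) * ∏ i, (1 - Polynomial.C (c i) * Polynomial.X) +
      ∑ i, Polynomial.C (lam i * c i * c₀) * Polynomial.X *
        ∏ j ∈ Finset.univ.erase i, (1 - Polynomial.C (c j) * Polynomial.X) := by
  rw [← sub_eq_zero]
  -- The difference has degree at most `n` and vanishes at the `n + 1` points `0` and `1 / c i`.
  refine Polynomial.eq_zero_of_natDegree_lt_card_of_eval_eq_zero _
    (f := fun i : Option (Fin n) => i.elim 0 fun i => 1 / c i) ?_ ?_ ?_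
  · rintro (_ | i) (_ | j) hij
    · rfl
    · exact absurd hij.symm (one_div_ne_zero (hc0 j))
    · exact absurd hij (one_div_ne_zero (hc0 i))
    · exact congrArg some (hc (by simpa using hij))
  · rintro (_ | i)
    · simp [Polynomial.eval_finsetSum, Polynomial.eval_prod, h0]
    · simp only [Option.elim, Polynomial.eval_sub, Polynomial.eval_add, Polynomial.eval_mul,
        Polynomial.eval_C, Polynomial.eval_finsetSum, Polynomial.eval_prod, Polynomial.eval_X,
        Polynomial.eval_one, hi]
      have hci := hc0 i
      rw [Finset.prod_eq_zero (Finset.mem_univ i) (by field_simp; ring), Finset.sum_eq_single i]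
      · field_simp
        ring
      · intro j _ hj
        rw [Finset.prod_eq_zero (Finset.mem_erase.mpr ⟨Ne.symm hj, Finset.mem_univ i⟩)
          (by field_simp; ring), mul_zero]
      · exact fun h => absurd (Finset.mem_univ i) h
  · rw [Fintype.card_option, Fintype.card_fin, Nat.lt_succ_iff]
    have hd : ∀ s : Finset (Fin n),
        (∏ i ∈ s, (1 - Polynomial.C (c i) * Polynomial.X)).natDegree ≤ s.card :=
      fun s => (coeff_prod_one_sub c s).1
    refine (Polynomial.natDegree_sub_le _ _).trans (max_le hR
      ((Polynomial.natDegree_add_le _ _).trans (max_le ?_ ?_)))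
    · refine (Polynomial.natDegree_C_mul_le _ _).trans ((hd _).trans ?_)
      simp
    · refine Polynomial.natDegree_sum_le_of_forall_le _ _ fun i _ => ?_
      refine Polynomial.natDegree_mul_le.trans ?_
      have h1 := hd (Finset.univ.erase i)
      rw [Finset.card_erase_of_mem (Finset.mem_univ i), Finset.card_univ, Fintype.card_fin] at h1
      have h2 : (Polynomial.C (lam i * c i * c₀) * Polynomial.X).natDegree ≤ 1 := by
        compute_degree
      have := i.pos
      omega

/-- The leading coefficient plays the part of the value at infinity: it brings in the sum of the
residues at the finite points. -/
theorem coeff_residues {n : ℕ} (c lam : Fin n → ℂ) (lam₀ c₀ : ℂ) :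
    (Polynomial.C (-lam₀ * c₀) * ∏ i, (1 - Polynomial.C (c i) * Polynomial.X) +
      ∑ i, Polynomial.C (lam i * c i * c₀) * Polynomial.X *
        ∏ j ∈ Finset.univ.erase i, (1 - Polynomial.C (c j) * Polynomial.X)).coeff n =
    (-lam₀ - ∑ i, lam i) * (c₀ * ∏ i, (-c i)) := by
  have h1 := (coeff_prod_one_sub c Finset.univ).2
  rw [Finset.card_univ, Fintype.card_fin] at h1
  rw [Polynomial.coeff_add, Polynomial.coeff_C_mul, h1, Polynomial.finsetSum_coeff, sub_mul,
    Finset.sum_mul, sub_eq_add_neg, ← Finset.sum_neg_distrib]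
  congr 1
  · ring
  · refine Finset.sum_congr rfl fun i _ => ?_
    have h2 := (coeff_prod_one_sub c (Finset.univ.erase i)).2
    rw [Finset.card_erase_of_mem (Finset.mem_univ i), Finset.card_univ, Fintype.card_fin] at h2
    obtain ⟨n, rfl⟩ : ∃ m, n = m + 1 := Nat.exists_eq_succ_of_ne_zero i.pos.ne'
    rw [mul_assoc, Polynomial.coeff_C_mul, Polynomial.coeff_X_mul]
    rw [Nat.add_sub_cancel] at h2
    rw [h2, ← Finset.mul_prod_erase _ _ (Finset.mem_univ i)]
    ring

theorem eval_residues {n : ℕ} (c lam : Fin n → ℂ) (lam₀ c₀ : ℂ) {x : ℂ}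
    (hx : ∀ i, 1 - c i * x ≠ 0) :
    (Polynomial.C (-lam₀ * c₀) * ∏ i, (1 - Polynomial.C (c i) * Polynomial.X) +
      ∑ i, Polynomial.C (lam i * c i * c₀) * Polynomial.X *
        ∏ j ∈ Finset.univ.erase i, (1 - Polynomial.C (c j) * Polynomial.X)).eval x =
    (-lam₀ + ∑ i, lam i * (c i * x / (1 - c i * x))) *
      (Polynomial.C c₀ * ∏ i, (1 - Polynomial.C (c i) * Polynomial.X)).eval x := by
  simp only [Polynomial.eval_add, Polynomial.eval_mul, Polynomial.eval_C, Polynomial.eval_prod,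
    Polynomial.eval_sub, Polynomial.eval_one, Polynomial.eval_X, Polynomial.eval_finsetSum]
  rw [add_mul, Finset.sum_mul]
  congr 1
  · ring
  · refine Finset.sum_congr rfl fun i _ => ?_
    rw [← Finset.mul_prod_erase _ _ (Finset.mem_univ i)]
    have := hx i
    field_simp

/-! ### Camacho–Sad indices read on the edge -/

theorem InitialPart.hasOrder {k l n ε₀ εinf d : ℕ} {c : Fin n → ℂ} {A B : ℕ × ℕ → ℂ} {c₀ : ℂ}
    (h : InitialPart k l n ε₀ εinf d c A B c₀) (hd : d = n * k * l + k * ε₀ + l * εinf) :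
    HasOrder A B (k, l) d := by
  refine ⟨h.le, _, (dot_initialExp (Nat.zero_le n)).trans hd.symm, ?_⟩
  have h1 := congrArg (fun F => Polynomial.coeff F 0) h.contraction
  have h2 := coeff_edgePoly (n := n) (fun r => pair (k, l) A B (initialExp k l n ε₀ εinf r))
    (Nat.zero_le n)
  rw [← h2]
  refine ne_of_eq_of_ne h1 ?_
  simp [Polynomial.coeff_zero_eq_eval_zero, Polynomial.eval_prod, h.ne_zero]

theorem HasOrder.dual {A B : ℕ × ℕ → ℂ} {W : ℕ × ℕ} {m : ℕ} (h : HasOrder A B W m) :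
    HasOrder (fun p => B p.swap) (fun p => A p.swap) W.swap m := by
  obtain ⟨P, h1, h2⟩ := h.exists_ne
  have e : ∀ Q : ℕ × ℕ, dot W.swap Q = dot W Q.swap := fun Q => by
    simp only [dot, Prod.fst_swap, Prod.snd_swap, add_comm]
  refine ⟨fun Q hQ => e Q ▸ h.le Q.swap hQ.symm, P.swap, ?_, ?_⟩
  · rw [e, Prod.swap_swap, h1]
  · simpa only [pair, Prod.fst_swap, Prod.snd_swap, Prod.swap_swap, add_comm] using h2

theorem sum_face_swap {W : ℕ × ℕ} (hW1 : 0 < W.1) (hW2 : 0 < W.2) (m : ℕ) (g : ℕ × ℕ → ℂ) :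
    ∑ P ∈ face W.swap m, g P = ∑ P ∈ face W m, g P.swap := by
  refine Finset.sum_equiv (Equiv.prodComm ℕ ℕ) (fun P => ?_) fun P _ => ?_
  · rw [mem_face hW2 hW1, mem_face hW1 hW2]
    simp only [dot, Prod.fst_swap, Prod.snd_swap, Equiv.prodComm_apply, add_comm]
  · simp

theorem InitialPart.sum_face {k l n ε₀ εinf d : ℕ} {c : Fin n → ℂ} {A B : ℕ × ℕ → ℂ} {c₀ : ℂ}
    (h : InitialPart k l n ε₀ εinf d c A B c₀) (hk : 0 < k) (hl : 0 < l)
    (hd : d = n * k * l + k * ε₀ + l * εinf) {V : ℕ × ℕ} (hV : Unimodular V (k, l))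
    (V' : ℕ × ℕ) (x : ℂ) :
    ∑ P ∈ face (k, l) d, pair V' A B P * x ^ dot V P =
      x ^ dot V (initialExp k l n ε₀ εinf 0) *
        (edgePoly n fun r => pair V' A B (initialExp k l n ε₀ εinf r)).eval x := by
  rw [sum_face_initialExp h.mem hk hl hd (fun Q h1 h2 => by simp [pair, h1, h2]), eval_edgePoly,
    Finset.mul_sum]
  refine Finset.sum_congr rfl fun r hr => ?_
  rw [dot_initialExp_right hV (Nat.lt_succ_iff.mp (Finset.mem_range.mp hr)), pow_add]
  ring

theorem InitialPart.sum_face_dual {k l n ε₀ εinf d : ℕ} {c : Fin n → ℂ} {A B : ℕ × ℕ → ℂ} {c₀ : ℂ}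
    (h : InitialPart k l n ε₀ εinf d c A B c₀) (hk : 0 < k) (hl : 0 < l)
    (hd : d = n * k * l + k * ε₀ + l * εinf) {U : ℕ × ℕ} (hU : Unimodular (k, l) U)
    (V' : ℕ × ℕ) (x : ℂ) :
    ∑ P ∈ face (l, k) d, pair V'.swap (fun p => B p.swap) (fun p => A p.swap) P *
        x ^ dot U.swap P =
      x ^ dot U (initialExp k l n ε₀ εinf n) *
        (edgePoly n fun r => pair V' A B (initialExp k l n ε₀ εinf (n - r))).eval x := by
  refine (sum_face_swap (W := (k, l)) hk hl d (fun P => pair V'.swap (fun p => B p.swap) (fun p => A p.swap) P *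
        x ^ dot U.swap P)).trans ?_
  rw [sum_face_initialExp h.mem hk hl hd (fun Q h1 h2 => by simp [pair, h1, h2]), eval_edgePoly,
    Finset.mul_sum, ← Finset.sum_range_reflect]
  refine Finset.sum_congr rfl fun r hr => ?_
  have hr' : r ≤ n := Nat.lt_succ_iff.mp (Finset.mem_range.mp hr)
  have e : n + 1 - 1 - r = n - r := by omega
  have e1 : ∀ P : ℕ × ℕ, dot U.swap P.swap = dot U P := fun P => by
    simp only [dot, Prod.fst_swap, Prod.snd_swap, add_comm]
  have e2 : ∀ P : ℕ × ℕ, pair V'.swap (fun p => B p.swap) (fun p => A p.swap) P.swap =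
      pair V' A B P := fun P => by
    simp only [pair, Prod.fst_swap, Prod.snd_swap, Prod.swap_swap, add_comm]
  rw [e, e1, e2, dot_initialExp_left hU (Nat.sub_le n r), pow_add]
  have e3 : n - (n - r) = r := by omega
  rw [e3]
  ring

/-- The Camacho–Sad indices along the principal component in terms of the initial part. -/
theorem InitialPart.indices {k l n ε₀ εinf d : ℕ} {c : Fin n → ℂ} {A B : ℕ × ℕ → ℂ} {c₀ : ℂ}
    (h : InitialPart k l n ε₀ εinf d c A B c₀) (hk : 0 < k) (hl : 0 < l)
    (hd : d = n * k * l + k * ε₀ + l * εinf) (hc0 : ∀ i, c i ≠ 0) (hc : Function.Injective c)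
    {ω : Form} (hω : LogCoeffs ω A B) {V : ℕ × ℕ} (hV : Unimodular V (k, l)) {η : Form}
    (hη : IsStrictTransform ω V (k, l) η) :
    edgePoly n (fun r => pair V A B (initialExp k l n ε₀ εinf r)) =
      Polynomial.C (-indexY η 0 * c₀) * ∏ i, (1 - Polynomial.C (c i) * Polynomial.X) +
      ∑ i, Polynomial.C (indexY η (1 / c i) * c i * c₀) * Polynomial.X *
        ∏ j ∈ Finset.univ.erase i, (1 - Polynomial.C (c j) * Polynomial.X) := by
  obtain ⟨α, β, hη : IsStrictTransformWith ω V (k, l) η α β⟩ := hη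
  have key := fun p H => hη.indexY_mul_eval hV hω hk hl (h.hasOrder hd) (p := p) (H := H)
    (h.sum_face hk hl hd hV (k, l)) (h.sum_face hk hl hd hV V)
  have hQ : edgePoly n (fun r => pair (k, l) A B (initialExp k l n ε₀ εinf r)) =
    Polynomial.C c₀ * ∏ i, (1 - Polynomial.C (c i) * Polynomial.X) := h.contraction
  simp only [hQ] at key
  refine eq_of_residues hc0 hc (natDegree_edgePoly_le _ _) ?_ fun i => ?_
  · have h1 := key 0 _ (by rw [Polynomial.C_0, sub_zero])
      (by simp [Polynomial.eval_prod, h.ne_zero])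
    simp only [Polynomial.eval_mul, Polynomial.eval_C, Polynomial.eval_prod, Polynomial.eval_sub,
      Polynomial.eval_one, Polynomial.eval_X, mul_zero, sub_zero, Finset.prod_const_one,
      mul_one] at h1
    linear_combination h1
  · have hci := hc0 i
    -- This is `X Q` divided by `X - 1 / c i`, using `1 - c i X = -c i (X - 1 / c i)`.
    have h1 := key (1 / c i) (Polynomial.X * (Polynomial.C c₀ * (Polynomial.C (-c i) *
      ∏ j ∈ Finset.univ.erase i, (1 - Polynomial.C (c j) * Polynomial.X)))) (by
        have : Polynomial.C (c i) * Polynomial.C (1 / c i) = 1 := by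
          rw [← Polynomial.C_mul, mul_one_div_cancel hci, Polynomial.C_1]
        rw [← Finset.mul_prod_erase _ _ (Finset.mem_univ i), Polynomial.C_neg]
        linear_combination (-Polynomial.X * Polynomial.C c₀ *
          ∏ j ∈ Finset.univ.erase i, (1 - Polynomial.C (c j) * Polynomial.X)) * this) (by
        simp only [Polynomial.eval_mul, Polynomial.eval_C, Polynomial.eval_prod,
          Polynomial.eval_sub, Polynomial.eval_one, Polynomial.eval_X]
        refine mul_ne_zero (one_div_ne_zero hci) (mul_ne_zero h.ne_zero
          (mul_ne_zero (neg_ne_zero.mpr hci) (Finset.prod_ne_zero_iff.mpr fun j hj => ?_)))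
        have hji : c j ≠ c i := fun e => (Finset.mem_erase.mp hj).1 (hc e)
        rw [mul_one_div, sub_ne_zero, ne_comm, Ne, div_eq_one_iff_eq hci]
        exact hji)
    simp only [Polynomial.eval_mul, Polynomial.eval_C, Polynomial.eval_prod, Polynomial.eval_sub,
      Polynomial.eval_one, Polynomial.eval_X] at h1
    have h2 : 1 / c i * c i = 1 := one_div_mul_cancel hci
    linear_combination h1 + (indexY η (1 / c i) * c₀ *
      ∏ j ∈ Finset.univ.erase i, (1 - c j * (1 / c i))) * h2

/-- After exchanging the coordinates the point at infinity becomes the origin of a chart where the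
principal component is `y = 0`, and the edge is read from its other end, `r ↦ n - r`. -/
theorem InitialPart.index_infinity {k l n ε₀ εinf d : ℕ} {c : Fin n → ℂ} {A B : ℕ × ℕ → ℂ} {c₀ : ℂ}
    (h : InitialPart k l n ε₀ εinf d c A B c₀) (hk : 0 < k) (hl : 0 < l)
    (hd : d = n * k * l + k * ε₀ + l * εinf) (hc0 : ∀ i, c i ≠ 0)
    {ω : Form} (hω : LogCoeffs ω A B) {U : ℕ × ℕ} (hU : Unimodular (k, l) U) {η : Form}
    (hη : IsStrictTransform ω (k, l) U η) :
    pair (k, l) A B (initialExp k l n ε₀ εinf n) = c₀ * ∏ i, (-c i) ∧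
    indexX η 0 * pair (k, l) A B (initialExp k l n ε₀ εinf n) =
      -pair U A B (initialExp k l n ε₀ εinf n) := by
  have htop := (coeff_prod_one_sub c Finset.univ).2
  rw [Finset.card_univ, Fintype.card_fin] at htop
  have h1 := congrArg (fun F => Polynomial.coeff F n) h.contraction
  have h2 := coeff_edgePoly (fun r => pair (k, l) A B (initialExp k l n ε₀ εinf r)) (le_refl n)
  have hn : pair (k, l) A B (initialExp k l n ε₀ εinf n) = c₀ * ∏ i, (-c i) := by
    rw [← h2, ← htop, ← Polynomial.coeff_C_mul]
    exact h1
  refine ⟨hn, ?_⟩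
  obtain ⟨α, β, hη : IsStrictTransformWith ω (k, l) U η α β⟩ := hη
  have hU' : Unimodular U.swap (l, k) := by
    simp only [Unimodular, Prod.fst_swap, Prod.snd_swap] at hU ⊢
    linarith
  have ev : ∀ V' : ℕ × ℕ,
      (edgePoly n fun r => pair V' A B (initialExp k l n ε₀ εinf (n - r))).eval 0 =
        pair V' A B (initialExp k l n ε₀ εinf n) := fun V' => by
    rw [← Polynomial.coeff_zero_eq_eval_zero, coeff_edgePoly _ (Nat.zero_le n), Nat.sub_zero]
  have key := hη.dual.indexY_mul_eval hU' hω.dual hl hk (h.hasOrder hd).dual (p := 0)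
    (h.sum_face_dual hk hl hd hU (k, l)) (h.sum_face_dual hk hl hd hU U)
    (by rw [Polynomial.C_0, sub_zero]) (by
      rw [ev, hn]
      exact mul_ne_zero h.ne_zero
        (Finset.prod_ne_zero_iff.mpr fun i _ => neg_ne_zero.mpr (hc0 i)))
  rwa [ev, ev] at key

/-! ### Logarithmic differentials and relations between the indices -/

theorem dlog_fst (z : ℂ × ℂ) (w : ℂ × ℂ) : dlog Prod.fst z w = z.1⁻¹ * w.1 := by
  simp [dlog, fderiv_fst]

theorem dlog_snd (z : ℂ × ℂ) (w : ℂ × ℂ) : dlog Prod.snd z w = z.2⁻¹ * w.2 := by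
  simp [dlog, fderiv_snd]

theorem dlog_cusp (k l : ℕ) (c : ℂ) (z w : ℂ × ℂ) :
    dlog (fun w => w.2 ^ k - c * w.1 ^ l) z w =
      (z.2 ^ k - c * z.1 ^ l)⁻¹ * (k * z.2 ^ (k - 1) * w.2 - c * (l * z.1 ^ (l - 1) * w.1)) := by
  have h1 : HasFDerivAt (fun w : ℂ × ℂ => w.2 ^ k - c * w.1 ^ l) _ z :=
    ((hasFDerivAt_snd (𝕜 := ℂ) (p := z)).pow k).sub
      (((hasFDerivAt_fst (𝕜 := ℂ) (p := z)).pow l).const_mul c)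
  rw [dlog, h1.fderiv]
  simp

/-- The relations satisfied by the Camacho–Sad indices. -/
theorem index_relations {k l u v ε₀ εinf : ℕ} (huv : k * u = l * v + 1) (hε₀ : ε₀ ≤ 1)
    (hεinf : εinf ≤ 1) {A₀ B₀ A₁ B₁ lam₀ laminf Λ Q₀ Q₁ : ℂ} (h : Q₀ ≠ 0) (h' : Q₁ ≠ 0)
    (hQ₀ : k * A₀ + l * B₀ = Q₀) (hQ₁ : k * A₁ + l * B₁ = Q₁)
    (hR₀ : (k - v) * A₀ + (l - u) * B₀ = -lam₀ * Q₀)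
    (hR₁ : (k - v) * A₁ + (l - u) * B₁ = (-lam₀ - Λ) * Q₁)
    (hinf : laminf * Q₁ = -(v * A₁ + u * B₁)) (hA : ε₀ = 0 → A₀ = 0) (hB : εinf = 0 → B₁ = 0) :
    ε₀ * (l * (lam₀ + 1) - u) = l * (lam₀ + 1) - u ∧
    k - v + k * lam₀ + k * Λ + εinf * (k * laminf + v) = 0 := by
  have e : (k : ℂ) * u = l * v + 1 := by exact_mod_cast huv
  constructor
  · interval_cases ε₀
    -- Without the branch `x = 0`, `A₀ = 0` forces `lam₀ = (u - l) / l`, so the residue along `x =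
    -- 0` vanishes by itself.
    · have hA' := hA rfl
      subst hA'
      refine mul_right_cancel₀ h ?_
      push_cast
      linear_combination (-l : ℂ) * hR₀ + (l - u : ℂ) * hQ₀
    · push_cast; ring
  · refine mul_right_cancel₀ h' ?_
    interval_cases εinf
    · have hB' := hB rfl
      subst hB'
      push_cast
      linear_combination (k : ℂ) * hR₁ - (k - v : ℂ) * hQ₁
    -- Here the relation is `k` times the Camacho–Sad formula: the indices add up to `-1`.
    · push_cast
      linear_combination (k : ℂ) * hR₁ - (k : ℂ) * hQ₁ + (k : ℂ) * hinf

end TQH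

/-! ### The initial form and the sum of the indices -/

theorem lemma2p5p1
    (k l u v n ε₀ εinf : ℕ) (hk : 0 < k) (hl : 0 < l) (hkl : Nat.Coprime k l)
    (huv : k * u = l * v + 1) (hu : u ≤ l) (hv : v ≤ k)
    (hn : 0 < n) (hε₀ : ε₀ ≤ 1) (hεinf : εinf ≤ 1)
    (s : Fin n → ℂ) (hs : ∀ i, s i ≠ 0) (hs_inj : Function.Injective s)
    (c : Fin n → ℂ) (ω : TQH.Form) (hω : TQH.MemQ k l u v n ε₀ εinf s c ω)
    -- strict transforms in the two charts that cover the principal component, which is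
    -- `{y = 0}` in the first one and `{x = 0}` in the second one
    (η ηinf : TQH.Form)
    (hη : TQH.IsStrictTransform ω (k - v, l - u) (k, l) η)
    (hηinf : TQH.IsStrictTransform ω (k, l) (v, u) ηinf)
    -- the Camacho–Sad indices along the principal component
    (lam : Fin n → ℂ) (lam₀ laminf : ℂ)
    (hlam : ∀ i, lam i = TQH.indexY η (1 / c i))
    (hlam₀ : lam₀ = TQH.indexY η 0)
    (hlaminf : laminf = TQH.indexX ηinf 0)
    (d : ℕ) (hd : d = n * k * l + k * ε₀ + l * εinf) :
    (∀ m < d, ∀ z : ℂ × ℂ, TQH.formPart k l m ω z = 0) ∧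
    (∃ c₀ : ℂ, c₀ ≠ 0 ∧ ∀ z : ℂ × ℂ,
      TQH.qhPart k l d (TQH.radial k l ω) z = c₀ * TQH.qhFun k l ε₀ εinf c z) ∧
    (∀ z : ℂ × ℂ, z.1 ≠ 0 → z.2 ≠ 0 → (∀ i, z.2 ^ k - c i * z.1 ^ l ≠ 0) →
      TQH.covector (TQH.formPart k l d ω z) =
        -TQH.qhPart k l d (TQH.radial k l ω) z •
          (∑ i, lam i • TQH.dlog (fun w => w.2 ^ k - c i * w.1 ^ l) z +
            ((ε₀ : ℂ) * ((l : ℂ) * (lam₀ + 1) - u)) • TQH.dlog Prod.fst z +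
            ((εinf : ℂ) * ((k : ℂ) * laminf + v)) • TQH.dlog Prod.snd z)) ∧
    ∑ i, lam i + (ε₀ : ℂ) * (lam₀ + ((l : ℂ) - u) / l) +
      (εinf : ℂ) * (laminf + (v : ℂ) / k) + 1 / ((k : ℂ) * l) = 0 := by
  have hV := TQH.unimodular_sub huv hu hv
  have hU : TQH.Unimodular (k, l) (v, u) := huv
  obtain ⟨A, B, hAB⟩ := (hω.sepHyp hk hl hV).exists_logCoeffs
  obtain ⟨c₀, h⟩ := hω.exists_initialPart hk hl huv hu hv hε₀ hεinf hd hAB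
  have hR := h.indices hk hl hd hω.c_ne_zero hω.c_injective hAB hV hη
  obtain ⟨hQ₁, hinf⟩ := h.index_infinity hk hl hd hω.c_ne_zero hAB hU hηinf
  simp only [← hlam, ← hlam₀, ← hlaminf] at hR hinf
  have hQ : TQH.edgePoly n (fun r => TQH.pair (k, l) A B (TQH.initialExp k l n ε₀ εinf r)) =
    Polynomial.C c₀ * ∏ i, (1 - Polynomial.C (c i) * Polynomial.X) := h.contraction
  have hQ₀ : TQH.pair (k, l) A B (TQH.initialExp k l n ε₀ εinf 0) = c₀ := by
    rw [← TQH.coeff_edgePoly (n := n)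
      (fun r => TQH.pair (k, l) A B (TQH.initialExp k l n ε₀ εinf r)) (Nat.zero_le n), hQ,
      Polynomial.coeff_zero_eq_eval_zero]
    simp [Polynomial.eval_prod]
  have hR₀ : TQH.pair (k - v, l - u) A B (TQH.initialExp k l n ε₀ εinf 0) = -lam₀ * c₀ := by
    rw [← TQH.coeff_edgePoly (n := n)
      (fun r => TQH.pair (k - v, l - u) A B (TQH.initialExp k l n ε₀ εinf r)) (Nat.zero_le n), hR,
      Polynomial.coeff_zero_eq_eval_zero]
    simp [Polynomial.eval_prod, Polynomial.eval_finsetSum]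
  have hR₁ : TQH.pair (k - v, l - u) A B (TQH.initialExp k l n ε₀ εinf n) =
      (-lam₀ - ∑ i, lam i) * (c₀ * ∏ i, (-c i)) := by
    rw [← TQH.coeff_residues, ← hR, TQH.coeff_edgePoly _ le_rfl]
  rw [hQ₁] at hinf
  have hne : c₀ * ∏ i, (-c i) ≠ 0 := mul_ne_zero h.ne_zero
    (Finset.prod_ne_zero_iff.mpr fun i _ => neg_ne_zero.mpr (hω.c_ne_zero i))
  have cV : ∀ P, TQH.pair (k - v, l - u) A B P = ((k : ℂ) - v) * A P + ((l : ℂ) - u) * B P :=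
    fun P => by simp only [TQH.pair, Nat.cast_sub hv, Nat.cast_sub hu]
  obtain ⟨h0, h1⟩ := TQH.index_relations huv hε₀ hεinf h.ne_zero hne hQ₀ hQ₁
    ((cV _).symm.trans hR₀) ((cV _).symm.trans hR₁) hinf
    -- When `ε₀ = 0` the first vertex has `x`-exponent zero, where the coefficients of `x a` vanish;
    -- the next argument is the mirror statement for `y b`.
    (fun e => by
      have := hAB.fst.coeff_snd_eq_zero (Eventually.of_forall fun x => zero_mul _)
        (εinf + k * (n - 0))
      simpa only [TQH.initialExp, e, mul_zero, add_zero] using this)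
    (fun e => by
      have := hAB.snd.coeff_fst_eq_zero (Eventually.of_forall fun x => zero_mul _)
        (ε₀ + l * n)
      simpa only [TQH.initialExp, e, Nat.sub_self, mul_zero, add_zero] using this)
  have hk' : (k : ℂ) ≠ 0 := Nat.cast_ne_zero.mpr hk.ne'
  have hl' : (l : ℂ) ≠ 0 := Nat.cast_ne_zero.mpr hl.ne'
  have huv' : (k : ℂ) * u = l * v + 1 := by exact_mod_cast huv
  have hsum : ∀ (g : ℕ × ℕ → ℂ), (∀ P, A P = 0 → B P = 0 → g P = 0) → ∀ z : ℂ × ℂ,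
      ∑ P ∈ TQH.face (k, l) d, g P * (z.1 ^ P.1 * z.2 ^ P.2) = z.1 ^ ε₀ * z.2 ^ εinf *
        ∑ r ∈ Finset.range (n + 1), g (TQH.initialExp k l n ε₀ εinf r) *
          ((z.1 ^ l) ^ r * (z.2 ^ k) ^ (n - r)) := fun g hg z => by
    rw [TQH.sum_face_initialExp h.mem hk hl hd (fun P hA hB => by rw [hg P hA hB, zero_mul]),
      Finset.mul_sum]
    refine Finset.sum_congr rfl fun r _ => ?_
    simp only [TQH.initialExp, pow_add, pow_mul]
    ring
  have hq : ∀ z, TQH.qhPart k l d (TQH.radial k l ω) z = c₀ * TQH.qhFun k l ε₀ εinf c z :=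
    fun z => by
      rw [hAB.qhPart_radial hk hl, hsum _ (fun P hA hB => by simp [TQH.pair, hA, hB]),
        TQH.sum_mul_pow_mul_pow_eq_prod hQ, TQH.qhFun]
      ring
  refine ⟨fun m hm z => hAB.formPart_eq_zero hω.analytic hk hl (fun P hP => ?_) z,
    ⟨c₀, h.ne_zero, hq⟩, fun z hz1 hz2 hD => ?_, ?_⟩
  · by_contra! hne
    have := h.le P (by tauto)
    omega
  · have hY : z.2 ^ k ≠ 0 := pow_ne_zero k hz2
    have hT : ∀ i, 1 - c i * (z.1 ^ l / z.2 ^ k) ≠ 0 := fun i => by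
      rw [show 1 - c i * (z.1 ^ l / z.2 ^ k) = (z.2 ^ k - c i * z.1 ^ l) / z.2 ^ k by field_simp]
      exact div_ne_zero (hD i) hY
    have hev := TQH.eval_residues c lam lam₀ c₀ hT
    rw [← hR, ← hQ] at hev
    have hS : ∑ i, lam i * (c i * (z.1 ^ l / z.2 ^ k) / (1 - c i * (z.1 ^ l / z.2 ^ k))) =
        ∑ i, lam i * (z.2 ^ k - c i * z.1 ^ l)⁻¹ * (c i * z.1 ^ l) :=
      Finset.sum_congr rfl fun i _ => by
        have h2 := hT i
        have h3 := hD i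
        field_simp
    rw [hS] at hev
    set S := ∑ i, lam i * (z.2 ^ k - c i * z.1 ^ l)⁻¹ * (c i * z.1 ^ l) with hSdef
    -- The identity `y^k / (y^k - c x^l) = 1 + c x^l / (y^k - c x^l)` lets one sum `S` serve for
    -- both coefficients.
    have hS' : ∑ i, lam i * (z.2 ^ k - c i * z.1 ^ l)⁻¹ * z.2 ^ k = ∑ i, lam i + S := by
      rw [hSdef, ← Finset.sum_add_distrib]
      refine Finset.sum_congr rfl fun i _ => ?_
      have h3 := hD i
      field_simp
      ring
    have hVsum : ∀ V' : ℕ × ℕ, (V'.1 : ℂ) * (z.1 * (TQH.formPart k l d ω z).1) +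
        V'.2 * (z.2 * (TQH.formPart k l d ω z).2) = z.1 ^ ε₀ * z.2 ^ εinf * ((z.2 ^ k) ^ n *
          (TQH.edgePoly n fun r => TQH.pair V' A B (TQH.initialExp k l n ε₀ εinf r)).eval
            (z.1 ^ l / z.2 ^ k)) := fun V' => by
      rw [← TQH.sum_mul_pow_mul_pow n _ _ hY,
        ← hsum _ (fun P hA hB => by simp [TQH.pair, hA, hB]), hAB.fst_mul_formPart hk hl,
        hAB.snd_mul_formPart hk hl, Finset.mul_sum, Finset.mul_sum, ← Finset.sum_add_distrib]
      exact Finset.sum_congr rfl fun P _ => by rw [TQH.pair]; ring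
    have hqz : TQH.qhPart k l d (TQH.radial k l ω) z = z.1 ^ ε₀ * z.2 ^ εinf * ((z.2 ^ k) ^ n *
          (TQH.edgePoly n fun r => TQH.pair (k, l) A B (TQH.initialExp k l n ε₀ εinf r)).eval
            (z.1 ^ l / z.2 ^ k)) := by
      rw [hAB.qhPart_radial hk hl, hsum _ (fun P hA hB => by simp [TQH.pair, hA, hB]),
        TQH.sum_mul_pow_mul_pow n _ _ hY]
    have e1 := hVsum (k, l)
    have e2 := hVsum (k - v, l - u)
    rw [← hqz] at e1
    rw [hev, mul_left_comm ((z.2 ^ k) ^ n), mul_left_comm (z.1 ^ ε₀ * z.2 ^ εinf), ← hqz] at e2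
    simp only [Nat.cast_sub hu, Nat.cast_sub hv] at e2
    rw [h0]
    set q := TQH.qhPart k l d (TQH.radial k l ω) z
    set p := TQH.formPart k l d ω z
    -- The contractions with `(k, l)` and `(k - v, l - u)` form a system of determinant one for `x
    -- a` and `y b`; for the second unknown the sum relation `h1` eliminates `lam₀`.
    have hp1 : z.1 * p.1 = -q * (-l * S + (l * (lam₀ + 1) - u)) := by
      linear_combination (l : ℂ) * e2 - (l - u : ℂ) * e1 - z.1 * p.1 * huv'
    have hp2 : z.2 * p.2 = -q * (k * (∑ i, lam i + S) + εinf * (k * laminf + v)) := by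
      linear_combination (-k : ℂ) * e2 + (k - v : ℂ) * e1 - z.2 * p.2 * huv' + q * h1
    refine ContinuousLinearMap.ext fun w => ?_
    have hdl : ∀ i, lam i * TQH.dlog (fun w => w.2 ^ k - c i * w.1 ^ l) z w =
        k * w.2 / z.2 * (lam i * (z.2 ^ k - c i * z.1 ^ l)⁻¹ * z.2 ^ k) -
          l * w.1 / z.1 * (lam i * (z.2 ^ k - c i * z.1 ^ l)⁻¹ * (c i * z.1 ^ l)) := fun i => by
      rw [TQH.dlog_cusp]
      have f1 := TQH.natCast_mul_pow_pred k z.2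
      have f2 := TQH.natCast_mul_pow_pred l z.1
      have g1 : (k : ℂ) * z.2 ^ (k - 1) = k * z.2 ^ k / z.2 := by
        rw [eq_div_iff hz2, mul_comm, f1]
      have g2 : (l : ℂ) * z.1 ^ (l - 1) = l * z.1 ^ l / z.1 := by
        rw [eq_div_iff hz1, mul_comm, f2]
      rw [g1, g2]
      ring
    simp only [_root_.smul_apply, _root_.add_apply,
      _root_.sum_apply, smul_eq_mul, TQH.dlog_fst, TQH.dlog_snd, hdl,
      Finset.sum_sub_distrib, ← Finset.mul_sum, hS', ← hSdef, TQH.covector,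
      ContinuousLinearMap.coe_fst', ContinuousLinearMap.coe_snd']
    field_simp
    linear_combination z.2 * w.1 * hp1 + z.1 * w.2 * hp2
  · have : (ε₀ : ℂ) * (lam₀ + ((l : ℂ) - u) / l) = lam₀ + ((l : ℂ) - u) / l := by
      field_simp
      linear_combination h0
    rw [this]
    field_simp
    -- The Bézout relation converts `h1`, divided by `k`, into the symmetric form with the term `1 /
    -- (k l)`.
    linear_combination (l : ℂ) * h1 - huv'
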